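/- **Setting.** Let $d,q\ge 1$ be integers, $a>0$, $0<s\le 1$. Let $g$ be a real function that is $C^q$ on $[-a,a]^d$, all of whose partial derivatives of order at most $q$ are bounded by a constant $\mathtt c$ on $[-a,a]^d$, and whose partial derivatives of order $q$ satisfy $|\partial^{\alpha}g(\mathbf x)-\partial^{\alpha}g(\mathbf z)|\le\mathscr C\|\mathbf x-\mathbf z\|^{s}$ there. *Data.* Let $(\mathbf x_t,\varepsilon_t)_{t\in\mathbb Z}$ be a strictly stationary process in $\mathbb R^d\times\mathbb R$ whose $\alpha$-mixing coefficients $\alpha(t)=\sup\{|P(A)P(B)-P(AB)|: A\in\mathcal F_{-\infty}^0,\ B\in\mathcal F_t^\infty\}$ satisfy $\sum_{t\ge1}\alpha(t)^{\nu/(2+\nu)}<\infty$ for some $\nu>0$, where $\mathcal F_{-\infty}^0$ and $\mathcal F_t^\infty$ are generated by $(\mathbf x_r,\varepsilon_r)_{r\le 0}$ and $(\mathbf x_r,\varepsilon_r)_{r\ge t}$. Let $\mathbf x_1$ have a density that is Lipschitz and bounded away from $0$ and $\infty$ on $[-a,a]^d$. Let $\varepsilon_1$ be independent of $\mathbf x_1$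 and have a density; let $\Phi_\varepsilon$ be its (known) distribution function, and suppose that $[1-\Phi_\varepsilon(g(\mathbf x))]\Phi_\varepsilon(g(\mathbf x))\ge\kappa$ on $[-a,a]^d$ for some $\kappa>0$. Let $y_t=1$ if $g(\mathbf x_t)-\varepsilon_t\ge0$ and $y_t=0$ otherwise. For a sample size $T$ let $\mathcal T=\{t\in\{1,\dots,T\}:\mathbf x_t\in[-a,a]^d\}$, which is $\{1,\dots,T\}$ when the regressors take values in the domain $[-a,a]^d$ of $g$. *Network.* Let $\sigma:\mathbb R\to[0,1]$ be $q+1$ times continuously differentiable with bounded derivatives, and let $u_\sigma\in\mathbb R$ be such that $\sigma^{(k)}(u_\sigma)\ne0$ for $1\le k\le q$. Put $d_q=\binom{d+q}{d}$, $\gamma_k=\frac{(-1)^{q+k-1}}{\sigma^{(q)}(u_\sigma)}\binom{q}{k-1}$ and $\beta_k=k-1$ for $1\le k\le q+1$. Let $\mathbf W=(\mathbf w_1,\dots,\mathbf w_{d_q})$ be a fixed $(d+1)\times d_q$ matrix with distinct columns of norm at most $\sqrt{d+1}$ such that the polynomials $[(1,\mathbf x^\top)\mathbf w_j]^q$ are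 linearly independent. For $h>0$ and $\boldsymbol\theta\in\mathbb R^{d_q}$ let $$s(\mathbf x\,|\,\mathbf x_0,\boldsymbol\theta)=\sum_{j=1}^{d_q}\sum_{k=1}^{q+1}\theta_j\gamma_k\,\sigma\!\Big(\tfrac{\beta_k}{d+1}\,(h,\ \mathbf x^\top-\mathbf x_0^\top)\,\mathbf w_j+u_\sigma\Big).$$ For an integer $M=M_T\ge1$ let $h=a/M$, divide $[-a,a]^d$ into the $M^d$ closed cubes $C_{\mathbf i}$, $\mathbf i\in[M]^d$, of centre $\mathbf x_{0\mathbf i}$ and side $2h$, and for $\boldsymbol\Theta=\{\boldsymbol\theta_{\mathbf i}\}$ with $\boldsymbol\theta_{\mathbf i}\in\mathbb R^{d_q}$ let $\widetilde s(\mathbf x\,|\,\boldsymbol\Theta)=\sum_{\mathbf i}I(\mathbf x\in C_{\mathbf i})\,s(\mathbf x\,|\,\mathbf x_{0\mathbf i},\boldsymbol\theta_{\mathbf i})$. Suppose that $h\to0$ and $Th^d\to\infty$ as $T\to\infty$. *Estimator.* Let $B\in[0,\infty]$ with $\sup_{[-a,a]^d}|g|\le B$. The candidates are those $\boldsymbol\Theta$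 for which $|s(\mathbf x\,|\,\mathbf x_{0\mathbf i},\boldsymbol\theta_{\mathbf i})|\le B$ for all $\mathbf i$ and $\mathbf x\in C_{\mathbf i}$; for $B=\infty$ all $\boldsymbol\Theta$ are candidates. Let $\widehat{\boldsymbol\Theta}$ be, with probability tending to one, a maximum likelihood estimator, i.e. a candidate that maximizes over the candidates $$\sum_{t\in\mathcal T}\Big\{(1-y_t)\log[1-\Phi_\varepsilon(\widetilde s(\mathbf x_t|\boldsymbol\Theta))]+y_t\log\Phi_\varepsilon(\widetilde s(\mathbf x_t|\boldsymbol\Theta))\Big\}\qquad(\log 0=-\infty).$$ **Lemma 3.4.** As $T\to\infty$, $$\frac1T\sum_{t\in\mathcal T}\big[\Phi_\varepsilon(g(\mathbf x_t))-\Phi_\varepsilon(\widetilde s(\mathbf x_t\,|\,\widehat{\boldsymbol\Theta}))\big]^2=o_P(1).$$ Consequently, if $B<\infty$ and if, for every $\mathbf x\in[-a,a]^d$, $\Phi_\varepsilon$ takes the value $\Phi_\varepsilon(g(\mathbf x))$ only at $g(\mathbf x)$, then also $$\frac1T\sum_{t\in\mathcal T}\big(g(\mathbf x_t)-\widetilde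 s(\mathbf x_t\,|\,\widehat{\boldsymbol\Theta})\big)^2=o_P(1).$$ -/

import Mathlib

open MeasureTheory ProbabilityTheory Filter Topology
open scoped ENNReal

noncomputable section

namespace LNN

/-- Points of `ℝ^d`, with the Euclidean norm. -/
abbrev Pt (d : ℕ) : Type := EuclideanSpace ℝ (Fin d)

/-- The cube `[-a, a]^d`. -/
def box (d : ℕ) (a : ℝ) : Set (Pt d) := {x | ∀ j, |x j| ≤ a}

/-- The small cube `C_{x₀,h} = {x | |x_j - x_{0,j}| ≤ h for all j}`. -/
def cube {d : ℕ} (x₀ : Pt d) (h : ℝ) : Set (Pt d) := {x | ∀ j, |x j - x₀ j| ≤ h}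

/-! ### Smoothness of the regression function -/

/-- The partial derivative `∂_{w 0} ⋯ ∂_{w (k-1)} g (x)` of order `k` of a function on `[-a, a]^d`
(one-sided on the boundary).  As `w` runs over `Fin k → Fin d` these are all the partial
derivatives `∂^{|α|} g / ∂x^α` with `|α| = k`. -/
def partialDeriv {d k : ℕ} (a : ℝ) (g : Pt d → ℝ) (w : Fin k → Fin d) (x : Pt d) : ℝ :=
  iteratedFDerivWithin ℝ k g (box d a) x (fun i => EuclideanSpace.single (w i) (1 : ℝ))

/-- `g` is `(q + s, C)`-smooth on `[-a, a]^d`, and all its partial derivatives of order at most `q`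
are bounded by `c` there.  Nothing is asked of `g` outside of `[-a, a]^d`. -/
structure IsSmooth {d : ℕ} (a : ℝ) (q : ℕ) (s C c : ℝ) (g : Pt d → ℝ) : Prop where
  contDiffOn : ContDiffOn ℝ (q : ℕ∞) g (box d a)
  holder : ∀ w : Fin q → Fin d, ∀ x ∈ box d a, ∀ z ∈ box d a,
    |partialDeriv a g w x - partialDeriv a g w z| ≤ C * ‖x - z‖ ^ s
  bounded : ∀ k ≤ q, ∀ w : Fin k → Fin d, ∀ x ∈ box d a, |partialDeriv a g w x| ≤ c

/-! ### The activation function and the network -/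

/-- The activation function `σ : ℝ → [0, 1]` is `q + 1` times continuously differentiable with
bounded derivatives, and its derivatives of orders `1, …, q` do not vanish at `u`. -/
structure IsActivation (q : ℕ) (σ : ℝ → ℝ) (u : ℝ) : Prop where
  mem_Icc : ∀ x, σ x ∈ Set.Icc (0 : ℝ) 1
  contDiff : ContDiff ℝ ((q + 1 : ℕ) : ℕ∞) σ
  bounded : ∃ K : ℝ, ∀ k, 1 ≤ k → k ≤ q + 1 → ∀ x, |iteratedDeriv k σ x| ≤ K
  deriv_ne_zero : ∀ k, 1 ≤ k → k ≤ q → iteratedDeriv k σ u ≠ 0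

/-- `d_q = binom (d + q) d`, the dimension of the space of polynomials of degree at most `q` in
`d` variables. -/
abbrev dimPoly (d q : ℕ) : ℕ := (d + q).choose d

/-- The user-chosen matrix `W`: its columns `w_j` are pairwise distinct and of norm at most
`√(d + 1)`, and the `d_q` polynomials `[(1, xᵀ) w_j]^q` are linearly independent, i.e. a basis of
the polynomials of degree at most `q` (so that the rotation matrix from them to the monomials
exists and has full rank). -/
structure IsDesign {d q : ℕ} (W : Matrix (Fin (d + 1)) (Fin (dimPoly d q)) ℝ) : Prop where
  norm_le : ∀ j, Real.sqrt (∑ l, W l j ^ 2) ≤ Real.sqrt (d + 1)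
  distinct : ∀ j₁ j₂, j₁ ≠ j₂ → (fun l => W l j₁) ≠ (fun l => W l j₂)
  basis : LinearIndependent ℝ
    (fun (j : Fin (dimPoly d q)) (x : Pt d) => (W 0 j + ∑ l, x l * W l.succ j) ^ q)

/-- `γ_{k+1} = (-1)^{q+k} binom q k / σ^{(q)}(u)`, for `k = 0, …, q`. -/
def gammaCoef (q : ℕ) (σ : ℝ → ℝ) (u : ℝ) (k : Fin (q + 1)) : ℝ :=
  (-1) ^ (q + (k : ℕ)) * (q.choose k : ℝ) / iteratedDeriv q σ u

/-- `β_{k+1} = k`, for `k = 0, …, q`. -/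
def betaCoef {q : ℕ} (k : Fin (q + 1)) : ℝ := ((k : ℕ) : ℝ)

/-- The column of `diag(h, I_d) W (I_{d_q} ⊗ βᵀ) / (d + 1) + (u, 0_d)ᵀ ⊗ 1ᵀ` with index
`(j, k)`. -/
def piCol {d q : ℕ} (W : Matrix (Fin (d + 1)) (Fin (dimPoly d q)) ℝ) (u h : ℝ)
    (j : Fin (dimPoly d q)) (k : Fin (q + 1)) : Fin (d + 1) → ℝ :=
  Fin.cons (h * W 0 j * betaCoef k / (d + 1) + u)
    (fun l : Fin d => W l.succ j * betaCoef k / (d + 1))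

/-- The neuron `σ([1, xᵀ - x₀ᵀ] π)`. -/
def neuron {d : ℕ} (σ : ℝ → ℝ) (x₀ x : Pt d) (π : Fin (d + 1) → ℝ) : ℝ :=
  σ (π 0 + ∑ l : Fin d, (x l - x₀ l) * π l.succ)

/-- The local network `s(x | x₀, θ) = (θ ⊗ γ)ᵀ σ(x | x₀)`. -/
def localNet {d q : ℕ} (σ : ℝ → ℝ) (u : ℝ) (W : Matrix (Fin (d + 1)) (Fin (dimPoly d q)) ℝ)
    (h : ℝ) (x₀ : Pt d) (θ : Fin (dimPoly d q) → ℝ) (x : Pt d) : ℝ :=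
  ∑ j, ∑ k : Fin (q + 1), θ j * gammaCoef q σ u k * neuron σ x₀ x (piCol W u h j k)

/-- The centre `x_{0i}` of the small cube with index `i`, when `[-a, a]^d` is divided into `M^d`
cubes `C_{x_{0i},h}` with `h = a / M`. -/
def center {d M : ℕ} (a : ℝ) (i : Fin d → Fin M) : Pt d :=
  WithLp.toLp 2 (fun j => -a + (2 * ((i j : ℕ) : ℝ) + 1) * (a / M))

/-- The parameters `Θ = {θ_i | i ∈ [M]^d}` of a network. -/
abbrev Param (d q M : ℕ) : Type := (Fin d → Fin M) → Fin (dimPoly d q) → ℝ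

open Classical in
/-- The localized network `s̃(x | Θ) = ∑_i I(x ∈ C_{x_{0i},h}) s(x | x_{0i}, θ_i)`,
`h = a / M`. -/
def net {d q M : ℕ} (a : ℝ) (σ : ℝ → ℝ) (u : ℝ)
    (W : Matrix (Fin (d + 1)) (Fin (dimPoly d q)) ℝ) (Θ : Param d q M) (x : Pt d) : ℝ :=
  ∑ i : Fin d → Fin M,
    if x ∈ cube (center a i) (a / M) then localNet σ u W (a / M) (center a i) (Θ i) x else 0

/-- The parameters for which every local network is bounded by `B` on its cube.  For `B = ∞` these
are all parameters. -/
def candidates {d q : ℕ} (M : ℕ) (a : ℝ) (σ : ℝ → ℝ) (u : ℝ)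
    (W : Matrix (Fin (d + 1)) (Fin (dimPoly d q)) ℝ) (B : ℝ≥0∞) : Set (Param d q M) :=
  {Θ | ∀ i, ∀ x ∈ cube (center a i) (a / M),
    ‖localNet σ u W (a / M) (center a i) (Θ i) x‖ₑ ≤ B}

/-! ### The data -/

section TimeSeries

variable {Ω : Type*} [MeasurableSpace Ω] {S : Type*} [MeasurableSpace S]

/-- Strict stationarity: the law of the whole path does not change under time shifts. -/
def IsStrictlyStationary (μ : Measure Ω) (Z : ℤ → Ω → S) : Prop :=
  ∀ k : ℤ, μ.map (fun ω t => Z (t + k) ω) = μ.map (fun ω t => Z t ω)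

/-- The `σ`-algebra generated by `Z_s`, `s ≤ 0`. -/
abbrev sigmaPast (Z : ℤ → Ω → S) : MeasurableSpace Ω :=
  ⨆ s : {s : ℤ // s ≤ 0}, MeasurableSpace.comap (Z s) inferInstance

/-- The `σ`-algebra generated by `Z_s`, `s ≥ t`. -/
abbrev sigmaFuture (Z : ℤ → Ω → S) (t : ℤ) : MeasurableSpace Ω :=
  ⨆ s : {s : ℤ // t ≤ s}, MeasurableSpace.comap (Z s) inferInstance

/-- The `α`-mixing coefficient
`α(t) = sup {|P(A) P(B) - P(A ∩ B)| : A ∈ F_{-∞}^0, B ∈ F_t^∞}`. -/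
def alphaMixing (μ : Measure Ω) (Z : ℤ → Ω → S) (t : ℕ) : ℝ :=
  sSup {r | ∃ A B : Set Ω, MeasurableSet[sigmaPast Z] A ∧ MeasurableSet[sigmaFuture Z t] B ∧
    r = |μ.real A * μ.real B - μ.real (A ∩ B)|}

end TimeSeries

section Model

variable {Ω : Type*} [MeasurableSpace Ω] {d : ℕ}

/-- Assumptions on the process `(x_t, ε_t)`, `t ∈ ℤ`: it is strictly stationary and `α`-mixing
with `∑_t α(t)^{ν/(2+ν)} < ∞` for some `ν > 0`; `x_1` has the density `f`, which on `[-a, a]^d` is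
Lipschitz continuous and bounded away from `0` and `∞`; and `ε_1` has the density `φ` and is
independent of `x_1`. -/
structure IsDataProcess (μ : Measure Ω) (a : ℝ) (X : ℤ → Ω → Pt d) (ε : ℤ → Ω → ℝ)
    (f : Pt d → ℝ) (φ : ℝ → ℝ) : Prop where
  measurable_X : ∀ t, Measurable (X t)
  measurable_ε : ∀ t, Measurable (ε t)
  stationary : IsStrictlyStationary μ (fun t ω => (X t ω, ε t ω))
  mixing : ∃ ν : ℝ, 0 < ν ∧
    Summable fun t : ℕ => alphaMixing μ (fun t ω => (X t ω, ε t ω)) (t + 1) ^ (ν / (2 + ν))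
  measurable_f : Measurable f
  nonneg_f : ∀ x, 0 ≤ f x
  law_X : μ.map (X 1) = volume.withDensity (fun x => ENNReal.ofReal (f x))
  lipschitz_f : ∃ K : NNReal, LipschitzOnWith K f (box d a)
  bounds_f : ∃ c₁ c₂ : ℝ, 0 < c₁ ∧ ∀ x ∈ box d a, c₁ ≤ f x ∧ f x ≤ c₂
  measurable_φ : Measurable φ
  nonneg_φ : ∀ v, 0 ≤ φ v
  law_ε : μ.map (ε 1) = volume.withDensity (fun v => ENNReal.ofReal (φ v))
  indep : IndepFun (X 1) (ε 1) μ

/-- The distribution function `Φ_ε` of the errors. -/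
def errorCDF (μ : Measure Ω) (ε : ℤ → Ω → ℝ) (v : ℝ) : ℝ := cdf (μ.map (ε 1)) v

open Classical in
/-- The binary outcome: `y_t = 1` if `g(x_t) - ε_t ≥ 0`, and `y_t = 0` otherwise. -/
def outcome (g : Pt d → ℝ) (X : ℤ → Ω → Pt d) (ε : ℤ → Ω → ℝ) (t : ℤ) (ω : Ω) : ℕ :=
  if 0 ≤ g (X t ω) - ε t ω then 1 else 0

open Classical in
/-- The observation times `t ∈ {1, …, T}` with `x_t ∈ [-a, a]^d`, the domain of `g`.  If
`x_t ∈ [-a, a]^d` for all `t`, this is `{1, …, T}`. -/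
def sampleTimes (a : ℝ) (X : ℤ → Ω → Pt d) (T : ℕ) (ω : Ω) : Finset ℕ :=
  (Finset.Icc 1 T).filter (fun t => X t ω ∈ box d a)

/-- The likelihood `L(r) = ∏_t [1 - Φ_ε(r(x_t))]^{1-y_t} Φ_ε(r(x_t))^{y_t}` of a candidate `r`.
Maximizing it is the same as maximizing `log L`, with `log 0 = -∞`. -/
def likelihood (μ : Measure Ω) (a : ℝ) (g : Pt d → ℝ) (X : ℤ → Ω → Pt d) (ε : ℤ → Ω → ℝ)
    (T : ℕ) (ω : Ω) (r : Pt d → ℝ) : ℝ :=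
  ∏ t ∈ sampleTimes a X T ω,
    (1 - errorCDF μ ε (r (X t ω))) ^ (1 - outcome g X ε t ω) *
      errorCDF μ ε (r (X t ω)) ^ outcome g X ε t ω

/-- `Θ` is a maximum likelihood estimate, at the sample point `ω`, among the candidates with
bound `B`. -/
def IsMLE {q M : ℕ} (μ : Measure Ω) (a : ℝ) (g : Pt d → ℝ) (X : ℤ → Ω → Pt d) (ε : ℤ → Ω → ℝ)
    (σ : ℝ → ℝ) (u : ℝ) (W : Matrix (Fin (d + 1)) (Fin (dimPoly d q)) ℝ) (B : ℝ≥0∞)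
    (T : ℕ) (ω : Ω) (Θ : Param d q M) : Prop :=
  Θ ∈ candidates M a σ u W B ∧
    ∀ Θ' ∈ candidates M a σ u W B,
      likelihood μ a g X ε T ω (net a σ u W Θ') ≤ likelihood μ a g X ε T ω (net a σ u W Θ)

end Model

end LNN

end

/-! Let `G`, `P` and `Q` denote `Φ_ε` at the regression function, at the estimate and at a fixed
candidate, along the sample. The estimate has at least the likelihood of any candidate. If `Q` is
within `δ` of `G`, the quadratic bound for the logarithm `log_le_sub_one_sub_sq` turns this into
`κ/4 ∑ (P - G)² ≤ ∑ (P - G) ζ + 2δT/κ`, where `ζ = (y - G) / (G (1 - G))` is the score, which is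
bounded and has mean zero given the regressor (`sum_sq_le_of_likelihood_le`). Such a `Q` exists
because constants lie in the span of the polynomials to which the network blocks converge, so that
local networks can be nearly constant, equal to about `g` at the centre of their cube
(`exists_candidate_close`).

The difficulty is to bound `∑ P ζ` uniformly over an unbounded parameter set. In the rescaled
coordinate of a cube, a local network is a linear combination of a few functions close to linearly
independent polynomials. If the coefficients are moderate, `Φ_ε` of it is nearly constant on small
subcells. If they are large, it is saturated near `0` or `1` except where the normalized polynomial
is small, and this happens on uniformly little volume, by compactness of the unit sphere and nullity
of zero sets. So with a fixed number `m ^ d` of subcells per cube, `P` is nearly constant on all but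
a small fraction of them, whatever the parameter (`exists_grid_oscillation`).

Therefore `∑ P ζ` is at most the sum over all cells of `|∑ ζ|`, plus a small multiple of `T`, plus a
multiple of the number of observations in bad cells (`sum_mul_le_sum_abs_add`). The first and last
terms are governed by deviations of cell sums from their means. The variances of the cell sums add
up to `O(T)`, uniformly in the number of cells: a trace of cross-covariances is at most one
covariance of a signed sum, which is bounded because the cells are disjoint, and mixing controls
that covariance. Cauchy–Schwarz and Markov then leave a probability of order (number of cells) /
`T`, that is `1 / (T h ^ d)`, which tends to zero (`measureReal_sum_abs_ge_le`).

For the second claim, injectivity of `Φ_ε` at the values of `g` and compactness make an error in the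
value visible as an error in the probability, uniformly for values bounded by `B`. -/

noncomputable section

namespace LNN

/-! ### Covariance inequality for bounded functions of two σ-algebras. -/

section Covariance

variable {Ω : Type*} {m0 : MeasurableSpace Ω} {μ : Measure Ω} [IsProbabilityMeasure μ]

/-- The `±1`-valued function which is `1` exactly on `A`. -/
def signOn (A : Set Ω) (ω : Ω) : ℝ := 2 * A.indicator 1 ω - 1

lemma abs_signOn_le (A : Set Ω) (ω : Ω) : |signOn A ω| ≤ 1 := by
  by_cases h : ω ∈ A <;> simp [signOn, h]; norm_num

lemma measurable_signOn {m : MeasurableSpace Ω} {A : Set Ω} (hA : MeasurableSet[m] A) :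
    Measurable[m] (signOn A) :=
  ((measurable_one.indicator hA).const_mul 2).sub_const 1

lemma integrable_of_measurable_abs_le {f : Ω → ℝ} (hf : Measurable[m0] f) {K : ℝ}
    (hK : ∀ ω, |f ω| ≤ K) : Integrable f μ :=
  .of_bound hf.aestronglyMeasurable K (ae_of_all _ hK)

/-- Replacing a bounded function by a sign can only increase a covariance. -/
lemma exists_abs_cov_le_signOn {m : MeasurableSpace Ω} (hm : m ≤ m0) {f g : Ω → ℝ} {K L : ℝ}
    (hf : Measurable[m] f) (hK : ∀ ω, |f ω| ≤ K) (hg : Measurable[m0] g) (hL : ∀ ω, |g ω| ≤ L) :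
    ∃ A, MeasurableSet[m] A ∧ |∫ ω, f ω * g ω ∂μ - (∫ ω, f ω ∂μ) * ∫ ω, g ω ∂μ| ≤
      K * |∫ ω, signOn A ω * g ω ∂μ - (∫ ω, signOn A ω ∂μ) * ∫ ω, g ω ∂μ| := by
  have hgi : Integrable g μ := integrable_of_measurable_abs_le hg hL
  set b := ∫ ω, g ω ∂μ with hb
  set v : Ω → ℝ := μ[g|m] with hv
  have hvm : StronglyMeasurable[m] v := stronglyMeasurable_condExp
  have hvi : Integrable v μ := integrable_condExp
  -- Conditioning replaces `g` by `v = E[g | m]`, so the covariance is linear in `f` with density `v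
  -- - b`. Among functions bounded by `K` it is extremal at `K` times the sign of `v - b`, which is
  -- why `A` is `{b ≤ v}`.
  have key : ∀ {f : Ω → ℝ} {K : ℝ}, Measurable[m] f → (∀ ω, |f ω| ≤ K) →
      ∫ ω, f ω * g ω ∂μ - (∫ ω, f ω ∂μ) * b = ∫ ω, f ω * (v ω - b) ∂μ := by
    intro f K hf hK
    have hf0 : Measurable[m0] f := hf.mono hm le_rfl
    have hfg : Integrable (f * g) μ := hgi.bdd_mul hf0.aestronglyMeasurable (ae_of_all _ hK)
    have hfv : Integrable (fun ω => f ω * v ω) μ :=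
      hvi.bdd_mul hf0.aestronglyMeasurable (ae_of_all _ hK)
    have hfi : Integrable f μ := integrable_of_measurable_abs_le hf0 hK
    have h1 : ∫ ω, f ω * g ω ∂μ = ∫ ω, f ω * v ω ∂μ :=
      (integral_condExp (f := f * g) hm).symm.trans (integral_congr_ae
        (condExp_mul_of_stronglyMeasurable_left hf.stronglyMeasurable hfg hgi))
    rw [h1, ← integral_mul_const, ← integral_sub hfv (hfi.mul_const b)]
    simp_rw [mul_sub]
  have hAm : MeasurableSet[m] {ω | b ≤ v ω} :=
    @measurableSet_le _ _ _ _ _ m _ _ _ _ _ measurable_const hvm.measurable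
  refine ⟨{ω | b ≤ v ω}, hAm, ?_⟩
  rw [key hf hK, key (measurable_signOn hAm) (abs_signOn_le _)]
  have hs : ∀ ω, signOn {ω | b ≤ v ω} ω * (v ω - b) = |v ω - b| := by
    intro ω
    by_cases h : b ≤ v ω
    · simp only [signOn, Set.indicator, Set.mem_ofPred_eq, h, if_true, Pi.one_apply]
      rw [abs_of_nonneg (by linarith)]; ring
    · simp only [signOn, Set.indicator, Set.mem_ofPred_eq, h, if_false]
      rw [abs_of_neg (by linarith)]; ring
  simp_rw [hs]
  have hui : Integrable (fun ω => |v ω - b|) μ := (hvi.sub (integrable_const b)).abs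
  have hu0 : 0 ≤ ∫ ω, |v ω - b| ∂μ := integral_nonneg fun ω => abs_nonneg (v ω - b)
  rw [abs_of_nonneg hu0, ← integral_const_mul]
  refine (abs_integral_le_integral_abs (f := fun ω => f ω * (v ω - b))).trans
    (integral_mono_of_nonneg (ae_of_all _ fun ω => abs_nonneg (f ω * (v ω - b)))
      (hui.const_mul K) (ae_of_all _ fun ω => ?_))
  simp only [abs_mul]
  exact mul_le_mul_of_nonneg_right (hK ω) (abs_nonneg _)

lemma integral_signOn {A : Set Ω} (hA : MeasurableSet A) :
    ∫ ω, signOn A ω ∂μ = 2 * μ.real A - 1 := by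
  have hi : Integrable (A.indicator (1 : Ω → ℝ)) μ := (integrable_const (1 : ℝ)).indicator hA
  unfold signOn
  rw [integral_sub (hi.const_mul 2) (integrable_const 1), integral_const_mul,
    integral_indicator_one hA]
  simp

/-- The covariance inequality for bounded functions. -/
lemma abs_cov_le_of_mixing {m₁ m₂ : MeasurableSpace Ω} (h₁ : m₁ ≤ m0) (h₂ : m₂ ≤ m0)
    {f g : Ω → ℝ} {K L r : ℝ} (hf : Measurable[m₁] f) (hK : ∀ ω, |f ω| ≤ K)
    (hg : Measurable[m₂] g) (hL : ∀ ω, |g ω| ≤ L)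
    (hr : ∀ A B, MeasurableSet[m₁] A → MeasurableSet[m₂] B →
      |μ.real A * μ.real B - μ.real (A ∩ B)| ≤ r) :
    |∫ ω, f ω * g ω ∂μ - (∫ ω, f ω ∂μ) * ∫ ω, g ω ∂μ| ≤ 4 * K * L * r := by
  have : Nonempty Ω := μ.nonempty_of_neZero
  have hK0 : 0 ≤ K := (abs_nonneg _).trans (hK this.some)
  have hL0 : 0 ≤ L := (abs_nonneg _).trans (hL this.some)
  -- First `f` is replaced by a sign, then `g`. The covariance of two signs is `4 (P(A ∩ B) - P(A)
  -- P(B))`, the source of the constant `4`.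
  obtain ⟨A, hA, hfA⟩ := exists_abs_cov_le_signOn (μ := μ) h₁ hf hK (hg.mono h₂ le_rfl) hL
  have hA0 : MeasurableSet[m0] A := h₁ _ hA
  obtain ⟨B, hB, hgB⟩ := exists_abs_cov_le_signOn (μ := μ) h₂ hg hL (measurable_signOn hA0)
    (abs_signOn_le A)
  have hB0 : MeasurableSet[m0] B := h₂ _ hB
  have hprod : ∫ ω, signOn B ω * signOn A ω ∂μ =
      4 * μ.real (A ∩ B) - 2 * μ.real A - 2 * μ.real B + 1 := by
    have e : ∀ ω, signOn B ω * signOn A ω =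
        2 * signOn (A ∩ B) ω - signOn A ω - signOn B ω + 1 := by
      intro ω
      by_cases ha : ω ∈ A <;> by_cases hb : ω ∈ B <;> simp [signOn, ha, hb] <;> norm_num
    have hi : ∀ {C : Set Ω}, MeasurableSet[m0] C → Integrable (signOn C) μ := fun hC =>
      integrable_of_measurable_abs_le (measurable_signOn hC) (abs_signOn_le _)
    have hAB := hA0.inter hB0
    simp_rw [e]
    rw [integral_add (by exact (((hi hAB).const_mul 2).sub (hi hA0)).sub (hi hB0))
        (integrable_const 1),
      integral_sub (by exact ((hi hAB).const_mul 2).sub (hi hA0)) (hi hB0),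
      integral_sub ((hi hAB).const_mul 2) (hi hA0), integral_const_mul, integral_signOn hAB,
      integral_signOn hA0, integral_signOn hB0]
    simp
    ring
  have hcomm : |∫ ω, signOn A ω * g ω ∂μ - (∫ ω, signOn A ω ∂μ) * ∫ ω, g ω ∂μ| ≤ L * (4 * r) := by
    simp_rw [mul_comm (signOn A _), mul_comm (∫ ω, signOn A ω ∂μ)]
    refine hgB.trans (mul_le_mul_of_nonneg_left ?_ hL0)
    rw [hprod, integral_signOn hA0, integral_signOn hB0,
      show 4 * μ.real (A ∩ B) - 2 * μ.real A - 2 * μ.real B + 1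
        - (2 * μ.real B - 1) * (2 * μ.real A - 1)
        = -(4 * (μ.real A * μ.real B - μ.real (A ∩ B))) by ring, abs_neg, abs_mul]
    simpa using hr A B hA hB
  calc _ ≤ K * (L * (4 * r)) := hfA.trans (mul_le_mul_of_nonneg_left hcomm hK0)
    _ = _ := by ring

end Covariance

/-! ### Choice of signs for a quadratic form. -/

/-- The trace of a quadratic form is at most some value of the form at a vector of signs. -/
lemma exists_signs_sum_diag_le {κ : Type*} [DecidableEq κ] (S : Finset κ) (c : κ → κ → ℝ) :
    ∃ s : κ → ℝ, (∀ i, |s i| = 1) ∧ ∑ i ∈ S, c i i ≤ ∑ i ∈ S, ∑ j ∈ S, s i * s j * c i j := by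
  induction S using Finset.induction_on with
  | empty => exact ⟨fun _ => 1, by simp, by simp⟩
  | insert k S hk ih =>
    obtain ⟨s, hs, hle⟩ := ih
    have h2 : ∀ i, s i * s i = 1 := fun i => by rw [← abs_mul_abs_self, hs i, one_mul]
    -- The new sign is chosen to make the cross terms between `k` and the old indices nonnegative in
    -- total; the diagonal term is unaffected since `e * e = 1`.
    obtain ⟨e, he, hpos⟩ : ∃ e : ℝ, |e| = 1 ∧ 0 ≤ e * ∑ j ∈ S, s j * (c k j + c j k) := by
      rcases le_total 0 (∑ j ∈ S, s j * (c k j + c j k)) with h | h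
      · exact ⟨1, by simp, by simpa⟩
      · exact ⟨-1, by simp, by simpa⟩
    have hee : e * e = 1 := by rw [← abs_mul_abs_self, he, one_mul]
    refine ⟨Function.update s k e, fun i => ?_, ?_⟩
    · by_cases h : i = k
      · subst h; simpa
      · simp [h, hs]
    · have hne : ∀ j ∈ S, Function.update s k e j = s j := fun j hj =>
        Function.update_of_ne (by rintro rfl; exact hk hj) _ _
      have h1 : ∀ i, ∑ j ∈ S, s i * Function.update s k e j * c i j
          = ∑ j ∈ S, s i * s j * c i j :=
        fun i => Finset.sum_congr rfl fun j hj => by rw [hne j hj]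
      have h3 : ∑ i ∈ S, ∑ j ∈ insert k S,
          Function.update s k e i * Function.update s k e j * c i j =
          ∑ i ∈ S, (s i * e * c i k + ∑ j ∈ S, s i * s j * c i j) :=
        Finset.sum_congr rfl fun i hi => by
          rw [Finset.sum_insert hk, hne i hi, h1]; simp
      rw [Finset.sum_insert hk, Finset.sum_insert hk, h3, Finset.sum_add_distrib,
        Finset.sum_insert hk]
      have h4 : ∑ j ∈ S, Function.update s k e k * Function.update s k e j * c k j
          = ∑ j ∈ S, e * (s j * c k j) :=
        Finset.sum_congr rfl fun j hj => by rw [hne j hj]; simp; ring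
      rw [h4]
      have h5 : e * ∑ j ∈ S, s j * (c k j + c j k) =
          ∑ j ∈ S, e * (s j * c k j) + ∑ i ∈ S, s i * e * c i k := by
        rw [Finset.mul_sum, ← Finset.sum_add_distrib]
        exact Finset.sum_congr rfl fun j _ => by ring
      simp only [Function.update_self, hee, one_mul]
      linarith

/-! ### Mixing coefficients and deviations of sums over a partition. -/

section Mixing

variable {Ω : Type*} [MeasurableSpace Ω] {μ : Measure Ω}
  {S : Type*} [MeasurableSpace S] {Z : ℤ → Ω → S}

lemma IsStrictlyStationary.integral_shift (hZ : IsStrictlyStationary μ Z)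
    (hm : ∀ t, Measurable (Z t)) {H : (ℤ → S) → ℝ} (hH : Measurable H) (k : ℤ) :
    ∫ ω, H (fun t => Z (t + k) ω) ∂μ = ∫ ω, H (fun t => Z t ω) ∂μ := by
  have h1 : Measurable fun ω t => Z t ω := measurable_pi_lambda _ fun t => hm t
  have h2 : Measurable fun ω t => Z (t + k) ω := measurable_pi_lambda _ fun t => hm _
  rw [← integral_map h2.aemeasurable hH.aestronglyMeasurable, hZ k,
    integral_map h1.aemeasurable hH.aestronglyMeasurable]

lemma IsStrictlyStationary.integral_eq (hZ : IsStrictlyStationary μ Z)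
    (hm : ∀ t, Measurable (Z t)) {φ : S → ℝ} (hφ : Measurable φ) (t : ℤ) :
    ∫ ω, φ (Z t ω) ∂μ = ∫ ω, φ (Z 0 ω) ∂μ := by
  simpa using hZ.integral_shift hm (H := fun z => φ (z 0)) (hφ.comp (measurable_pi_apply 0)) t

lemma IsStrictlyStationary.integral_mul_eq (hZ : IsStrictlyStationary μ Z)
    (hm : ∀ t, Measurable (Z t)) {φ ψ : S → ℝ} (hφ : Measurable φ) (hψ : Measurable ψ) (t k : ℤ) :
    ∫ ω, φ (Z t ω) * ψ (Z (t + k) ω) ∂μ = ∫ ω, φ (Z 0 ω) * ψ (Z k ω) ∂μ := by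
  simpa [add_comm] using hZ.integral_shift hm (H := fun z => φ (z 0) * ψ (z k))
    ((hφ.comp (measurable_pi_apply 0)).mul (hψ.comp (measurable_pi_apply k))) t

variable [IsProbabilityMeasure μ]

lemma alphaMixing_bddAbove (t : ℕ) :
    BddAbove {r | ∃ A B : Set Ω, MeasurableSet[sigmaPast Z] A ∧ MeasurableSet[sigmaFuture Z t] B ∧
      r = |μ.real A * μ.real B - μ.real (A ∩ B)|} := by
  refine ⟨1, ?_⟩
  rintro r ⟨A, B, -, -, rfl⟩
  have h1 := mul_le_one₀ (measureReal_le_one (μ := μ) (s := A)) measureReal_nonneg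
    (measureReal_le_one (μ := μ) (s := B))
  have h2 := measureReal_le_one (μ := μ) (s := A ∩ B)
  have h3 := mul_nonneg (measureReal_nonneg (μ := μ) (s := A)) (measureReal_nonneg (μ := μ) (s := B))
  have h4 := measureReal_nonneg (μ := μ) (s := A ∩ B)
  rw [abs_le]
  constructor <;> linarith

lemma le_alphaMixing (t : ℕ) {A B : Set Ω} (hA : MeasurableSet[sigmaPast Z] A)
    (hB : MeasurableSet[sigmaFuture Z t] B) :
    |μ.real A * μ.real B - μ.real (A ∩ B)| ≤ alphaMixing μ Z t :=
  le_csSup (alphaMixing_bddAbove t) ⟨A, B, hA, hB, rfl⟩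

lemma alphaMixing_nonneg (t : ℕ) : 0 ≤ alphaMixing μ Z t :=
  (abs_nonneg _).trans (le_alphaMixing (μ := μ) (Z := Z) t (A := ∅) (B := ∅)
    (@MeasurableSet.empty _ (sigmaPast Z)) (@MeasurableSet.empty _ (sigmaFuture Z t)))

lemma alphaMixing_le_one (t : ℕ) : alphaMixing μ Z t ≤ 1 := by
  refine Real.sSup_le ?_ zero_le_one
  rintro r ⟨A, B, -, -, rfl⟩
  have h1 := mul_le_one₀ (measureReal_le_one (μ := μ) (s := A)) measureReal_nonneg
    (measureReal_le_one (μ := μ) (s := B))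
  have h2 := measureReal_le_one (μ := μ) (s := A ∩ B)
  have h3 := mul_nonneg (measureReal_nonneg (μ := μ) (s := A)) (measureReal_nonneg (μ := μ) (s := B))
  have h4 := measureReal_nonneg (μ := μ) (s := A ∩ B)
  rw [abs_le]
  constructor <;> linarith

/-- The coefficients lie in `[0, 1]` and the exponent `ν / (2 + ν)` is at most `1`, so each
coefficient is at most its power. -/
lemma summable_alphaMixing {ν : ℝ} (hν : 0 < ν)
    (h : Summable fun t : ℕ => alphaMixing μ Z (t + 1) ^ (ν / (2 + ν))) :
    Summable fun t : ℕ => alphaMixing μ Z t := by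
  rw [← summable_nat_add_iff 1]
  refine h.of_nonneg_of_le (fun t => alphaMixing_nonneg _) fun t => ?_
  have hp : ν / (2 + ν) ≤ 1 := by rw [div_le_one (by linarith)]; linarith
  rcases (alphaMixing_nonneg (μ := μ) (Z := Z) (t + 1)).eq_or_lt with h0 | h0
  · rw [← h0]; exact Real.rpow_nonneg le_rfl _
  · simpa using Real.rpow_le_rpow_of_exponent_ge h0 (alphaMixing_le_one _) hp

lemma abs_cov_le_alphaMixing (hm : ∀ t, Measurable (Z t)) {φ ψ : S → ℝ} (hφ : Measurable φ)
    (hψ : Measurable ψ) {K L : ℝ} (hK : ∀ z, |φ z| ≤ K) (hL : ∀ z, |ψ z| ≤ L) (k : ℕ) :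
    |∫ ω, φ (Z 0 ω) * ψ (Z k ω) ∂μ - (∫ ω, φ (Z 0 ω) ∂μ) * ∫ ω, ψ (Z k ω) ∂μ| ≤
      4 * K * L * alphaMixing μ Z k := by
  refine abs_cov_le_of_mixing (m₁ := sigmaPast Z) (m₂ := sigmaFuture Z k)
    (iSup_le fun s => (hm s).comap_le) (iSup_le fun s => (hm s).comap_le) ?_ (fun ω => hK _) ?_
    (fun ω => hL _) fun A B hA hB => le_alphaMixing k hA hB
  · have h1 : MeasurableSpace.comap (Z 0) inferInstance ≤ sigmaPast Z :=
      le_iSup (fun s : {s : ℤ // s ≤ 0} => MeasurableSpace.comap (Z s) inferInstance) ⟨0, le_rfl⟩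
    exact (hφ.comp (comap_measurable (Z 0))).mono h1 le_rfl
  · have h1 : MeasurableSpace.comap (Z k) inferInstance ≤ sigmaFuture Z k :=
      le_iSup (fun s : {s : ℤ // (k : ℤ) ≤ s} => MeasurableSpace.comap (Z s) inferInstance)
        ⟨k, le_rfl⟩
    exact (hψ.comp (comap_measurable (Z k))).mono h1 le_rfl

variable {κ : Type*} [Fintype κ]

/-- The lag-`k` autocovariances of boundedly overlapping functions of the process are summable
over the functions, uniformly in their number. -/
lemma sum_autocov_le_alphaMixing (hZ : IsStrictlyStationary μ Z) (hm : ∀ t, Measurable (Z t))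
    {φ : κ → S → ℝ} (hφ : ∀ i, Measurable (φ i)) {K : ℝ} (hK : ∀ z, ∑ i, |φ i z| ≤ K)
    (t : ℤ) (k : ℕ) :
    ∑ i, (∫ ω, φ i (Z t ω) * φ i (Z (t + k) ω) ∂μ - (∫ ω, φ i (Z 0 ω) ∂μ) ^ 2) ≤
      4 * K * K * alphaMixing μ Z k := by
  classical
  have hb : ∀ i z, |φ i z| ≤ K := fun i z =>
    (Finset.single_le_sum (f := fun i => |φ i z|) (fun i _ => abs_nonneg _)
      (Finset.mem_univ i)).trans (hK z)
  -- The sum to be bounded is the trace of the matrix of lag-`k` covariances. Its quadratic form at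
  -- the signs `s` is the lag-`k` autocovariance of the single function `F = ∑ s i * φ i`, which is
  -- bounded by `K` whatever the number of summands.
  obtain ⟨s, hs, hle⟩ := exists_signs_sum_diag_le (Finset.univ : Finset κ)
    fun i j => ∫ ω, φ i (Z 0 ω) * φ j (Z k ω) ∂μ -
      (∫ ω, φ i (Z 0 ω) ∂μ) * ∫ ω, φ j (Z 0 ω) ∂μ
  set F : S → ℝ := fun z => ∑ i, s i * φ i z with hF
  have hFm : Measurable F := Finset.measurable_fun_sum _ fun i _ => (hφ i).const_mul _
  have hFK : ∀ z, |F z| ≤ K := fun z => (Finset.abs_sum_le_sum_abs _ _).trans <| by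
    simpa [abs_mul, hs] using hK z
  have hint : ∀ i t, Integrable (fun ω => φ i (Z t ω)) μ := fun i t =>
    integrable_of_measurable_abs_le ((hφ i).comp (hm t)) fun ω => hb i _
  have hint2 : ∀ i j, Integrable (fun ω => φ i (Z 0 ω) * φ j (Z k ω)) μ := fun i j =>
    (hint j k).bdd_mul ((hφ i).comp (hm 0)).aestronglyMeasurable (ae_of_all _ fun ω => hb i _)
  have h := (le_abs_self _).trans (abs_cov_le_alphaMixing (μ := μ) hm hFm hFm hFK hFK k)
  have e1 : ∀ t, ∫ ω, F (Z t ω) ∂μ = ∑ i, s i * ∫ ω, φ i (Z 0 ω) ∂μ := fun t => by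
    rw [hZ.integral_eq hm hFm t]
    simp only [hF]
    rw [integral_finsetSum _ fun i _ => (hint i 0).const_mul _]
    simp_rw [integral_const_mul]
  have e2 : ∫ ω, F (Z 0 ω) * F (Z k ω) ∂μ =
      ∑ i, ∑ j, s i * s j * ∫ ω, φ i (Z 0 ω) * φ j (Z k ω) ∂μ := by
    have : ∀ ω, F (Z 0 ω) * F (Z k ω) =
        ∑ i, ∑ j, s i * s j * (φ i (Z 0 ω) * φ j (Z k ω)) := fun ω => by
      simp only [hF]
      rw [Finset.sum_mul_sum]
      exact Finset.sum_congr rfl fun i _ => Finset.sum_congr rfl fun j _ => by ring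
    simp_rw [this]
    rw [integral_finsetSum _ fun i _ => integrable_finsetSum _ fun j _ =>
      (hint2 i j).const_mul _]
    refine Finset.sum_congr rfl fun i _ => ?_
    rw [integral_finsetSum _ fun j _ => (hint2 i j).const_mul _]
    simp_rw [integral_const_mul]
  rw [e1, e1, e2, Finset.sum_mul_sum, ← Finset.sum_sub_distrib] at h
  simp_rw [← Finset.sum_sub_distrib] at h
  refine (le_of_eq ?_).trans (hle.trans (le_trans (le_of_eq ?_) h))
  · refine Finset.sum_congr rfl fun i _ => ?_
    rw [hZ.integral_mul_eq hm (hφ i) (hφ i)]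
    ring
  · exact Finset.sum_congr rfl fun i _ => Finset.sum_congr rfl fun j _ => by ring

/-- With truncated subtraction the argument of `r` is `|t - t'|`, and each lag occurs at most once
on either side of `t`. -/
lemma sum_comp_natAbs_sub_le {r : ℕ → ℝ} (hr : Summable r) (h0 : ∀ k, 0 ≤ r k)
    (S : Finset ℕ) (t : ℕ) : ∑ t' ∈ S, r ((t - t') + (t' - t)) ≤ 2 * ∑' k, r k := by
  have h1 : ∑ t' ∈ S with t' ≤ t, r ((t - t') + (t' - t)) ≤ ∑' k, r k := by
    rw [← Finset.sum_image (g := fun t' => (t - t') + (t' - t)) (f := r)]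
    · exact hr.sum_le_tsum _ fun k _ => h0 k
    · intro x hx y hy hxy
      simp only [Finset.coe_filter, Set.mem_ofPred_eq] at hx hy
      simp only at hxy
      omega
  have h2 : ∑ t' ∈ S with ¬ t' ≤ t, r ((t - t') + (t' - t)) ≤ ∑' k, r k := by
    rw [← Finset.sum_image (g := fun t' => (t - t') + (t' - t)) (f := r)]
    · exact hr.sum_le_tsum _ fun k _ => h0 k
    · intro x hx y hy hxy
      simp only [Finset.coe_filter, Set.mem_ofPred_eq] at hx hy
      simp only at hxy
      omega
  rw [← Finset.sum_filter_add_sum_filter_not S (fun t' => t' ≤ t)]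
  linarith

/-- The sum over `i` of the variances of the partial sums of `φ i (Z t)`. -/
lemma sum_integral_sq_le (hZ : IsStrictlyStationary μ Z) (hm : ∀ t, Measurable (Z t))
    (hα : Summable fun k : ℕ => alphaMixing μ Z k)
    {φ : κ → S → ℝ} (hφ : ∀ i, Measurable (φ i)) {K : ℝ} (hK : ∀ z, ∑ i, |φ i z| ≤ K) (T : ℕ) :
    ∑ i, ∫ ω, (∑ t ∈ Finset.Icc 1 T, (φ i (Z t ω) - ∫ ω, φ i (Z 0 ω) ∂μ)) ^ 2 ∂μ ≤
      T * (8 * K * K * ∑' k : ℕ, alphaMixing μ Z k) := by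
  have hb : ∀ i z, |φ i z| ≤ K := fun i z =>
    (Finset.single_le_sum (f := fun i => |φ i z|) (fun i _ => abs_nonneg _)
      (Finset.mem_univ i)).trans (hK z)
  have hint : ∀ i t, Integrable (fun ω => φ i (Z t ω)) μ := fun i t =>
    integrable_of_measurable_abs_le ((hφ i).comp (hm t)) fun ω => hb i _
  have hint2 : ∀ i t t', Integrable (fun ω => φ i (Z t ω) * φ i (Z t' ω)) μ := fun i t t' =>
    (hint i t').bdd_mul ((hφ i).comp (hm t)).aestronglyMeasurable (ae_of_all _ fun ω => hb i _)
  set b : κ → ℝ := fun i => ∫ ω, φ i (Z 0 ω) ∂μ with hbdef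
  have hcov : ∀ i (t t' : ℤ), ∫ ω, (φ i (Z t ω) - b i) * (φ i (Z t' ω) - b i) ∂μ =
      ∫ ω, φ i (Z t ω) * φ i (Z t' ω) ∂μ - b i ^ 2 := by
    intro i t t'
    have e : ∀ ω, (φ i (Z t ω) - b i) * (φ i (Z t' ω) - b i) =
      φ i (Z t ω) * φ i (Z t' ω) - b i * φ i (Z t ω) - b i * φ i (Z t' ω) + b i ^ 2 :=
      fun ω => by ring
    simp_rw [e]
    have i1 : Integrable (fun ω => φ i (Z t ω) * φ i (Z t' ω) - b i * φ i (Z t ω)) μ :=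
      (hint2 i t t').sub ((hint i t).const_mul _)
    have i2 : Integrable (fun ω => φ i (Z t ω) * φ i (Z t' ω) - b i * φ i (Z t ω)
        - b i * φ i (Z t' ω)) μ := i1.sub ((hint i t').const_mul _)
    rw [integral_add i2 (integrable_const _), integral_sub i1 ((hint i t').const_mul _),
      integral_sub (hint2 i t t') ((hint i t).const_mul _), integral_const_mul,
      integral_const_mul, hZ.integral_eq hm (hφ i) t, hZ.integral_eq hm (hφ i) t']
    simp only [integral_const, probReal_univ, one_smul, hbdef]
    ring
  have hint3 : ∀ i (t t' : ℤ),
      Integrable (fun ω => (φ i (Z t ω) - b i) * (φ i (Z t' ω) - b i)) μ := fun i t t' =>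
    ((hint i t').sub (integrable_const _)).bdd_mul (c := K + |b i|)
      (((hφ i).comp (hm t)).sub_const _).aestronglyMeasurable
      (ae_of_all _ fun ω => (abs_sub _ _).trans (by gcongr; exact hb i _))
  have hexp : ∀ i, ∫ ω, (∑ t ∈ Finset.Icc 1 T, (φ i (Z t ω) - b i)) ^ 2 ∂μ =
      ∑ t ∈ Finset.Icc 1 T, ∑ t' ∈ Finset.Icc 1 T,
        (∫ ω, φ i (Z t ω) * φ i (Z t' ω) ∂μ - b i ^ 2) := by
    intro i
    simp_rw [sq (∑ t ∈ Finset.Icc 1 T, _), Finset.sum_mul_sum]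
    rw [integral_finsetSum _ fun (t : ℕ) _ => integrable_finsetSum _ fun (t' : ℕ) _ =>
      hint3 i t t']
    refine Finset.sum_congr rfl fun t _ => ?_
    rw [integral_finsetSum _ fun (t' : ℕ) _ => hint3 i t t']
    exact Finset.sum_congr rfl fun t' _ => hcov i t t'
  have hpair : ∀ t t' : ℕ, ∑ i, (∫ ω, φ i (Z t ω) * φ i (Z t' ω) ∂μ - b i ^ 2) ≤
      4 * K * K * alphaMixing μ Z ((t - t') + (t' - t)) := by
    intro t t'
    rcases le_total t t' with h | h
    · obtain ⟨k, rfl⟩ := Nat.exists_eq_add_of_le h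
      have := sum_autocov_le_alphaMixing (μ := μ) hZ hm hφ hK t k
      simpa using this
    · obtain ⟨k, rfl⟩ := Nat.exists_eq_add_of_le h
      have := sum_autocov_le_alphaMixing (μ := μ) hZ hm hφ hK t' k
      simpa [mul_comm (φ _ (Z (_ + _) _))] using this
  have hKK : 0 ≤ K * K := mul_self_nonneg K
  calc _ = ∑ t ∈ Finset.Icc 1 T, ∑ t' ∈ Finset.Icc 1 T,
        ∑ i, (∫ ω, φ i (Z t ω) * φ i (Z t' ω) ∂μ - b i ^ 2) := by
        rw [Finset.sum_congr rfl fun i _ => hexp i, Finset.sum_comm]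
        exact Finset.sum_congr rfl fun t _ => Finset.sum_comm
    _ ≤ ∑ t ∈ Finset.Icc 1 T, ∑ t' ∈ Finset.Icc 1 T,
        4 * K * K * alphaMixing μ Z ((t - t') + (t' - t)) :=
        Finset.sum_le_sum fun t _ => Finset.sum_le_sum fun t' _ => hpair t t'
    _ ≤ ∑ t ∈ Finset.Icc 1 T, 4 * K * K * (2 * ∑' k : ℕ, alphaMixing μ Z k) := by
        refine Finset.sum_le_sum fun t _ => ?_
        rw [← Finset.mul_sum]
        exact mul_le_mul_of_nonneg_left
          (sum_comp_natAbs_sub_le hα (fun k => alphaMixing_nonneg k) _ t) (by linarith)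
    _ = _ := by
        simp only [Finset.sum_const, Nat.card_Icc, Nat.add_sub_cancel, nsmul_eq_mul]
        ring

/-- A maximal deviation inequality over a partition: the total absolute deviation of the
empirical means of boundedly overlapping functions. -/
lemma measureReal_sum_abs_ge_le (hZ : IsStrictlyStationary μ Z) (hm : ∀ t, Measurable (Z t))
    (hα : Summable fun k : ℕ => alphaMixing μ Z k)
    {φ : κ → S → ℝ} (hφ : ∀ i, Measurable (φ i)) {K : ℝ} (hK : ∀ z, ∑ i, |φ i z| ≤ K)
    {T : ℕ} (hT : 0 < T) {δ : ℝ} (hδ : 0 < δ) :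
    μ.real {ω | δ * T ≤ ∑ i, |∑ t ∈ Finset.Icc 1 T, (φ i (Z t ω) - ∫ ω, φ i (Z 0 ω) ∂μ)|} ≤
      (Fintype.card κ / T) * (8 * K * K * (∑' k : ℕ, alphaMixing μ Z k) / δ ^ 2) := by
  have hb : ∀ i z, |φ i z| ≤ K := fun i z =>
    (Finset.single_le_sum (f := fun i => |φ i z|) (fun i _ => abs_nonneg _)
      (Finset.mem_univ i)).trans (hK z)
  set Y : κ → Ω → ℝ := fun i ω => ∑ t ∈ Finset.Icc 1 T, (φ i (Z t ω) - ∫ ω, φ i (Z 0 ω) ∂μ)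
    with hY
  have hYm : ∀ i, Measurable (Y i) := fun i => Finset.measurable_fun_sum _ fun t _ =>
    ((hφ i).comp (hm t)).sub_const _
  have hYb : ∀ i ω, |Y i ω| ≤ T * (K + |∫ ω, φ i (Z 0 ω) ∂μ|) := fun i ω => by
    refine (Finset.abs_sum_le_sum_abs _ _).trans ((Finset.sum_le_card_nsmul _ _
      (K + |∫ ω, φ i (Z 0 ω) ∂μ|) fun t _ => (abs_sub _ _).trans ?_).trans (le_of_eq ?_))
    · gcongr; exact hb i _
    · simp [mul_add]
  have hYi : ∀ i, Integrable (fun ω => Y i ω ^ 2) μ := fun i =>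
    integrable_of_measurable_abs_le ((hYm i).pow_const 2)
      (K := (T * (K + |∫ ω, φ i (Z 0 ω) ∂μ|)) ^ 2) fun ω => by
        rw [abs_pow]; exact pow_le_pow_left₀ (abs_nonneg _) (hYb i ω) 2
  have hT' : (0 : ℝ) < T := by exact_mod_cast hT
  -- Cauchy–Schwarz costs a factor `card κ`. Since the second moments sum to `O(T)`, Markov at level
  -- `(δ T)²` leaves `card κ / T`.
  have hsub : {ω | δ * T ≤ ∑ i, |Y i ω|} ⊆
      {ω | (δ * T) ^ 2 ≤ Fintype.card κ * ∑ i, Y i ω ^ 2} := by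
    intro ω hω
    simp only [Set.mem_ofPred_eq] at hω ⊢
    refine (pow_le_pow_left₀ (by positivity) hω 2).trans ?_
    simpa [sq_abs] using sq_sum_le_card_mul_sum_sq (s := Finset.univ) (f := fun i => |Y i ω|)
  have hmarkov := mul_meas_ge_le_integral_of_nonneg (μ := μ)
    (f := fun ω => Fintype.card κ * ∑ i, Y i ω ^ 2)
    (ae_of_all _ fun ω => by positivity)
    ((integrable_finsetSum _ fun i _ => hYi i).const_mul _) ((δ * T) ^ 2)
  rw [integral_const_mul, integral_finsetSum _ fun i _ => hYi i] at hmarkov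
  have hbound := sum_integral_sq_le hZ hm hα hφ hK T
  have hpos : 0 < (δ * T) ^ 2 := by positivity
  calc _ ≤ μ.real {ω | (δ * T) ^ 2 ≤ Fintype.card κ * ∑ i, Y i ω ^ 2} :=
        measureReal_mono hsub
    _ ≤ (Fintype.card κ * (T * (8 * K * K * ∑' k : ℕ, alphaMixing μ Z k))) / (δ * T) ^ 2 := by
        rw [le_div_iff₀ hpos, mul_comm]
        exact hmarkov.trans (mul_le_mul_of_nonneg_left hbound (by positivity))
    _ = _ := by field_simp

end Mixing

/-! ### Null zero sets of polynomials. -/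

/-- The zero set of a nonzero polynomial is Lebesgue null. -/
lemma volume_zeros_mvPolynomial_eq_zero {n : ℕ} {p : MvPolynomial (Fin n) ℝ} (hp : p ≠ 0) :
    volume {x : Fin n → ℝ | MvPolynomial.eval x p = 0} = 0 := by
  induction n with
  | zero =>
    rw [MvPolynomial.eq_C_of_isEmpty p] at hp ⊢
    have h : p.coeff 0 ≠ 0 := fun h => hp (by rw [h, map_zero])
    simp [h]
  | succ n ih =>
    have hq : MvPolynomial.finSuccEquiv ℝ n p ≠ 0 := by simpa using hp
    set P := MvPolynomial.finSuccEquiv ℝ n p with hP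
    have hlead : P.leadingCoeff ≠ 0 := Polynomial.leadingCoeff_ne_zero.mpr hq
    have hcont : Continuous fun x : Fin (n + 1) → ℝ => MvPolynomial.eval x p :=
      MvPolynomial.continuous_eval p
    have hms : MeasurableSet {x : Fin (n + 1) → ℝ | MvPolynomial.eval x p = 0} :=
      hcont.measurable (measurableSet_singleton 0)
    have hmp := (volume_preserving_piFinSuccAbove (fun _ : Fin (n + 1) => ℝ) 0).symm
    rw [← hmp.measure_preimage hms.nullMeasurableSet]
    have hms' := hmp.measurable hms
    rw [Measure.volume_eq_prod, Measure.prod_apply_symm hms', lintegral_eq_zero_iff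
      (measurable_measure_prodMk_right hms')]
    -- For almost every choice of the other variables the leading coefficient in the first variable
    -- is nonzero, so the slice is a finite set of roots and Fubini applies.
    have hae : ∀ᵐ y : Fin n → ℝ, MvPolynomial.eval y P.leadingCoeff ≠ 0 := by
      rw [ae_iff]; simpa using ih hlead
    filter_upwards [hae] with y hy
    have hmap : Polynomial.map (MvPolynomial.eval y) P ≠ 0 := by
      intro h
      apply hy
      have := congrArg (fun r => Polynomial.coeff r P.natDegree) h
      simpa [Polynomial.coeff_map] using this
    refine measure_mono_null (t := (Polynomial.map (MvPolynomial.eval y) P).rootSet ℝ) ?_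
      ((Polynomial.rootSet_finite _ ℝ).measure_zero _)
    intro x hx
    have hx' : MvPolynomial.eval (Fin.cons x y : Fin (n + 1) → ℝ) p = 0 := by
      simpa [MeasurableEquiv.piFinSuccAbove, Fin.insertNthEquiv] using hx
    rw [MvPolynomial.eval_eq_eval_mv_eval'] at hx'
    rw [Polynomial.mem_rootSet]
    exact ⟨hmap, by simpa using hx'⟩

/-! ### Uniform rarity of small values in a finite-dimensional function space. -/

section Span

variable {d : ℕ} {ι : Type*} [Fintype ι]

/-- The functions in the span of `b`. -/
def lin (b : ι → (Fin d → ℝ) → ℝ) (θ : ι → ℝ) (z : Fin d → ℝ) : ℝ := ∑ j, θ j * b j z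

lemma lin_smul (b : ι → (Fin d → ℝ) → ℝ) (r : ℝ) (θ : ι → ℝ) (z : Fin d → ℝ) :
    lin b (r • θ) z = r * lin b θ z := by
  simp [lin, Finset.mul_sum, mul_assoc]

lemma abs_sum_mul_sub_le {v w : ι → ℝ} {e : ℝ} (h : ∀ j, |v j - w j| ≤ e) (θ : ι → ℝ) :
    |∑ j, θ j * v j - ∑ j, θ j * w j| ≤ ‖θ‖ * (Fintype.card ι * e) := by
  rw [← Finset.sum_sub_distrib]
  refine (Finset.abs_sum_le_sum_abs _ _).trans ((Finset.sum_le_card_nsmul _ _ (‖θ‖ * e)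
    fun j _ => ?_).trans (le_of_eq ?_))
  · rw [← mul_sub, abs_mul]
    exact mul_le_mul (norm_le_pi_norm θ j) (h j) (abs_nonneg _) (norm_nonneg _)
  · simp; ring

/-- The cube `[-1, 1]^d`. -/
abbrev unitBox (d : ℕ) : Set (Fin d → ℝ) := Set.Icc (fun _ => -1) (fun _ => 1)

/-- Small values of normalized elements of a finite-dimensional function space whose nonzero
elements have null zero sets are uniformly rare. -/
lemma exists_volume_abs_lin_le {b : ι → (Fin d → ℝ) → ℝ} (hb : ∀ j, Continuous (b j))
    (hnull : ∀ θ : ι → ℝ, θ ≠ 0 → volume {z | lin b θ z = 0} = 0) {η : ℝ≥0∞} (hη : 0 < η) :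
    ∃ δ : ℝ, 0 < δ ∧ ∀ θ : ι → ℝ, ‖θ‖ = 1 → volume {z ∈ unitBox d | |lin b θ z| ≤ δ} ≤ η := by
  have hlc : ∀ θ, Continuous (lin b θ) := fun θ =>
    continuous_finsetSum _ fun j _ => continuous_const.mul (hb j)
  have hcomp : IsCompact (unitBox d) := isCompact_Icc
  obtain ⟨K, hK⟩ : ∃ K : ℝ, ∀ j, ∀ z ∈ unitBox d, |b j z| ≤ K := by
    have h : ∀ j, ∃ K, ∀ z ∈ unitBox d, |b j z| ≤ K := fun j =>
      hcomp.exists_bound_of_continuousOn (hb j).continuousOn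
    choose K hK using h
    exact ⟨∑ j, |K j|, fun j z hz => (hK j z hz).trans ((le_abs_self _).trans
      (Finset.single_le_sum (f := fun j => |K j|) (fun j _ => abs_nonneg _)
        (Finset.mem_univ j)))⟩
  -- For fixed `θ` the sublevel sets decrease to a null set, so one of them has measure below `η`.
  -- Halving its level absorbs small changes of `θ`, and compactness of the unit sphere then gives a
  -- common level.
  have hloc : ∀ θ : ι → ℝ, ‖θ‖ = 1 → ∃ δ : ℝ, 0 < δ ∧ ∀ᶠ θ' in 𝓝 θ,
      volume {z ∈ unitBox d | |lin b θ' z| ≤ δ} ≤ η := by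
    intro θ hθ
    have hθ0 : θ ≠ 0 := fun h => by simp [h] at hθ
    set s : ℕ → Set (Fin d → ℝ) := fun n => {z ∈ unitBox d | |lin b θ z| ≤ 1 / (n + 1)} with hs
    have hsm : ∀ n, MeasurableSet (s n) := fun n => measurableSet_Icc.inter
      (measurableSet_le (hlc θ).abs.measurable measurable_const)
    have hanti : Antitone s := fun n n' hn z hz =>
      ⟨hz.1, hz.2.trans (one_div_le_one_div_of_le (by positivity) (by gcongr))⟩
    have hfin : ∃ n, volume (s n) ≠ ∞ :=
      ⟨0, ((measure_mono (Set.sep_subset _ _)).trans_lt hcomp.measure_lt_top).ne⟩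
    have hlim := tendsto_measure_iInter_atTop (fun n => (hsm n).nullMeasurableSet) hanti hfin
    have hzero : volume (⋂ n, s n) = 0 := by
      refine measure_mono_null (fun z hz => ?_) (hnull θ hθ0)
      rw [Set.mem_iInter] at hz
      have h : |lin b θ z| ≤ 0 :=
        ge_of_tendsto' tendsto_one_div_add_atTop_nhds_zero_nat fun n => (hz n).2
      exact abs_nonpos_iff.mp h
    rw [hzero] at hlim
    obtain ⟨n, hn⟩ := (hlim.eventually (gt_mem_nhds hη)).exists
    set e : ℝ := 1 / (n + 1) with he
    have he0 : 0 < e := by positivity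
    refine ⟨e / 2, by positivity, ?_⟩
    have hcl : ∀ᶠ θ' in 𝓝 θ, ‖θ' - θ‖ * (Fintype.card ι * K) < e / 2 := by
      have hc : ContinuousAt (fun θ' : ι → ℝ => ‖θ' - θ‖ * (Fintype.card ι * K)) θ := by fun_prop
      refine hc.eventually_lt continuousAt_const (by simpa using by positivity)
    filter_upwards [hcl] with θ' hθ'
    refine (measure_mono ?_).trans hn.le
    rintro z ⟨hz, hz'⟩
    refine ⟨hz, ?_⟩
    have h1 : |lin b (θ' - θ) z| ≤ ‖θ' - θ‖ * (Fintype.card ι * K) := by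
      simpa [lin] using abs_sum_mul_sub_le (v := fun j => b j z) (w := fun _ => 0)
        (fun j => by simpa using hK j z hz) (θ' - θ)
    have h2 : lin b θ z = lin b θ' z - lin b (θ' - θ) z := by
      simp [lin, sub_mul, Finset.sum_sub_distrib]
    rw [h2]
    refine (abs_sub _ _).trans ?_
    linarith
  refine (isCompact_sphere (0 : ι → ℝ) 1).induction_on
    (p := fun s => ∃ δ : ℝ, 0 < δ ∧ ∀ θ ∈ s, volume {z ∈ unitBox d | |lin b θ z| ≤ δ} ≤ η)
    ⟨1, one_pos, by simp⟩ (fun s t hst ⟨δ, h0, h⟩ => ⟨δ, h0, fun θ hθ => h θ (hst hθ)⟩) ?_ ?_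
    |>.imp fun δ h => ⟨h.1, fun θ hθ => h.2 θ (by simpa using hθ)⟩
  · rintro s t ⟨δ, h0, h⟩ ⟨δ', h0', h'⟩
    refine ⟨min δ δ', lt_min h0 h0', fun θ hθ => ?_⟩
    rcases hθ with hθ | hθ
    · refine le_trans (measure_mono ?_) (h θ hθ)
      exact fun z hz => ⟨hz.1, hz.2.trans (min_le_left _ _)⟩
    · refine le_trans (measure_mono ?_) (h' θ hθ)
      exact fun z hz => ⟨hz.1, hz.2.trans (min_le_right _ _)⟩
  · intro θ hθ
    obtain ⟨δ, h0, h⟩ := hloc θ (by simpa using hθ)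
    exact ⟨_, mem_nhdsWithin_of_mem_nhds h, δ, h0, fun θ' hθ' => hθ'⟩

end Span

/-! ### Oscillation on a fine grid, uniform over all coefficients. -/

section Cells

variable {d : ℕ} {ι : Type*} [Fintype ι]

/-- The `r`-th of the `m ^ d` closed cubes of side `2 / m` which make up `[-1, 1]^d`. -/
def subBox (m : ℕ) (r : Fin d → Fin m) : Set (Fin d → ℝ) :=
  Set.Icc (fun j => -1 + 2 * ((r j : ℕ) : ℝ) / m) (fun j => -1 + 2 * (((r j : ℕ) : ℝ) + 1) / m)

lemma subBox_subset_unitBox {m : ℕ} (r : Fin d → Fin m) : subBox m r ⊆ unitBox d := by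
  rintro z ⟨h1, h2⟩
  refine ⟨fun j => ?_, fun j => ?_⟩
  · refine le_trans ?_ (h1 j)
    have : (0 : ℝ) ≤ 2 * ((r j : ℕ) : ℝ) / m := by positivity
    simpa using this
  · refine (h2 j).trans ?_
    have hm : (0 : ℝ) < m := by exact_mod_cast (r j).pos
    have : (((r j : ℕ) : ℝ) + 1) ≤ m := by exact_mod_cast (r j).isLt
    have h : 2 * (((r j : ℕ) : ℝ) + 1) / m ≤ 2 := by rw [div_le_iff₀ hm]; linarith
    linarith

lemma dist_le_of_mem_subBox {m : ℕ} {r : Fin d → Fin m} {z z' : Fin d → ℝ}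
    (hz : z ∈ subBox m r) (hz' : z' ∈ subBox m r) : dist z z' ≤ 2 / m := by
  rw [dist_pi_le_iff (by positivity)]
  intro j
  have h1 := hz.1 j
  have h2 := hz.2 j
  have h3 := hz'.1 j
  have h4 := hz'.2 j
  have e : 2 * (((r j : ℕ) : ℝ) + 1) / m = 2 * ((r j : ℕ) : ℝ) / m + 2 / m := by ring
  simp only [e] at h2 h4
  rw [Real.dist_eq, abs_le]
  constructor <;> linarith

/-- A set of subcubes contained in a set of small volume has few elements. -/
lemma card_subBox_le {m : ℕ} (hm : 0 < m) (S : Finset (Fin d → Fin m)) {A : Set (Fin d → ℝ)}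
    {η : ℝ} (hη : 0 ≤ η) (hA : volume A ≤ ENNReal.ofReal (η * 2 ^ d))
    (hS : ∀ r ∈ S, subBox m r ⊆ A) : (S.card : ℝ) ≤ η * m ^ d := by
  have hm' : (0 : ℝ) < m := by exact_mod_cast hm
  -- Half-open versions of the subcubes are genuinely disjoint, so their volumes add.
  set Q : (Fin d → Fin m) → Set (Fin d → ℝ) := fun r => Set.pi Set.univ fun j =>
    Set.Ico (-1 + 2 * ((r j : ℕ) : ℝ) / m) (-1 + 2 * (((r j : ℕ) : ℝ) + 1) / m) with hQ
  have hsub : ∀ r, Q r ⊆ subBox m r := fun r z hz =>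
    ⟨fun j => (hz j trivial).1, fun j => (hz j trivial).2.le⟩
  have hvol : ∀ r, volume (Q r) = ENNReal.ofReal ((2 / m) ^ d) := by
    intro r
    rw [hQ]
    simp only
    rw [Real.volume_pi_Ico]
    have : ∀ j : Fin d, -1 + 2 * (((r j : ℕ) : ℝ) + 1) / m - (-1 + 2 * ((r j : ℕ) : ℝ) / m)
        = 2 / m := fun j => by ring
    simp only [this, Finset.prod_const, Finset.card_univ, Fintype.card_fin]
    rw [ENNReal.ofReal_pow (by positivity)]
  have hmeas : ∀ r, MeasurableSet (Q r) := fun r =>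
    MeasurableSet.univ_pi fun j => measurableSet_Ico
  have hdisj : (S : Set (Fin d → Fin m)).PairwiseDisjoint Q := by
    intro r _ r' _ hne
    rw [Function.onFun, Set.disjoint_left]
    intro z hz hz'
    apply hne
    funext j
    obtain ⟨h1, h2⟩ := hz j trivial
    obtain ⟨h3, h4⟩ := hz' j trivial
    have h5 : 2 * ((r j : ℕ) : ℝ) / m < 2 * (((r' j : ℕ) : ℝ) + 1) / m := by linarith
    have h6 : 2 * ((r' j : ℕ) : ℝ) / m < 2 * (((r j : ℕ) : ℝ) + 1) / m := by linarith
    rw [div_lt_div_iff_of_pos_right hm'] at h5 h6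
    have h7 : (r j : ℕ) < r' j + 1 := by
      have : ((r j : ℕ) : ℝ) < ((r' j + 1 : ℕ) : ℝ) := by push_cast; linarith
      exact_mod_cast this
    have h8 : (r' j : ℕ) < r j + 1 := by
      have : ((r' j : ℕ) : ℝ) < ((r j + 1 : ℕ) : ℝ) := by push_cast; linarith
      exact_mod_cast this
    exact Fin.ext (by omega)
  have h : (S.card : ℝ≥0∞) * ENNReal.ofReal ((2 / m) ^ d) ≤ ENNReal.ofReal (η * 2 ^ d) := by
    calc _ = ∑ r ∈ S, volume (Q r) := by simp [hvol]
      _ = volume (⋃ r ∈ S, Q r) := (measure_biUnion_finset hdisj fun r _ => hmeas r).symm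
      _ ≤ volume A := measure_mono (Set.iUnion₂_subset fun r hr => (hsub r).trans (hS r hr))
      _ ≤ _ := hA
  rw [← ENNReal.ofReal_natCast, ← ENNReal.ofReal_mul (by positivity),
    ENNReal.ofReal_le_ofReal_iff (by positivity), div_pow, mul_div_assoc', div_le_iff₀ (by positivity)] at h
  have h2 : (0 : ℝ) < 2 ^ d := by positivity
  nlinarith

/-- Consider a sigmoid `Φ` and the functions `Φ (∑ j, θ j * B j)` with `B` uniformly close to `b`.
On most cells of a fine grid such a function is nearly constant, uniformly in `θ`. -/
lemma exists_grid_oscillation {b : ι → (Fin d → ℝ) → ℝ} (hb : ∀ j, Continuous (b j))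
    (hnull : ∀ θ : ι → ℝ, θ ≠ 0 → volume {z | lin b θ z = 0} = 0)
    {Φ : ℝ → ℝ} (hΦ : UniformContinuous Φ) (hΦ0 : ∀ v, 0 ≤ Φ v) (hΦ1 : ∀ v, Φ v ≤ 1)
    (hbot : Tendsto Φ atBot (𝓝 0)) (htop : Tendsto Φ atTop (𝓝 1)) {η : ℝ} (hη : 0 < η) :
    ∃ m : ℕ, 0 < m ∧ ∃ e : ℝ, 0 < e ∧ ∀ B : ι → (Fin d → ℝ) → ℝ,
      (∀ j, ∀ z ∈ unitBox d, |B j z - b j z| ≤ e) → ∀ θ : ι → ℝ, ∃ S : Finset (Fin d → Fin m),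
        (S.card : ℝ) ≤ η * m ^ d ∧ ∀ r ∉ S, ∀ z ∈ subBox m r, ∀ z' ∈ subBox m r,
          |Φ (lin B θ z) - Φ (lin B θ z')| ≤ η := by
  classical
  obtain ⟨δ, hδ, hvol⟩ := exists_volume_abs_lin_le hb hnull
    (η := ENNReal.ofReal (η * 2 ^ d)) (by simpa using by positivity)
  obtain ⟨R, hR0, hRtop, hRbot⟩ : ∃ R : ℝ, 0 < R ∧ (∀ v, R ≤ v → 1 - η ≤ Φ v) ∧
      ∀ v, v ≤ -R → Φ v ≤ η := by
    obtain ⟨R₁, h₁⟩ := (eventually_atTop.mp (htop.eventually_const_lt (show 1 - η < 1 by linarith)))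
    obtain ⟨R₂, h₂⟩ := (eventually_atBot.mp (hbot.eventually_lt_const hη))
    refine ⟨max 1 (max R₁ (-R₂)), by positivity, fun v hv => (h₁ v ?_).le, fun v hv => (h₂ v ?_).le⟩
    · exact (le_max_left _ _).trans ((le_max_right _ _).trans hv)
    · have := (le_max_right R₁ (-R₂)).trans (le_max_right 1 _)
      linarith
  obtain ⟨δΦ, hδΦ, hucΦ⟩ := Metric.uniformContinuous_iff.mp hΦ η hη
  -- Border between moderate and large coefficients: at norm `ρ` or more, a normalized value of size
  -- at least `δ / 2` gives a value of size at least `2 * R`, where `Φ` is within `η` of `0` or `1`.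
  set ρ : ℝ := 4 * R / δ with hρ
  have hρ0 : 0 < ρ := by positivity
  set n : ℝ := Fintype.card ι + 1 with hn
  have hn0 : 0 < n := by positivity
  -- The first entry leaves `δ / 2` of `δ` after one oscillation of `b` and one replacement of `b`
  -- by `B`. The second keeps one oscillation and two replacements, at norm below `ρ`, at `3 / 5` of
  -- `δΦ`. The `+ 1` in `n` avoids a zero divisor.
  set e : ℝ := min (δ / 4) (δΦ / (5 * ρ)) / n with he
  have he0 : 0 < e := by positivity
  have hne : (Fintype.card ι : ℝ) * e ≤ min (δ / 4) (δΦ / (5 * ρ)) := by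
    rw [he, mul_div_assoc', div_le_iff₀ hn0, mul_comm]
    exact mul_le_mul_of_nonneg_left (by rw [hn]; linarith) (by positivity)
  have huc : ∃ t : ℝ, 0 < t ∧ ∀ z ∈ unitBox d, ∀ z' ∈ unitBox d, dist z z' < t →
      ∀ j, |b j z - b j z'| ≤ e := by
    have h : ∀ j, ∃ t : ℝ, 0 < t ∧ ∀ z ∈ unitBox d, ∀ z' ∈ unitBox d, dist z z' < t →
        |b j z - b j z'| ≤ e := by
      intro j
      have := (isCompact_Icc (a := fun _ : Fin d => (-1 : ℝ)) (b := fun _ => 1)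
        ).uniformContinuousOn_of_continuous (hb j).continuousOn
      obtain ⟨t, ht, h⟩ := Metric.uniformContinuousOn_iff.mp this e he0
      exact ⟨t, ht, fun z hz z' hz' hd => (h z hz z' hz' hd).le⟩
    choose t ht h using h
    rcases isEmpty_or_nonempty ι with hι | hι
    · exact ⟨1, one_pos, fun _ _ _ _ _ j => hι.elim j⟩
    · obtain ⟨j₀, hj₀⟩ := Finite.exists_min t
      exact ⟨t j₀, ht j₀, fun z hz z' hz' hd j => h j z hz z' hz' (hd.trans_le (hj₀ j))⟩
  obtain ⟨t, ht, huct⟩ := huc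
  obtain ⟨m, hm⟩ := exists_nat_gt (2 / t)
  have hm0' : (0 : ℝ) < m := lt_trans (by positivity) hm
  have hm0 : 0 < m := by exact_mod_cast hm0'
  have hmt : 2 / (m : ℝ) < t := by
    rw [div_lt_iff₀ hm0']; rw [div_lt_iff₀ ht] at hm; linarith
  refine ⟨m, hm0, e, he0, fun B hB θ => ?_⟩
  have hosc : ∀ r : Fin d → Fin m, ∀ z ∈ subBox m r, ∀ z' ∈ subBox m r, ∀ ϑ : ι → ℝ,
      |lin b ϑ z - lin b ϑ z'| ≤ ‖ϑ‖ * (Fintype.card ι * e) := fun r z hz z' hz' ϑ =>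
    abs_sum_mul_sub_le (fun j => huct z (subBox_subset_unitBox r hz) z'
      (subBox_subset_unitBox r hz') ((dist_le_of_mem_subBox hz hz').trans_lt hmt) j) ϑ
  have hBb : ∀ z ∈ unitBox d, ∀ ϑ : ι → ℝ,
      |lin B ϑ z - lin b ϑ z| ≤ ‖ϑ‖ * (Fintype.card ι * e) := fun z hz ϑ =>
    abs_sum_mul_sub_le (fun j => hB j z hz) ϑ
  rcases lt_or_ge ‖θ‖ ρ with hsmall | hlarge
  · refine ⟨∅, by simpa using by positivity, fun r _ z hz z' hz' => ?_⟩
    rw [← Real.dist_eq]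
    refine (hucΦ ?_).le
    rw [Real.dist_eq]
    have h1 := hosc r z hz z' hz' θ
    have h2 := hBb z (subBox_subset_unitBox r hz) θ
    have h3 := hBb z' (subBox_subset_unitBox r hz') θ
    have h4 : ‖θ‖ * (Fintype.card ι * e) ≤ δΦ / 5 := by
      calc _ ≤ ρ * (δΦ / (5 * ρ)) := mul_le_mul hsmall.le (hne.trans (min_le_right _ _))
              (by positivity) hρ0.le
        _ = _ := by field_simp
    rw [abs_le] at h1 h2 h3
    rw [abs_lt]
    constructor <;> linarith
  · have hθ0 : 0 < ‖θ‖ := hρ0.trans_le hlarge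
    set ϑ : ι → ℝ := ‖θ‖⁻¹ • θ with hϑ
    have hϑ1 : ‖ϑ‖ = 1 := by rw [hϑ, norm_smul, norm_inv, norm_norm, inv_mul_cancel₀ hθ0.ne']
    have hθϑ : θ = ‖θ‖ • ϑ := by rw [hϑ, smul_smul, mul_inv_cancel₀ hθ0.ne', one_smul]
    have hnd : (Fintype.card ι : ℝ) * e ≤ δ / 4 := hne.trans (min_le_left _ _)
    -- Only cells lying entirely in the small-value set are bad. Any other cell has a point `w` with
    -- normalized value beyond `δ`, and by closeness the sign and half of this size persist on the
    -- whole cell.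
    refine ⟨Finset.univ.filter fun r => subBox m r ⊆ {z ∈ unitBox d | |lin b ϑ z| ≤ δ},
      card_subBox_le hm0 _ hη.le (hvol ϑ hϑ1) fun r hr => (Finset.mem_filter.mp hr).2, ?_⟩
    intro r hr z hz z' hz'
    rw [Finset.mem_filter, not_and] at hr
    obtain ⟨w, hw, hwδ⟩ := Set.not_subset.mp (hr (Finset.mem_univ r))
    have hwδ' : δ < |lin b ϑ w| := by
      by_contra h
      exact hwδ ⟨subBox_subset_unitBox r hw, not_lt.mp h⟩
    have hclose : ∀ y ∈ subBox m r, |lin B ϑ y - lin b ϑ w| ≤ δ / 2 := by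
      intro y hy
      have h1 := hosc r y hy w hw ϑ
      have h2 := hBb y (subBox_subset_unitBox r hy) ϑ
      rw [hϑ1, one_mul] at h1 h2
      rw [abs_le] at h1 h2 ⊢
      constructor <;> linarith
    have hRθ : R ≤ ‖θ‖ * (δ / 2) := by
      have h1 : ρ * (δ / 2) = 2 * R := by rw [hρ]; field_simp; norm_num
      have h2 := mul_le_mul_of_nonneg_right hlarge (show 0 ≤ δ / 2 by positivity)
      linarith
    rcases lt_abs.mp hwδ' with hpos | hneg
    · have hge : ∀ y ∈ subBox m r, R ≤ lin B θ y := by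
        intro y hy
        rw [hθϑ, lin_smul]
        refine hRθ.trans (mul_le_mul_of_nonneg_left ?_ hθ0.le)
        have := (abs_le.mp (hclose y hy)).1
        linarith
      have h1 := hRtop _ (hge z hz)
      have h2 := hRtop _ (hge z' hz')
      have h3 := hΦ1 (lin B θ z)
      have h4 := hΦ1 (lin B θ z')
      rw [abs_le]; constructor <;> linarith
    · have hle : ∀ y ∈ subBox m r, lin B θ y ≤ -R := by
        intro y hy
        rw [hθϑ, lin_smul]
        have := (abs_le.mp (hclose y hy)).2
        have h5 : lin B ϑ y ≤ -(δ / 2) := by linarith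
        have h6 := mul_le_mul_of_nonneg_left h5 hθ0.le
        linarith
      have h1 := hRbot _ (hle z hz)
      have h2 := hRbot _ (hle z' hz')
      have h3 := hΦ0 (lin B θ z)
      have h4 := hΦ0 (lin B θ z')
      rw [abs_le]; constructor <;> linarith

end Cells

/-! ### Mean values of forward differences. -/

/-- The mean value theorem for iterated forward differences. -/
lemma exists_fwdDiff_iter_eq {n : ℕ} {f : ℝ → ℝ} (hf : ContDiff ℝ n f) (u τ : ℝ) :
    ∃ ξ, |ξ - u| ≤ n * |τ| ∧ (fwdDiff τ)^[n] f u = τ ^ n * iteratedDeriv n f ξ := by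
  induction n generalizing f with
  | zero => exact ⟨u, by simp, by simp⟩
  | succ n ih =>
    have hfn : ContDiff ℝ n f := hf.of_le (by exact_mod_cast Nat.le_succ n)
    have hsh : ContDiff ℝ n fun x => f (x + τ) := hfn.comp (contDiff_id.add contDiff_const)
    have hF : ContDiff ℝ n (fwdDiff τ f) := hsh.sub hfn
    -- The induction hypothesis is used for the first difference of `f`, whose `n`-th derivative is
    -- an increment of `iteratedDeriv n f`; the ordinary mean value theorem treats that increment.
    obtain ⟨ξ, hξ, h⟩ := ih hF
    have hD : iteratedDeriv n (fwdDiff τ f) ξ = iteratedDeriv n f (ξ + τ) - iteratedDeriv n f ξ := by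
      have : fwdDiff τ f = (fun x => f (x + τ)) - f := rfl
      rw [this, iteratedDeriv_sub hsh.contDiffAt hfn.contDiffAt, iteratedDeriv_comp_add_const]
    have hdiff : Differentiable ℝ (iteratedDeriv n f) :=
      hf.differentiable_iteratedDeriv n (by exact_mod_cast Nat.lt_succ_self n)
    obtain ⟨ζ, hζ, hmv⟩ : ∃ ζ, |ζ - ξ| ≤ |τ| ∧
        iteratedDeriv n f (ξ + τ) - iteratedDeriv n f ξ = τ * iteratedDeriv (n + 1) f ζ := by
      rw [iteratedDeriv_succ]
      rcases lt_trichotomy τ 0 with hτ | hτ | hτ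
      · obtain ⟨ζ, hζ, hs⟩ := exists_deriv_eq_slope (iteratedDeriv n f)
          (show ξ + τ < ξ by linarith) hdiff.continuous.continuousOn hdiff.differentiableOn
        refine ⟨ζ, ?_, ?_⟩
        · rw [abs_of_neg hτ, abs_le]; constructor <;> linarith [hζ.1, hζ.2]
        · have := hτ.ne
          rw [hs, show ξ - (ξ + τ) = -τ by ring]; field_simp; ring
      · subst hτ; exact ⟨ξ, by simp, by simp⟩
      · obtain ⟨ζ, hζ, hs⟩ := exists_deriv_eq_slope (iteratedDeriv n f)
          (show ξ < ξ + τ by linarith) hdiff.continuous.continuousOn hdiff.differentiableOn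
        refine ⟨ζ, ?_, ?_⟩
        · rw [abs_of_pos hτ, abs_le]; constructor <;> linarith [hζ.1, hζ.2]
        · have := hτ.ne'
          rw [hs, show ξ + τ - ξ = τ by ring]; field_simp
    refine ⟨ζ, ?_, ?_⟩
    · calc |ζ - u| = |(ζ - ξ) + (ξ - u)| := by ring_nf
        _ ≤ |τ| + n * |τ| := (abs_add_le _ _).trans (add_le_add hζ hξ)
        _ = _ := by push_cast; ring
    · rw [Function.iterate_succ_apply, h, hD, hmv]; ring

/-! ### The local network as a perturbation of a polynomial basis. -/

section Basis

variable {d q : ℕ}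

/-- The linear form `(1, zᵀ) w_j / (d + 1)`. -/
def tilt (W : Matrix (Fin (d + 1)) (Fin (dimPoly d q)) ℝ) (j : Fin (dimPoly d q))
    (z : Fin d → ℝ) : ℝ := (W 0 j + ∑ l, z l * W l.succ j) / (d + 1)

/-- The polynomials `[(1, zᵀ) w_j / (d + 1)] ^ q`. -/
def limBasis (W : Matrix (Fin (d + 1)) (Fin (dimPoly d q)) ℝ) (j : Fin (dimPoly d q))
    (z : Fin d → ℝ) : ℝ := tilt W j z ^ q

/-- The rescaled building blocks of the local network in the coordinate `z = (x - x₀) / h`. -/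
def netBasis (σ : ℝ → ℝ) (u : ℝ) (W : Matrix (Fin (d + 1)) (Fin (dimPoly d q)) ℝ) (h : ℝ)
    (j : Fin (dimPoly d q)) (z : Fin d → ℝ) : ℝ :=
  (∑ k : Fin (q + 1), gammaCoef q σ u k * σ (u + (k : ℕ) * (h * tilt W j z))) / h ^ q

lemma continuous_tilt (W : Matrix (Fin (d + 1)) (Fin (dimPoly d q)) ℝ) (j) :
    Continuous (tilt W j) := by
  unfold tilt; fun_prop

lemma continuous_limBasis (W : Matrix (Fin (d + 1)) (Fin (dimPoly d q)) ℝ) (j) :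
    Continuous (limBasis W j) := (continuous_tilt W j).pow q

/-- Rescaling puts the bandwidth into the basis functions and into the factor `h ^ q` on the
coefficients. As later bounds hold for every coefficient vector, this factor is harmless. -/
lemma localNet_eq_lin (σ : ℝ → ℝ) (u : ℝ) (W : Matrix (Fin (d + 1)) (Fin (dimPoly d q)) ℝ)
    {h : ℝ} (hh : h ≠ 0) (x₀ x : Pt d) (θ : Fin (dimPoly d q) → ℝ) :
    localNet σ u W h x₀ θ x =
      lin (netBasis σ u W h) (h ^ q • θ) fun l => (x l - x₀ l) / h := by
  rw [lin_smul, lin, Finset.mul_sum]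
  refine Finset.sum_congr rfl fun j _ => ?_
  have hq : h ^ q ≠ 0 := pow_ne_zero _ hh
  rw [netBasis, mul_div_assoc', mul_div_assoc', mul_div_cancel_left₀ _ hq, Finset.mul_sum]
  refine Finset.sum_congr rfl fun k _ => ?_
  rw [mul_assoc, neuron]
  congr 3
  simp only [piCol, Fin.cons_zero, Fin.cons_succ, betaCoef, tilt]
  have hd : (d : ℝ) + 1 ≠ 0 := by positivity
  have : ∑ l, (x l - x₀ l) / h * W l.succ j = (∑ l, (x l - x₀ l) * W l.succ j) / h := by
    rw [Finset.sum_div]; exact Finset.sum_congr rfl fun l _ => by ring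
  rw [this]
  have h2 : ∑ l, (x l - x₀ l) * (W l.succ j * ((k : ℕ) : ℝ) / (d + 1)) =
      (∑ l, (x l - x₀ l) * W l.succ j) * ((k : ℕ) : ℝ) / (d + 1) := by
    rw [Finset.sum_mul, Finset.sum_div]; exact Finset.sum_congr rfl fun l _ => by ring
  rw [h2]
  field_simp
  ring

/-- The weights are the signed binomial coefficients of a `q`-th forward difference, divided by the
`q`-th derivative at `u`; the signs agree because `q + k` and `q - k` have the same parity. -/
lemma sum_gammaCoef_mul (σ : ℝ → ℝ) (u τ : ℝ) :
    ∑ k : Fin (q + 1), gammaCoef q σ u k * σ (u + (k : ℕ) * τ) =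
      (fwdDiff τ)^[q] σ u / iteratedDeriv q σ u := by
  rw [fwdDiff_iter_eq_sum_shift, Finset.sum_div]
  refine (Fin.sum_univ_eq_sum_range (fun k : ℕ => (-1) ^ (q + k) * (q.choose k : ℝ) /
    iteratedDeriv q σ u * σ (u + (k : ℕ) * τ)) (q + 1)).trans ?_
  refine Finset.sum_congr rfl fun k hk => ?_
  have hk' : k ≤ q := Nat.lt_succ_iff.mp (Finset.mem_range.mp hk)
  have hsgn : (-1 : ℝ) ^ (q + k) = (-1) ^ (q - k) := by
    rw [show q + k = (q - k) + 2 * k by omega, pow_add, pow_mul]; simp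
  rw [hsgn, nsmul_eq_mul, zsmul_eq_mul]
  push_cast
  ring

/-- As the bandwidth tends to zero, the building blocks of the local network converge to
polynomials. -/
lemma netBasis_close {σ : ℝ → ℝ} {u : ℝ} (hq : 1 ≤ q) (hσ : IsActivation q σ u)
    (W : Matrix (Fin (d + 1)) (Fin (dimPoly d q)) ℝ) {e : ℝ} (he : 0 < e) :
    ∃ h₀ : ℝ, 0 < h₀ ∧ ∀ h, 0 < h → h < h₀ → ∀ j, ∀ z ∈ unitBox d,
      |netBasis σ u W h j z - limBasis W j z| ≤ e := by
  obtain ⟨K, hK0, hK⟩ : ∃ K : ℝ, 0 < K ∧ ∀ j, ∀ z ∈ unitBox d, |tilt W j z| ≤ K := by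
    have h : ∀ j, ∃ K, ∀ z ∈ unitBox d, |tilt W j z| ≤ K := fun j =>
      isCompact_Icc.exists_bound_of_continuousOn (continuous_tilt W j).continuousOn
    choose K hK using h
    refine ⟨1 + ∑ j, |K j|, by positivity, fun j z hz => ?_⟩
    have := (hK j z hz).trans ((le_abs_self _).trans (Finset.single_le_sum
      (f := fun j => |K j|) (fun j _ => abs_nonneg _) (Finset.mem_univ j)))
    linarith
  set D := iteratedDeriv q σ u with hD
  have hD0 : D ≠ 0 := hσ.deriv_ne_zero q hq le_rfl
  have hsq : ContDiff ℝ q σ := hσ.contDiff.of_le (by exact_mod_cast Nat.le_succ q)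
  have hcont : Continuous (iteratedDeriv q σ) := hsq.continuous_iteratedDeriv q le_rfl
  have hKq : 0 < K ^ q := pow_pos hK0 q
  obtain ⟨δ, hδ, hclose⟩ := Metric.continuous_iff.mp hcont u (e * |D| / K ^ q)
    (by have := abs_pos.mpr hD0; positivity)
  have hqr : (0 : ℝ) < q := by exact_mod_cast hq
  refine ⟨δ / (q * K), by positivity, fun h h0 hh j z hz => ?_⟩
  -- The block is `tilt ^ q` times the ratio of the `q`-th derivatives at `ξ` and at `u`, with `ξ`
  -- within `q h K` of `u`; continuity of that derivative makes the ratio close to `1`.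
  obtain ⟨ξ, hξ, hfd⟩ := exists_fwdDiff_iter_eq hsq u (h * tilt W j z)
  have ht := hK j z hz
  have hξδ : dist ξ u < δ := by
    rw [Real.dist_eq]
    refine hξ.trans_lt ?_
    rw [abs_mul, abs_of_pos h0]
    calc (q : ℝ) * (h * |tilt W j z|) ≤ q * (h * K) := by gcongr
      _ = h * (q * K) := by ring
      _ < δ := by rwa [lt_div_iff₀ (by positivity)] at hh
  have h1 := (hclose ξ hξδ).le
  rw [Real.dist_eq] at h1
  have e1 : netBasis σ u W h j z - limBasis W j z =
      tilt W j z ^ q * ((iteratedDeriv q σ ξ - D) / D) := by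
    rw [netBasis, sum_gammaCoef_mul, hfd, limBasis, mul_pow, ← hD]
    field_simp
  rw [e1, abs_mul, abs_pow, abs_div]
  calc |tilt W j z| ^ q * (|iteratedDeriv q σ ξ - D| / |D|) ≤ K ^ q * (e * |D| / K ^ q / |D|) := by
        gcongr
    _ = e := by have := abs_pos.mpr hD0; field_simp

/-- Multisets of size `q` from `d + 1` symbols index the homogeneous monomials of degree `q` in `(1,
x)`, so the design has exactly as many polynomials as there are monomials. -/
lemma card_sym_eq_dimPoly : Fintype.card (Sym (Fin (d + 1)) q) = dimPoly d q := by
  rw [Sym.card_sym_eq_choose, Fintype.card_fin, dimPoly, show d + 1 + q - 1 = d + q by omega,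
    Nat.choose_symm_add]

/-- The constants are in the span of the design polynomials. -/
lemma IsDesign.exists_lin_eq_one {W : Matrix (Fin (d + 1)) (Fin (dimPoly d q)) ℝ}
    (hW : IsDesign W) : ∃ c : Fin (dimPoly d q) → ℝ, ∀ z, lin (limBasis W) c z = 1 := by
  set v : Fin (dimPoly d q) → Pt d → ℝ := fun j x => (W 0 j + ∑ l, x l * W l.succ j) ^ q with hv
  set X : Pt d → Fin (d + 1) → ℝ := fun x => Fin.cons 1 fun l => x l with hX
  set mono : Sym (Fin (d + 1)) q → Pt d → ℝ := fun k x => (k.1.map (X x)).prod with hmono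
  have hmem : ∀ j, v j ∈ Submodule.span ℝ (Set.range mono) := by
    intro j
    have e : v j = ∑ k ∈ (Finset.univ : Finset (Fin (d + 1))).sym q,
        (((k : Multiset (Fin (d + 1))).countPerms : ℝ) * (k.1.map fun i => W i j).prod) • mono k := by
      funext x
      have h1 : W 0 j + ∑ l, x l * W l.succ j = ∑ i, X x i * W i j := by
        rw [Fin.sum_univ_succ]; simp [hX]
      simp only [hv]
      rw [h1, Finset.sum_pow, Finset.sum_apply]
      refine Finset.sum_congr rfl fun k _ => ?_
      rw [Multiset.prod_map_mul, Pi.smul_apply, smul_eq_mul]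
      simp only [hmono]
      rw [mul_comm (Multiset.prod _), ← mul_assoc]
      congr!
    rw [e]
    exact Submodule.sum_mem _ fun k _ => Submodule.smul_mem _ _ (Submodule.subset_span ⟨k, rfl⟩)
  have hle : Submodule.span ℝ (Set.range v) ≤ Submodule.span ℝ (Set.range mono) :=
    Submodule.span_le.mpr (by rintro _ ⟨j, rfl⟩; exact hmem j)
  have hfd : FiniteDimensional ℝ (Submodule.span ℝ (Set.range mono)) :=
    FiniteDimensional.span_of_finite ℝ (Set.finite_range mono)
  -- The span of the monomials has dimension at most their number, which equals the number of
  -- independent vectors `v j` inside it. The constant is the monomial that takes the coordinate `1`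
  -- all `q` times.
  have heq : Submodule.span ℝ (Set.range v) = Submodule.span ℝ (Set.range mono) := by
    refine Submodule.eq_of_le_of_finrank_le hle ?_
    rw [finrank_span_eq_card hW.basis, Fintype.card_fin, ← card_sym_eq_dimPoly]
    exact finrank_range_le_card mono
  have hone : (fun _ => 1 : Pt d → ℝ) ∈ Submodule.span ℝ (Set.range v) := by
    rw [heq]
    refine Submodule.subset_span ⟨Sym.replicate q 0, ?_⟩
    funext x
    simp [hmono, hX, Sym.coe_replicate]
  obtain ⟨c, hc⟩ := (Submodule.mem_span_range_iff_exists_fun ℝ).mp hone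
  refine ⟨fun j => (d + 1) ^ q * c j, fun z => ?_⟩
  have := congrFun hc (WithLp.toLp 2 z)
  rw [Finset.sum_apply] at this
  refine Eq.trans ?_ this
  rw [lin]
  refine Finset.sum_congr rfl fun j _ => ?_
  have hd : ((d : ℝ) + 1) ^ q ≠ 0 := by positivity
  simp only [limBasis, tilt, hv, Pi.smul_apply, smul_eq_mul, div_pow]
  field_simp

/-- Nonzero combinations of the design polynomials have null zero sets. -/
lemma IsDesign.volume_lin_eq_zero {W : Matrix (Fin (d + 1)) (Fin (dimPoly d q)) ℝ}
    (hW : IsDesign W) {θ : Fin (dimPoly d q) → ℝ} (hθ : θ ≠ 0) :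
    volume {z | lin (limBasis W) θ z = 0} = 0 := by
  set p : MvPolynomial (Fin d) ℝ := ∑ j, MvPolynomial.C (θ j) *
    (MvPolynomial.C (W 0 j) + ∑ l, MvPolynomial.X l * MvPolynomial.C (W l.succ j)) ^ q with hp
  have heval : ∀ z, MvPolynomial.eval z p = (d + 1) ^ q * lin (limBasis W) θ z := by
    intro z
    have hd : ((d : ℝ) + 1) ^ q ≠ 0 := by positivity
    simp only [hp, map_sum, map_mul, map_pow, map_add, MvPolynomial.eval_C, MvPolynomial.eval_X,
      lin, limBasis, tilt, div_pow, Finset.mul_sum]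
    exact Finset.sum_congr rfl fun j _ => by field_simp
  have hp0 : p ≠ 0 := by
    intro h
    refine hθ (funext fun j => Fintype.linearIndependent_iff.mp hW.basis θ ?_ j)
    funext x
    have := congrArg (MvPolynomial.eval fun l => x l) h
    simpa [hp] using this
  refine measure_mono_null (fun z hz => ?_) (volume_zeros_mvPolynomial_eq_zero hp0)
  have hz' : lin (limBasis W) θ z = 0 := hz
  simp [heval, hz']

end Basis

/-! ### Laws of the regressors and of the centred outcome. -/

section Law

variable {Ω : Type*} [MeasurableSpace Ω] {μ : Measure Ω}

lemma IsStrictlyStationary.map_eq {S : Type*} [MeasurableSpace S] {Z : ℤ → Ω → S}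
    (hZ : IsStrictlyStationary μ Z) (hm : ∀ t, Measurable (Z t)) (t : ℤ) :
    μ.map (Z t) = μ.map (Z 0) := by
  have h1 : Measurable fun ω t => Z t ω := measurable_pi_lambda _ fun t => hm t
  have h2 : Measurable fun ω s => Z (s + t) ω := measurable_pi_lambda _ fun t => hm _
  have e1 := congrArg (Measure.map fun z : ℤ → S => z 0) (hZ t)
  rw [Measure.map_map (measurable_pi_apply 0) h2, Measure.map_map (measurable_pi_apply 0) h1] at e1
  simpa [Function.comp_def] using e1

variable {d q : ℕ} {a : ℝ} {X : ℤ → Ω → Pt d} {ε : ℤ → Ω → ℝ} {f : Pt d → ℝ} {φ : ℝ → ℝ}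

lemma errorCDF_nonneg (v : ℝ) : 0 ≤ errorCDF μ ε v := cdf_nonneg _ v

lemma errorCDF_le_one (v : ℝ) : errorCDF μ ε v ≤ 1 := cdf_le_one _ v

lemma measurable_errorCDF : Measurable (errorCDF μ ε) := (monotone_cdf _).measurable

lemma IsDataProcess.measurable_pair (h : IsDataProcess μ a X ε f φ) (t : ℤ) :
    Measurable fun ω => (X t ω, ε t ω) := (h.measurable_X t).prodMk (h.measurable_ε t)

lemma IsDataProcess.map_X_eq (h : IsDataProcess μ a X ε f φ) (t : ℤ) :
    μ.map (X t) = volume.withDensity fun x => ENNReal.ofReal (f x) := by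
  rw [← h.law_X]
  have key : ∀ t, μ.map (X t) = (μ.map fun ω => (X 0 ω, ε 0 ω)).map Prod.fst := fun t => by
    rw [← h.stationary.map_eq h.measurable_pair t,
      Measure.map_map measurable_fst (h.measurable_pair t)]
    rfl
  rw [key t, key 1]

lemma IsDataProcess.measure_X_eq_zero (h : IsDataProcess μ a X ε f φ) {A : Set (Pt d)}
    (hA : volume A = 0) (t : ℤ) : μ {ω | X t ω ∈ A} = 0 := by
  have hac : μ.map (X t) A = 0 := by
    rw [h.map_X_eq]; exact withDensity_absolutelyContinuous _ _ hA
  exact nonpos_iff_eq_zero.mp ((Measure.le_map_apply (h.measurable_X t).aemeasurable A).trans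
    hac.le)

lemma IsDataProcess.measureReal_X_le (h : IsDataProcess μ a X ε f φ) {c₂ : ℝ}
    (hc : ∀ x ∈ box d a, f x ≤ c₂) (hc0 : 0 ≤ c₂) {A : Set (Pt d)} (hAm : MeasurableSet A)
    (hA : A ⊆ box d a) {v : ℝ} (hv0 : 0 ≤ v) (hv : volume A ≤ ENNReal.ofReal v) (t : ℤ) :
    μ.real {ω | X t ω ∈ A} ≤ c₂ * v := by
  have e : μ {ω | X t ω ∈ A} = μ.map (X t) A := by
    rw [Measure.map_apply (h.measurable_X t) hAm]; rfl
  have hle : μ {ω | X t ω ∈ A} ≤ ENNReal.ofReal (c₂ * v) := by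
    rw [e, h.map_X_eq, withDensity_apply _ hAm, ENNReal.ofReal_mul hc0]
    calc _ ≤ ∫⁻ _ in A, ENNReal.ofReal c₂ :=
          setLIntegral_mono measurable_const fun x hx => ENNReal.ofReal_le_ofReal (hc x (hA hx))
      _ = ENNReal.ofReal c₂ * volume A := setLIntegral_const _ _
      _ ≤ _ := by gcongr
  exact ENNReal.toReal_le_of_le_ofReal (by positivity) hle

open Classical in
/-- The centred outcome, as a function of the regressor and of the error. -/
def centredOutcome (μ : Measure Ω) (ε : ℤ → Ω → ℝ) (g : Pt d → ℝ) (z : Pt d × ℝ) : ℝ :=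
  (if z.2 ≤ g z.1 then 1 else 0) - errorCDF μ ε (g z.1)

lemma measurable_centredOutcome {g : Pt d → ℝ} (hg : Measurable g) :
    Measurable (centredOutcome μ ε g) := by
  classical
  refine Measurable.sub (Measurable.ite (measurableSet_le measurable_snd (hg.comp measurable_fst))
    measurable_const measurable_const) (measurable_errorCDF.comp (hg.comp measurable_fst))

lemma abs_centredOutcome_le (g : Pt d → ℝ) (z : Pt d × ℝ) : |centredOutcome μ ε g z| ≤ 1 := by
  have h0 := errorCDF_nonneg (μ := μ) (ε := ε) (g z.1)
  have h1 := errorCDF_le_one (μ := μ) (ε := ε) (g z.1)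
  unfold centredOutcome
  split_ifs <;> rw [abs_le] <;> constructor <;> linarith

variable [IsProbabilityMeasure μ]

/-- The distribution function of the errors is uniformly continuous. -/
lemma IsDataProcess.uniformContinuous_errorCDF (h : IsDataProcess μ a X ε f φ) :
    UniformContinuous (errorCDF μ ε) := by
  have : IsProbabilityMeasure (μ.map (ε 1)) :=
    Measure.isProbabilityMeasure_map (h.measurable_ε 1).aemeasurable
  have hfin : ∫⁻ v, ENNReal.ofReal (φ v) ≠ ∞ := by
    have h1 := measure_univ (μ := μ.map (ε 1))
    rw [h.law_ε, withDensity_apply _ MeasurableSet.univ, setLIntegral_univ] at h1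
    rw [h1]; simp
  have hmono : ∀ e > 0, ∃ δ > 0, ∀ x y : ℝ, x ≤ y → y - x < δ →
      |errorCDF μ ε y - errorCDF μ ε x| < e := by
    intro e he
    -- Absolute continuity of the integral of the error density: intervals of small length have
    -- small mass, wherever they lie.
    obtain ⟨δ, hδ, hδe⟩ := exists_pos_setLIntegral_lt_of_measure_lt hfin
      (ε := ENNReal.ofReal e) (by simpa using he)
    obtain ⟨δ', hδ'0, hδ'⟩ : ∃ δ' : ℝ, 0 < δ' ∧ ENNReal.ofReal δ' ≤ δ := by
      rcases eq_or_ne δ ∞ with rfl | hne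
      · exact ⟨1, one_pos, le_top⟩
      · exact ⟨δ.toReal, ENNReal.toReal_pos hδ.ne' hne, by rw [ENNReal.ofReal_toReal hne]⟩
    refine ⟨δ', hδ'0, fun x y hxy hlt => ?_⟩
    have hm : (μ.map (ε 1)) (Set.Ioc x y) < ENNReal.ofReal e := by
      rw [h.law_ε, withDensity_apply _ measurableSet_Ioc]
      refine hδe _ ?_
      rw [Real.volume_Ioc]
      exact ((ENNReal.ofReal_lt_ofReal_iff hδ'0).mpr hlt).trans_le hδ'
    have h2 : errorCDF μ ε y - errorCDF μ ε x = (μ.map (ε 1)).real (Set.Ioc x y) := by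
      rw [errorCDF, errorCDF, cdf_eq_real, cdf_eq_real, ← Set.Iic_sdiff_Iic,
        measureReal_sdiff (Set.Iic_subset_Iic.mpr hxy) measurableSet_Iic]
    rw [h2, abs_of_nonneg measureReal_nonneg]
    rw [Measure.real, ← ENNReal.toReal_ofReal he.le]
    exact (ENNReal.toReal_lt_toReal (measure_ne_top _ _) ENNReal.ofReal_ne_top).mpr hm
  rw [Metric.uniformContinuous_iff]
  intro e he
  obtain ⟨δ, hδ, hh⟩ := hmono e he
  refine ⟨δ, hδ, fun {x y} hxy => ?_⟩
  rw [Real.dist_eq] at hxy ⊢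
  rcases le_total x y with hle | hle
  · rw [abs_sub_comm]; refine hh x y hle ?_
    rw [abs_lt] at hxy; linarith
  · refine hh y x hle ?_
    rw [abs_lt] at hxy; linarith

/-- The centred outcome is uncorrelated with all functions of the regressor. -/
lemma IsDataProcess.integral_mul_centredOutcome (h : IsDataProcess μ a X ε f φ) {g ψ : Pt d → ℝ}
    (hg : Measurable g) (hψ : Measurable ψ) {K : ℝ} (hK : ∀ x, |ψ x| ≤ K) :
    ∫ ω, ψ (X 0 ω) * centredOutcome μ ε g (X 0 ω, ε 0 ω) ∂μ = 0 := by
  classical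
  have hF : Measurable fun z : Pt d × ℝ => ψ z.1 * centredOutcome μ ε g z :=
    (hψ.comp measurable_fst).mul (measurable_centredOutcome hg)
  have hPε : IsProbabilityMeasure (μ.map (ε 1)) :=
    Measure.isProbabilityMeasure_map (h.measurable_ε 1).aemeasurable
  have hPX : IsProbabilityMeasure (μ.map (X 1)) :=
    Measure.isProbabilityMeasure_map (h.measurable_X 1).aemeasurable
  -- Independence and the error law are given at time `1`, so stationarity first moves the
  -- expectation there. Then the joint law is a product, and the inner integral over the error
  -- vanishes for every fixed regressor.
  have e0 := h.stationary.integral_eq h.measurable_pair hF 1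
  rw [← e0, ← integral_map (φ := fun ω => (X 1 ω, ε 1 ω)) (h.measurable_pair 1).aemeasurable
    hF.aestronglyMeasurable, (indepFun_iff_map_prod_eq_prod_map_map (h.measurable_X 1).aemeasurable
    (h.measurable_ε 1).aemeasurable).mp h.indep]
  have hint : Integrable (fun z : Pt d × ℝ => ψ z.1 * centredOutcome μ ε g z)
      ((μ.map (X 1)).prod (μ.map (ε 1))) := by
    refine .of_bound hF.aestronglyMeasurable (K * 1) (ae_of_all _ fun z => ?_)
    rw [Real.norm_eq_abs, abs_mul]
    exact mul_le_mul (hK _) (abs_centredOutcome_le g z) (abs_nonneg _)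
      ((abs_nonneg _).trans (hK z.1))
  rw [integral_prod _ hint]
  have hin : ∀ x, ∫ v, ψ x * centredOutcome μ ε g (x, v) ∂(μ.map (ε 1)) = 0 := by
    intro x
    have e1 : ∀ v, centredOutcome μ ε g (x, v) =
        (Set.Iic (g x)).indicator 1 v - errorCDF μ ε (g x) := fun v => by
      simp [centredOutcome, Set.indicator_apply]
    simp_rw [e1]
    have hi : Integrable ((Set.Iic (g x)).indicator (1 : ℝ → ℝ)) (μ.map (ε 1)) :=
      (integrable_const (1 : ℝ)).indicator measurableSet_Iic
    rw [integral_const_mul, integral_sub hi (integrable_const _), integral_indicator_one measurableSet_Iic]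
    simp [errorCDF, cdf_eq_real]
  simp [hin]

end Law

/-! ### Geometry of cubes, cells and walls. -/

section Grid

variable {d : ℕ}

lemma isClosed_box (d : ℕ) (a : ℝ) : IsClosed (box d a) := by
  have : box d a = ⋂ j, {x : Pt d | |x j| ≤ a} := by ext; simp [box]
  rw [this]
  exact isClosed_iInter fun j => isClosed_le (by fun_prop) continuous_const

lemma isCompact_box (d : ℕ) (a : ℝ) : IsCompact (box d a) := by
  have h : IsCompact (Set.Icc (fun _ : Fin d => -a) fun _ => a) := isCompact_Icc
  have e : box d a = (EuclideanSpace.equiv (Fin d) ℝ).symm '' Set.Icc (fun _ => -a) fun _ => a := by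
    ext x
    constructor
    · intro hx
      exact ⟨fun j => x j, ⟨fun j => (abs_le.mp (hx j)).1, fun j => (abs_le.mp (hx j)).2⟩, rfl⟩
    · rintro ⟨z, hz, rfl⟩ j
      exact abs_le.mpr ⟨hz.1 j, hz.2 j⟩
  rw [e]
  exact h.image (EuclideanSpace.equiv (Fin d) ℝ).symm.continuous

/-- The union of the walls of the cubes into which `[-a, a]^d` is divided. -/
def walls (d : ℕ) (a : ℝ) (N : ℕ) : Set (Pt d) :=
  {x | ∃ j, ∃ n : ℤ, x j = -a + 2 * (a / N) * n}

lemma volume_walls (a : ℝ) (N : ℕ) : volume (walls d a N) = 0 := by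
  have e : walls d a N = ⋃ j : Fin d, ⋃ n : ℤ, {x : Pt d | x j = -a + 2 * (a / N) * n} := by
    ext x; simp [walls]
  rw [e]
  refine measure_iUnion_null fun j => measure_iUnion_null fun n => ?_
  have hm : MeasurableSet {z : Fin d → ℝ | z j = -a + 2 * (a / N) * n} :=
    measurable_pi_apply j (measurableSet_singleton _)
  have := (PiLp.volume_preserving_ofLp (Fin d)).measure_preimage hm.nullMeasurableSet
  rw [volume_pi, Measure.pi_hyperplane] at this
  exact this

/-- The half-open cell with index `r` in the coarse cube with index `i`. -/
def cell (d : ℕ) (a : ℝ) (M m : ℕ) (I : (Fin d → Fin M) × (Fin d → Fin m)) : Set (Pt d) :=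
  {x | ∀ j, ⌊(x j + a) * (M * m) / (2 * a)⌋ = ((I.1 j : ℕ) * m + (I.2 j : ℕ) : ℤ)}

variable {a : ℝ} {M m : ℕ}

lemma measurableSet_cell (I) : MeasurableSet (cell d a M m I) := by
  have e : cell d a M m I = ⋂ j, (fun x : Pt d => ⌊(x j + a) * (M * m) / (2 * a)⌋) ⁻¹'
      {((I.1 j : ℕ) * m + (I.2 j : ℕ) : ℤ)} := by ext; simp [cell]
  rw [e]
  refine MeasurableSet.iInter fun j => ?_
  exact (Int.measurable_floor.comp (by fun_prop)) (measurableSet_singleton _)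

lemma eq_of_mem_cell {x : Pt d} {I I'} (h : x ∈ cell d a M m I) (h' : x ∈ cell d a M m I') :
    I = I' := by
  have key : ∀ j, (I.1 j : ℕ) = I'.1 j ∧ (I.2 j : ℕ) = I'.2 j := by
    intro j
    have e := (h j).symm.trans (h' j)
    have e' : (I.1 j : ℕ) * m + (I.2 j : ℕ) = (I'.1 j : ℕ) * m + (I'.2 j : ℕ) := by
      exact_mod_cast e
    have h1 := (I.2 j).isLt
    have h2 := (I'.2 j).isLt
    have hm : 0 < m := (I.2 j).pos
    constructor
    · have := congrArg (· / m) e'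
      simpa [mul_comm _ m, Nat.mul_add_div hm, Nat.div_eq_of_lt h1, Nat.div_eq_of_lt h2] using this
    · have := congrArg (· % m) e'
      simpa [mul_comm _ m, Nat.mul_add_mod, Nat.mod_eq_of_lt h1, Nat.mod_eq_of_lt h2] using this
  exact Prod.ext (funext fun j => Fin.ext (key j).1) (funext fun j => Fin.ext (key j).2)

lemma mem_cell_bounds (ha : 0 < a) (hM : 0 < M) (hm : 0 < m) {x : Pt d} {I}
    (h : x ∈ cell d a M m I) (j : Fin d) :
    -a + 2 * (a / M) * (I.1 j : ℕ) + 2 * (a / M) * ((I.2 j : ℕ) / m) ≤ x j ∧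
      x j < -a + 2 * (a / M) * (I.1 j : ℕ) + 2 * (a / M) * (((I.2 j : ℕ) + 1) / m) := by
  have hM' : (0 : ℝ) < M := by exact_mod_cast hM
  have hm' : (0 : ℝ) < m := by exact_mod_cast hm
  obtain ⟨h1, h2⟩ := Int.floor_eq_iff.mp (h j)
  push_cast at h1 h2
  rw [le_div_iff₀ (by positivity)] at h1
  rw [div_lt_iff₀ (by positivity)] at h2
  have hMm : 0 < (M : ℝ) * m := by positivity
  constructor
  · have e : -a + 2 * (a / M) * (I.1 j : ℕ) + 2 * (a / M) * (((I.2 j : ℕ) : ℝ) / m) =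
      -a + (((I.1 j : ℕ) : ℝ) * m + (I.2 j : ℕ)) * (2 * a) / (M * m) := by field_simp; ring
    rw [e, ← le_sub_iff_add_le', div_le_iff₀ hMm]
    linarith
  · have e : -a + 2 * (a / M) * (I.1 j : ℕ) + 2 * (a / M) * ((((I.2 j : ℕ) : ℝ) + 1) / m) =
      -a + (((I.1 j : ℕ) : ℝ) * m + (I.2 j : ℕ) + 1) * (2 * a) / (M * m) := by field_simp; ring
    rw [e, ← sub_lt_iff_lt_add', lt_div_iff₀ hMm]
    linarith

lemma center_apply (i : Fin d → Fin M) (j : Fin d) :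
    (center a i : Pt d) j = -a + (2 * ((i j : ℕ) : ℝ) + 1) * (a / M) := rfl

/-- The rescaled position of a point of a cell. -/
lemma scaled_mem_subBox (ha : 0 < a) (hM : 0 < M) (hm : 0 < m) {x : Pt d} {I}
    (h : x ∈ cell d a M m I) :
    (fun l => (x l - (center a I.1 : Pt d) l) / (a / M)) ∈ subBox m I.2 := by
  have hM' : (0 : ℝ) < M := by exact_mod_cast hM
  have hh : 0 < a / M := by positivity
  refine ⟨fun j => ?_, fun j => ?_⟩
  · simp only
    rw [le_div_iff₀ hh, center_apply]
    have := (mem_cell_bounds ha hM hm h j).1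
    linarith [show (-1 + 2 * ((I.2 j : ℕ) : ℝ) / m) * (a / M) =
      -(a / M) + 2 * (a / M) * (((I.2 j : ℕ) : ℝ) / m) by ring]
  · simp only
    rw [div_le_iff₀ hh, center_apply]
    have := (mem_cell_bounds ha hM hm h j).2
    linarith [show (-1 + 2 * (((I.2 j : ℕ) : ℝ) + 1) / m) * (a / M) =
      -(a / M) + 2 * (a / M) * ((((I.2 j : ℕ) : ℝ) + 1) / m) by ring]

lemma mem_cube_iff_scaled (ha : 0 < a) (hM : 0 < M) {x : Pt d} {i : Fin d → Fin M} :
    x ∈ cube (center a i) (a / M) ↔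
      (fun l => (x l - (center a i : Pt d) l) / (a / M)) ∈ unitBox d := by
  have hM' : (0 : ℝ) < M := by exact_mod_cast hM
  have hh : 0 < a / M := by positivity
  have e : ∀ j, |x j - (center a i : Pt d) j| ≤ a / M ↔
      -1 ≤ (x j - (center a i : Pt d) j) / (a / M) ∧
        (x j - (center a i : Pt d) j) / (a / M) ≤ 1 := fun j => by
    rw [abs_le, le_div_iff₀ hh, div_le_iff₀ hh, neg_one_mul, one_mul]
  constructor
  · intro h
    exact ⟨fun j => ((e j).mp (h j)).1, fun j => ((e j).mp (h j)).2⟩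
  · intro h j
    exact (e j).mpr ⟨h.1 j, h.2 j⟩

lemma cell_subset_cube (ha : 0 < a) (hM : 0 < M) (hm : 0 < m) (I) :
    cell d a M m I ⊆ cube (center a I.1) (a / M) := fun _ h =>
  (mem_cube_iff_scaled ha hM).mpr (subBox_subset_unitBox _ (scaled_mem_subBox ha hM hm h))

lemma cube_subset_box (ha : 0 < a) (hM : 0 < M) (i : Fin d → Fin M) :
    cube (center a i) (a / M) ⊆ box d a := by
  intro x hx j
  have hM' : (0 : ℝ) < M := by exact_mod_cast hM
  have hh : 0 < a / M := by positivity
  have h1 := abs_le.mp (hx j)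
  rw [center_apply] at h1
  have h2 : ((i j : ℕ) : ℝ) + 1 ≤ M := by exact_mod_cast (i j).isLt
  have h3 : (a / M) * (((i j : ℕ) : ℝ) + 1) ≤ a := by
    calc _ ≤ (a / M) * M := mul_le_mul_of_nonneg_left h2 hh.le
      _ = a := by field_simp
  have h4 : 0 ≤ (a / M) * ((i j : ℕ) : ℝ) := by positivity
  rw [abs_le]
  constructor <;> linarith [h1.1, h1.2]

lemma center_mem_box (ha : 0 < a) (hM : 0 < M) (i : Fin d → Fin M) :
    (center a i : Pt d) ∈ box d a := by
  refine cube_subset_box ha hM i fun j => ?_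
  simp only [sub_self, abs_zero]
  positivity

lemma exists_mem_cell (ha : 0 < a) (hM : 0 < M) (hm : 0 < m) {x : Pt d} (hx : x ∈ box d a)
    (hw : x ∉ walls d a M) : ∃ I, x ∈ cell d a M m I := by
  have hM' : (0 : ℝ) < M := by exact_mod_cast hM
  have hm' : (0 : ℝ) < m := by exact_mod_cast hm
  have hlt : ∀ j, x j < a := by
    intro j
    -- The half-open cells miss the upper faces of the box, but these are the walls with `n = M`.
    refine lt_of_le_of_ne (abs_le.mp (hx j)).2 fun h => hw ⟨j, M, ?_⟩
    rw [h]; push_cast; field_simp; ring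
  have key : ∀ j, ∃ n : ℕ, n < M * m ∧ ⌊(x j + a) * (M * m) / (2 * a)⌋ = (n : ℤ) := by
    intro j
    have h0 : 0 ≤ (x j + a) * (M * m) / (2 * a) := by
      have := (abs_le.mp (hx j)).1
      have h : 0 ≤ x j + a := by linarith
      positivity
    have h1 : (x j + a) * (M * m) / (2 * a) < (M * m : ℕ) := by
      rw [div_lt_iff₀ (by positivity)]
      push_cast
      have := hlt j
      have hMm : 0 < (M : ℝ) * m := by positivity
      nlinarith
    refine ⟨⌊(x j + a) * (M * m) / (2 * a)⌋₊, (Nat.floor_lt h0).mpr h1, ?_⟩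
    exact (Int.natCast_floor_eq_floor h0).symm
  choose n hn he using key
  refine ⟨⟨fun j => ⟨n j / m, Nat.div_lt_of_lt_mul (by rw [mul_comm]; exact hn j)⟩,
    fun j => ⟨n j % m, Nat.mod_lt _ hm⟩⟩, fun j => ?_⟩
  rw [he j]
  simp only
  have := Nat.div_add_mod (n j) m
  rw [mul_comm] at this
  exact_mod_cast this.symm

/-- Off the walls the floor of `(x j + a) / (2h)` recovers the index of the closed cube; the only
ambiguity would be at an upper face, which is a wall. -/
lemma eq_of_mem_cube (ha : 0 < a) (hM : 0 < M) {x : Pt d} (hw : x ∉ walls d a M)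
    {i i' : Fin d → Fin M} (h : x ∈ cube (center a i) (a / M))
    (h' : x ∈ cube (center a i') (a / M)) : i = i' := by
  have hM' : (0 : ℝ) < M := by exact_mod_cast hM
  have hh : 0 < a / M := by positivity
  have key : ∀ i : Fin d → Fin M, x ∈ cube (center a i) (a / M) → ∀ j,
      ⌊(x j + a) / (2 * (a / M))⌋ = ((i j : ℕ) : ℤ) := by
    intro i hi j
    have h1 := abs_le.mp (hi j)
    rw [center_apply] at h1
    rw [Int.floor_eq_iff, le_div_iff₀ (by positivity), div_lt_iff₀ (by positivity)]
    push_cast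
    refine ⟨by linarith [h1.1], lt_of_le_of_ne (by linarith [h1.2]) fun e => ?_⟩
    refine hw ⟨j, (i j : ℕ) + 1, ?_⟩
    push_cast
    linarith
  funext j
  have := (key i h j).symm.trans (key i' h' j)
  exact Fin.ext (by exact_mod_cast this)

lemma volume_cell_le (ha : 0 < a) (hM : 0 < M) (hm : 0 < m) (I) :
    volume (cell d a M m I) ≤ ENNReal.ofReal ((2 * a / (M * m)) ^ d) := by
  have hM' : (0 : ℝ) < M := by exact_mod_cast hM
  have hm' : (0 : ℝ) < m := by exact_mod_cast hm
  set lo : Fin d → ℝ := fun j =>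
    -a + 2 * (a / M) * (I.1 j : ℕ) + 2 * (a / M) * (((I.2 j : ℕ) : ℝ) / m) with hlo
  set hi : Fin d → ℝ := fun j =>
    -a + 2 * (a / M) * (I.1 j : ℕ) + 2 * (a / M) * ((((I.2 j : ℕ) : ℝ) + 1) / m) with hhi
  have hsub : cell d a M m I ⊆ (fun x : Pt d => (x : Fin d → ℝ)) ⁻¹'
      Set.pi Set.univ fun j => Set.Ico (lo j) (hi j) := fun x hx j _ =>
    mem_cell_bounds ha hM hm hx j
  have hms : MeasurableSet (Set.pi Set.univ fun j => Set.Ico (lo j) (hi j)) :=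
    MeasurableSet.univ_pi fun j => measurableSet_Ico
  refine (measure_mono hsub).trans (le_of_eq ?_)
  refine ((PiLp.volume_preserving_ofLp (Fin d)).measure_preimage hms.nullMeasurableSet).trans ?_
  rw [Real.volume_pi_Ico]
  have : ∀ j, hi j - lo j = 2 * a / (M * m) := fun j => by
    simp only [hlo, hhi]; field_simp; ring
  simp only [this, Finset.prod_const, Finset.card_univ, Fintype.card_fin]
  rw [ENNReal.ofReal_pow (by positivity)]

end Grid

/-! ### The basic inequality for Bernoulli likelihoods. -/

section Likelihood

/-- With `w = √r`, `log r = 2 log w ≤ 2 (w - 1) = (r - 1) - (w - 1)²`. Moreover `r - 1 = (w - 1)(w +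
1)` and `(w + 1)² ≤ 2 (r + 1) ≤ 4R`. -/
lemma log_le_sub_one_sub_sq {r R : ℝ} (hr : 0 < r) (hR : 1 ≤ R) (hrR : r ≤ R) :
    Real.log r ≤ (r - 1) - (r - 1) ^ 2 / (4 * R) := by
  set w := Real.sqrt r with hw
  have hw0 : 0 < w := Real.sqrt_pos.mpr hr
  have hr2 : r = w ^ 2 := (Real.sq_sqrt hr.le).symm
  have h1 : Real.log r ≤ 2 * (w - 1) := by
    rw [hr2, Real.log_pow]
    have := Real.log_le_sub_one_of_pos hw0
    push_cast
    linarith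
  have h2 : (w + 1) ^ 2 ≤ 4 * R := by nlinarith [sq_nonneg (w - 1)]
  have h3 : (r - 1) ^ 2 / (4 * R) ≤ (w - 1) ^ 2 := by
    rw [div_le_iff₀ (by linarith)]
    calc (r - 1) ^ 2 = (w - 1) ^ 2 * (w + 1) ^ 2 := by rw [hr2]; ring
      _ ≤ (w - 1) ^ 2 * (4 * R) := mul_le_mul_of_nonneg_left h2 (sq_nonneg _)
  nlinarith

/-- The Bernoulli probability of the outcome `y`. -/
def bern (p : ℝ) (y : ℕ) : ℝ := (1 - p) ^ (1 - y) * p ^ y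

/-- The log ratio of `P` to `Q` is split at the true probability `G`. From `P` to `G` the quadratic
bound with `R = 1 / κ` applies, and its linear term is `P - G` times the score. From `G` to `Q` the
log ratio is at most `2δ / κ`, as the comparator's probability of the outcome is at least `κ / 2`.
-/
lemma log_bern_le {P Q G κ δ : ℝ} {y : ℕ} (hy : y = 0 ∨ y = 1) (hκ : 0 < κ)
    (hG0 : 0 ≤ G) (hG1 : G ≤ 1) (hG : κ ≤ (1 - G) * G) (hP0 : 0 ≤ P) (hP1 : P ≤ 1)
    (hδ : δ ≤ κ / 2) (hQ : |Q - G| ≤ δ) (hP : 0 < bern P y) :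
    0 < bern Q y ∧ Real.log (bern P y) - Real.log (bern Q y) ≤
      (P - G) * ((y - G) / (G * (1 - G))) - κ / 4 * (P - G) ^ 2 + 2 * δ / κ := by
  have hκG : κ ≤ G := by nlinarith
  have hκG' : κ ≤ 1 - G := by nlinarith
  rw [abs_le] at hQ
  have main : ∀ p p' e v : ℝ, κ ≤ p → p ≤ 1 → 0 < p' → p' ≤ 1 → |e - p| ≤ δ →
      p' / p - 1 = v → (P - G) ^ 2 ≤ v ^ 2 → 0 < e ∧ Real.log p' - Real.log e ≤
        v - κ / 4 * (P - G) ^ 2 + 2 * δ / κ := by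
    intro p p' e v hp hp1 hp' hp'1 he hv hsq
    rw [abs_le] at he
    have hp0 : 0 < p := hκ.trans_le hp
    have he0 : κ / 2 ≤ e := by linarith
    have he00 : 0 < e := by linarith
    refine ⟨he00, ?_⟩
    have hδ0 : 0 ≤ δ := by linarith
    have h1 : Real.log (p' / p) ≤ (p' / p - 1) - (p' / p - 1) ^ 2 / (4 * (1 / κ)) := by
      refine log_le_sub_one_sub_sq (by positivity) ?_ ?_
      · rw [le_div_iff₀ hκ]; linarith
      · rw [div_le_div_iff₀ hp0 hκ]; nlinarith
    have h2 : Real.log (p / e) ≤ 2 * δ / κ := by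
      refine (Real.log_le_sub_one_of_pos (by positivity)).trans ?_
      have : p / e - 1 = (p - e) / e := by field_simp
      rw [this, div_le_div_iff₀ he00 hκ]
      nlinarith
    rw [Real.log_div hp'.ne' hp0.ne'] at h1
    rw [Real.log_div hp0.ne' he00.ne'] at h2
    rw [hv] at h1
    have h3 : v ^ 2 / (4 * (1 / κ)) = κ / 4 * v ^ 2 := by field_simp
    rw [h3] at h1
    have h4 : κ / 4 * (P - G) ^ 2 ≤ κ / 4 * v ^ 2 :=
      mul_le_mul_of_nonneg_left hsq (by linarith)
    linarith
  have hG0' : G ≠ 0 := by linarith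
  have hG1' : 1 - G ≠ 0 := by linarith
  have hsq : ∀ r : ℝ, 0 < r → r ≤ 1 → (P - G) ^ 2 ≤ ((P - G) / r) ^ 2 := by
    intro r hr hr1
    rw [div_pow, le_div_iff₀ (by positivity)]
    have : r ^ 2 ≤ 1 := pow_le_one₀ hr.le hr1
    nlinarith [sq_nonneg (P - G)]
  rcases hy with rfl | rfl
  · simp only [bern, Nat.sub_zero, pow_one, pow_zero, mul_one] at hP ⊢
    refine main (1 - G) (1 - P) (1 - Q) _ hκG' (by linarith) hP (by linarith)
      (by rw [abs_le]; constructor <;> linarith) ?_ ?_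
    · push_cast; field_simp; ring
    · have := hsq (1 - G) (by linarith) (by linarith)
      have e : (P - G) * ((((0 : ℕ) : ℝ) - G) / (G * (1 - G))) = -((P - G) / (1 - G)) := by
        push_cast; field_simp; ring
      rw [e, neg_sq]; exact this
  · simp only [bern, Nat.sub_self, pow_one, pow_zero, one_mul] at hP ⊢
    refine main G P Q _ hκG hG1 hP hP1 (by rw [abs_le]; constructor <;> linarith) ?_ ?_
    · push_cast; field_simp
    · have := hsq G (by linarith) hG1
      have e : (P - G) * ((((1 : ℕ) : ℝ) - G) / (G * (1 - G))) = (P - G) / G := by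
        push_cast; field_simp
      rw [e]; exact this

/-- The basic inequality for a Bernoulli likelihood which is at least as large as that of a
comparator. -/
lemma sum_sq_le_of_likelihood_le {τ : Type*} (A : Finset τ) {P Q G : τ → ℝ} {y : τ → ℕ} {κ δ : ℝ}
    (hy : ∀ t ∈ A, y t = 0 ∨ y t = 1) (hκ : 0 < κ)
    (hG0 : ∀ t ∈ A, 0 ≤ G t) (hG1 : ∀ t ∈ A, G t ≤ 1) (hG : ∀ t ∈ A, κ ≤ (1 - G t) * G t)
    (hP0 : ∀ t ∈ A, 0 ≤ P t) (hP1 : ∀ t ∈ A, P t ≤ 1)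
    (hδ : δ ≤ κ / 2) (hQ : ∀ t ∈ A, |Q t - G t| ≤ δ)
    (hlik : ∏ t ∈ A, bern (Q t) (y t) ≤ ∏ t ∈ A, bern (P t) (y t)) :
    κ / 4 * ∑ t ∈ A, (P t - G t) ^ 2 ≤
      ∑ t ∈ A, (P t - G t) * ((y t - G t) / (G t * (1 - G t))) + A.card * (2 * δ / κ) := by
  have hb0 : ∀ {p : ℝ} {y : ℕ}, 0 ≤ p → p ≤ 1 → 0 ≤ bern p y := fun h0 h1 =>
    mul_nonneg (pow_nonneg (by linarith) _) (pow_nonneg h0 _)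
  have hQpos : ∀ t ∈ A, 0 < bern (Q t) (y t) := by
    intro t ht
    have hG' := hG t ht
    have hκG : κ ≤ G t := by nlinarith [hG0 t ht, hG1 t ht]
    have hκG' : κ ≤ 1 - G t := by nlinarith [hG0 t ht, hG1 t ht]
    have := abs_le.mp (hQ t ht)
    exact mul_pos (pow_pos (by linarith) _) (pow_pos (by linarith) _)
  -- The comparator's likelihood is positive, so no factor of the larger likelihood vanishes and
  -- logarithms may be taken.
  have hPpos : ∀ t ∈ A, 0 < bern (P t) (y t) := by
    intro t ht
    have h0 := (Finset.prod_pos hQpos).trans_le hlik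
    exact lt_of_le_of_ne (hb0 (hP0 t ht) (hP1 t ht))
      (Finset.prod_ne_zero_iff.mp h0.ne' t ht).symm
  have hlog : 0 ≤ ∑ t ∈ A, (Real.log (bern (P t) (y t)) - Real.log (bern (Q t) (y t))) := by
    rw [Finset.sum_sub_distrib, ← Real.log_prod fun t ht => (hPpos t ht).ne',
      ← Real.log_prod fun t ht => (hQpos t ht).ne', sub_nonneg]
    exact Real.log_le_log (Finset.prod_pos hQpos) hlik
  have hle := hlog.trans (Finset.sum_le_sum fun t ht => (log_bern_le (hy t ht) hκ (hG0 t ht)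
    (hG1 t ht) (hG t ht) (hP0 t ht) (hP1 t ht) hδ (hQ t ht) (hPpos t ht)).2)
  rw [Finset.sum_add_distrib, Finset.sum_sub_distrib, ← Finset.mul_sum, Finset.sum_const,
    nsmul_eq_mul] at hle
  linarith

end Likelihood

/-! ### Weighted sums over a partition with few bad cells. -/

section Partition

/-- A weighted sum whose weights are nearly constant on each good cell of a partition. -/
lemma sum_mul_le_sum_abs_add {τ κ : Type*} [DecidableEq κ] (A : Finset τ) (S : Finset κ)
    (cl : τ → κ)
    (hcl : ∀ t ∈ A, cl t ∈ S) (bad : Finset κ) (hbad : bad ⊆ S) {P ζ : τ → ℝ} {K η : ℝ}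
    (hη : 0 ≤ η) (hP : ∀ t ∈ A, |P t| ≤ 1) (hζ : ∀ t ∈ A, |ζ t| ≤ K)
    (hosc : ∀ t ∈ A, ∀ t' ∈ A, cl t = cl t' → cl t ∉ bad → |P t - P t'| ≤ η) :
    ∑ t ∈ A, P t * ζ t ≤ ∑ I ∈ S, |∑ t ∈ A with cl t = I, ζ t| + η * K * A.card +
      K * ∑ I ∈ bad, ((A.filter fun t => cl t = I).card : ℝ) := by
  rcases A.eq_empty_or_nonempty with rfl | ⟨t₀, ht₀⟩
  · simp
  have hK : 0 ≤ K := (abs_nonneg _).trans (hζ t₀ ht₀)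
  have hcell : ∀ I ∈ S, ∑ t ∈ A with cl t = I, P t * ζ t ≤ |∑ t ∈ A with cl t = I, ζ t| +
      η * K * ((A.filter fun t => cl t = I).card : ℝ) +
      if I ∈ bad then K * ((A.filter fun t => cl t = I).card : ℝ) else 0 := by
    intro I _
    set AI := A.filter fun t => cl t = I with hAI
    have hmem : ∀ t ∈ AI, t ∈ A ∧ cl t = I := fun t ht => Finset.mem_filter.mp ht
    have hn0 : 0 ≤ η * K * (AI.card : ℝ) := by positivity
    by_cases hb : I ∈ bad
    · rw [if_pos hb]
      have : ∑ t ∈ AI, P t * ζ t ≤ AI.card • K := Finset.sum_le_card_nsmul _ _ _ fun t ht => by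
        refine (le_abs_self _).trans ?_
        rw [abs_mul]
        have h1 := hP t (hmem t ht).1
        have h2 := hζ t (hmem t ht).1
        nlinarith [abs_nonneg (P t), abs_nonneg (ζ t)]
      rw [nsmul_eq_mul] at this
      have h0 := abs_nonneg (∑ t ∈ AI, ζ t)
      linarith
    · rw [if_neg hb, add_zero]
      rcases AI.eq_empty_or_nonempty with hE | ⟨t₁, ht₁⟩
      · simp [hE]
      -- On a good cell the weight is frozen at one observation of the cell, at a cost of `η` per
      -- observation.
      have h1 : ∑ t ∈ AI, P t * ζ t = P t₁ * ∑ t ∈ AI, ζ t + ∑ t ∈ AI, (P t - P t₁) * ζ t := by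
        rw [Finset.mul_sum, ← Finset.sum_add_distrib]
        exact Finset.sum_congr rfl fun t _ => by ring
      have h2 : ∑ t ∈ AI, (P t - P t₁) * ζ t ≤ AI.card • (η * K) :=
        Finset.sum_le_card_nsmul _ _ _ fun t ht => by
          refine (le_abs_self _).trans ?_
          rw [abs_mul]
          refine mul_le_mul (hosc t (hmem t ht).1 t₁ (hmem t₁ ht₁).1 ?_ ?_) (hζ t (hmem t ht).1)
            (abs_nonneg _) hη
          · rw [(hmem t ht).2, (hmem t₁ ht₁).2]
          · rw [(hmem t ht).2]; exact hb
      have h3 : P t₁ * ∑ t ∈ AI, ζ t ≤ |∑ t ∈ AI, ζ t| := by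
        refine (le_abs_self _).trans ?_
        rw [abs_mul]
        exact mul_le_of_le_one_left (abs_nonneg _) (hP t₁ (hmem t₁ ht₁).1)
      rw [nsmul_eq_mul] at h2
      rw [h1]
      linarith
  calc ∑ t ∈ A, P t * ζ t = ∑ I ∈ S, ∑ t ∈ A with cl t = I, P t * ζ t :=
        (Finset.sum_fiberwise_of_maps_to hcl _).symm
    _ ≤ _ := Finset.sum_le_sum hcell
    _ = _ := by
      rw [Finset.sum_add_distrib, Finset.sum_add_distrib, ← Finset.mul_sum, ← Nat.cast_sum,
        ← Finset.card_eq_sum_card_fiberwise hcl, Finset.sum_ite_mem,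
        Finset.inter_eq_right.mpr hbad, Finset.mul_sum]

end Partition

/-! ### Off-wall values of the network and approximating candidates. -/

section Network

variable {d q : ℕ} {a : ℝ}

/-- Away from the walls the network is given by a single local network. -/
lemma net_eq_lin (ha : 0 < a) {M m : ℕ} (hM : 0 < M) (hm : 0 < m) (σ : ℝ → ℝ) (u : ℝ)
    (W : Matrix (Fin (d + 1)) (Fin (dimPoly d q)) ℝ) (Θ : Param d q M) {x : Pt d}
    (hw : x ∉ walls d a M) {I} (hx : x ∈ cell d a M m I) :
    net a σ u W Θ x = localNet σ u W (a / M) (center a I.1) (Θ I.1) x := by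
  have hc := cell_subset_cube ha hM hm I hx
  rw [net, Finset.sum_eq_single I.1]
  · rw [if_pos hc]
  · intro i _ hi
    rw [if_neg fun h => hi (eq_of_mem_cube ha hM hw h hc)]
  · simp

/-- There are candidates which approximate the regression function uniformly. -/
lemma exists_candidate_close {σ : ℝ → ℝ} {u : ℝ} (ha : 0 < a) (hq : 1 ≤ q)
    (hσ : IsActivation q σ u) {W : Matrix (Fin (d + 1)) (Fin (dimPoly d q)) ℝ} (hW : IsDesign W)
    {g : Pt d → ℝ} (hg : ContinuousOn g (box d a)) {B : ℝ≥0∞} (hB : ∀ x ∈ box d a, ‖g x‖ₑ ≤ B)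
    {δ : ℝ} (hδ : 0 < δ) :
    ∃ M₀ : ℕ, ∀ M ≥ M₀, 0 < M → ∃ Θ ∈ candidates M a σ u W B, ∀ i,
      ∀ x ∈ cube (center a i) (a / M),
        |localNet σ u W (a / M) (center a i) (Θ i) x - g x| ≤ δ := by
  obtain ⟨L, hL⟩ := (isCompact_box d a).exists_bound_of_continuousOn hg
  have hL0 : 0 ≤ |L| := abs_nonneg L
  obtain ⟨c, hc⟩ := hW.exists_lin_eq_one
  obtain ⟨ρ, hρ, huc⟩ := Metric.uniformContinuousOn_iff.mp
    ((isCompact_box d a).uniformContinuousOn_of_continuous hg) (δ / 2) (by positivity)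
  set e : ℝ := δ / (4 * (|L| + 1)) with he
  have he0 : 0 < e := by positivity
  obtain ⟨h₀, hh₀, hclose⟩ := netBasis_close hq hσ W
    (show 0 < e / (‖c‖ * (dimPoly d q) + 1) by positivity)
  obtain ⟨M₀, hM₀⟩ := exists_nat_gt (max (a / h₀) (a * Real.sqrt d / ρ))
  refine ⟨M₀, fun M hM hMpos => ?_⟩
  have hM' : (0 : ℝ) < M := by exact_mod_cast hMpos
  have hMM : max (a / h₀) (a * Real.sqrt d / ρ) < M := hM₀.trans_le (by exact_mod_cast hM)
  have hh : 0 < a / M := by positivity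
  have hhh : a / M < h₀ := by
    have := (le_max_left _ _).trans_lt hMM
    rw [div_lt_iff₀ hh₀] at this
    rw [div_lt_iff₀ hM']; linarith
  have hhρ : a / M * Real.sqrt d < ρ := by
    have := (le_max_right _ _).trans_lt hMM
    rw [div_lt_iff₀ hρ] at this
    rw [div_mul_eq_mul_div, div_lt_iff₀ hM']; linarith
  have hone : ∀ z ∈ unitBox d, |lin (netBasis σ u W (a / M)) c z - 1| ≤ e := by
    intro z hz
    rw [← hc z]
    refine (abs_sum_mul_sub_le (fun j => hclose _ hh hhh j z hz) c).trans ?_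
    rw [Fintype.card_fin, ← mul_assoc, mul_div_assoc', div_le_iff₀ (by positivity)]
    nlinarith
  -- The local networks reproduce `1` only up to `e`. Shrinking by `1 / (1 + e)` keeps them below
  -- `|g|` at the centre of the cube, hence below `B`, so the approximation is itself a candidate.
  set lam : ℝ := 1 / (1 + e) with hlam
  have hq0 : (a / M) ^ q ≠ 0 := pow_ne_zero _ hh.ne'
  set Θ : Param d q M := fun i => ((a / M) ^ q)⁻¹ • ((lam * g (center a i)) • c) with hΘ
  have hval : ∀ i, ∀ x ∈ cube (center a i) (a / M), ∃ v : ℝ, |v - 1| ≤ e ∧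
      localNet σ u W (a / M) (center a i) (Θ i) x = lam * g (center a i) * v := by
    intro i x hx
    refine ⟨_, hone _ ((mem_cube_iff_scaled ha hMpos).mp hx), ?_⟩
    rw [localNet_eq_lin σ u W hh.ne', hΘ]
    simp only
    rw [smul_smul, mul_inv_cancel₀ hq0, one_smul, lin_smul]
  have hlam0 : 0 < lam := by positivity
  refine ⟨Θ, fun i x hx => ?_, fun i x hx => ?_⟩
  · obtain ⟨v, hv, hval⟩ := hval i x hx
    refine le_trans ?_ (hB _ (center_mem_box ha hMpos i))
    rw [hval, ← ofReal_norm, ← ofReal_norm, Real.norm_eq_abs, Real.norm_eq_abs]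
    refine ENNReal.ofReal_le_ofReal ?_
    rw [abs_mul, abs_mul, abs_of_pos hlam0]
    have h1 : |v| ≤ 1 + e := by
      rw [abs_le] at hv ⊢; constructor <;> linarith
    calc lam * |g (center a i)| * |v| ≤ lam * |g (center a i)| * (1 + e) := by gcongr
      _ = |g (center a i)| := by rw [hlam]; field_simp
  · obtain ⟨v, hv, hval⟩ := hval i x hx
    rw [hval]
    have hcb := center_mem_box ha hMpos i
    have hgc : |g (center a i)| ≤ |L| := (hL _ hcb).trans (le_abs_self L)
    have hdist : dist (center a i : Pt d) x < ρ := by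
      refine lt_of_le_of_lt ?_ hhρ
      rw [EuclideanSpace.dist_eq]
      calc _ ≤ Real.sqrt (∑ _j : Fin d, (a / M) ^ 2) := by
            refine Real.sqrt_le_sqrt (Finset.sum_le_sum fun j _ => ?_)
            rw [Real.dist_eq, abs_sub_comm]
            exact pow_le_pow_left₀ (abs_nonneg _) (hx j) 2
        _ = a / M * Real.sqrt d := by
            rw [Finset.sum_const, Finset.card_univ, Fintype.card_fin, nsmul_eq_mul,
              Real.sqrt_mul (by positivity), Real.sqrt_sq hh.le, mul_comm]
    have h2 := huc _ hcb x (cube_subset_box ha hMpos i hx) hdist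
    rw [Real.dist_eq] at h2
    have h3 : |lam * v - 1| ≤ 2 * e := by
      have e1 : lam * v - 1 = ((v - 1) - e) / (1 + e) := by rw [hlam]; field_simp; ring
      rw [e1, abs_div, abs_of_pos (show 0 < 1 + e by positivity), div_le_iff₀ (by positivity)]
      have h4 : |v - 1 - e| ≤ 2 * e := by
        refine (abs_sub _ _).trans ?_
        rw [abs_of_pos he0]; linarith
      nlinarith
    have e2 : lam * g (center a i) * v - g x =
        g (center a i) * (lam * v - 1) + (g (center a i) - g x) := by ring
    rw [e2]
    refine (abs_add_le _ _).trans ?_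
    rw [abs_mul]
    have h5 : |g (center a i)| * |lam * v - 1| ≤ δ / 2 := by
      calc _ ≤ (|L| + 1) * (2 * e) := mul_le_mul (by linarith) h3 (abs_nonneg _) (by positivity)
        _ = δ / 2 := by rw [he]; field_simp; ring
    linarith

end Network

/-! ### Deviations of cell sums tend to zero relative to `T`. -/

section CellDeviations

variable {Ω : Type*} [MeasurableSpace Ω] {μ : Measure Ω}
  {d : ℕ} {a : ℝ} {X : ℤ → Ω → Pt d} {ε : ℤ → Ω → ℝ} {f : Pt d → ℝ} {φ : ℝ → ℝ}

/-- The function `ψ` of regressor and error, cut off outside of the cell `I`. -/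
def onCell (a : ℝ) (M m : ℕ) (ψ : Pt d × ℝ → ℝ) (I : (Fin d → Fin M) × (Fin d → Fin m)) :
    Pt d × ℝ → ℝ :=
  Set.indicator (Prod.fst ⁻¹' cell d a M m I) ψ

/-- The total absolute deviation over the cells of the sums of `ψ` from their means. -/
def cellDev (μ : Measure Ω) (a : ℝ) (X : ℤ → Ω → Pt d) (ε : ℤ → Ω → ℝ) (M m : ℕ)
    (ψ : Pt d × ℝ → ℝ) (T : ℕ) (ω : Ω) : ℝ :=
  ∑ I, |∑ t ∈ Finset.Icc 1 T, (onCell a M m ψ I (X t ω, ε t ω) -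
    ∫ ω, onCell a M m ψ I (X 0 ω, ε 0 ω) ∂μ)|

lemma measurable_onCell {M m : ℕ} {ψ : Pt d × ℝ → ℝ} (hψ : Measurable ψ) (I) :
    Measurable (onCell a M m ψ I) :=
  hψ.indicator (measurable_fst (measurableSet_cell I))

/-- The cells are disjoint, so at most one term is nonzero; this is the overlap bound, free of the
number of cells, required by the deviation inequality. -/
lemma sum_abs_onCell_le {M m : ℕ} {ψ : Pt d × ℝ → ℝ} {K : ℝ} (hK : ∀ z, |ψ z| ≤ K)
    (z : Pt d × ℝ) : ∑ I, |onCell a M m ψ I z| ≤ K := by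
  by_cases h : ∃ I, z.1 ∈ cell d a M m I
  · obtain ⟨I, hI⟩ := h
    rw [Finset.sum_eq_single I]
    · simpa [onCell, Set.indicator, hI] using hK z
    · intro I' _ hne
      have : z.1 ∉ cell d a M m I' := fun h => hne (eq_of_mem_cell h hI)
      simp [onCell, this]
    · simp
  · have h' : ∀ I, z.1 ∉ cell d a M m I := fun I hI => h ⟨I, hI⟩
    simpa [onCell, h'] using (abs_nonneg _).trans (hK z)

/-- The number of cells per observation is `(M m) ^ d / T = (a m) ^ d / (T h ^ d)`, which tends to
zero for fixed `m`. -/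
lemma IsDataProcess.tendsto_cellDev [IsProbabilityMeasure μ] (h : IsDataProcess μ a X ε f φ)
    (ha : 0 < a) {M : ℕ → ℕ} (hM : Tendsto M atTop atTop)
    (hTh : Tendsto (fun T : ℕ => (T : ℝ) * (a / M T) ^ d) atTop atTop) (m : ℕ)
    {ψ : Pt d × ℝ → ℝ} (hψ : Measurable ψ) {K : ℝ} (hK : ∀ z, |ψ z| ≤ K) {ρ : ℝ} (hρ : 0 < ρ) :
    Tendsto (fun T : ℕ => μ {ω | ρ * T ≤ cellDev μ a X ε (M T) m ψ T ω}) atTop (𝓝 0) := by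
  obtain ⟨ν, hν, hs⟩ := h.mixing
  have hα := summable_alphaMixing hν hs
  set A := 8 * K * K * (∑' k : ℕ, alphaMixing μ (fun t ω => (X t ω, ε t ω)) k) / ρ ^ 2 with hA
  have hcard : Tendsto (fun T : ℕ =>
      (Fintype.card ((Fin d → Fin (M T)) × (Fin d → Fin m)) : ℝ) / T * A) atTop (𝓝 0) := by
    rw [← zero_mul A]
    refine Tendsto.mul_const A ?_
    refine (hTh.const_div_atTop ((a * m) ^ d)).congr' ?_
    filter_upwards [hM.eventually_gt_atTop 0, eventually_gt_atTop 0] with T hMT hT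
    have h1 : (0 : ℝ) < M T := by exact_mod_cast hMT
    have h2 : (0 : ℝ) < T := by exact_mod_cast hT
    simp only [Fintype.card_prod, Fintype.card_fun, Fintype.card_fin, Nat.cast_mul, Nat.cast_pow]
    rw [div_pow, mul_pow]
    field_simp
  have hlim := ENNReal.tendsto_ofReal hcard
  rw [ENNReal.ofReal_zero] at hlim
  refine tendsto_of_tendsto_of_tendsto_of_le_of_le' tendsto_const_nhds hlim (Eventually.of_forall fun T => zero_le) ?_
  filter_upwards [eventually_gt_atTop 0] with T hT
  rw [← ofReal_measureReal]
  exact ENNReal.ofReal_le_ofReal (measureReal_sum_abs_ge_le h.stationary h.measurable_pair hα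
    (fun I => measurable_onCell hψ I) (sum_abs_onCell_le hK) hT hρ)

lemma IsDataProcess.measure_exists_walls_eq_zero (h : IsDataProcess μ a X ε f φ) (N : ℕ) :
    μ {ω | ∃ t : ℕ, X t ω ∈ walls d a N} = 0 := by
  have e : {ω | ∃ t : ℕ, X t ω ∈ walls d a N} = ⋃ t : ℕ, {ω | X t ω ∈ walls d a N} := by
    ext; simp
  rw [e]
  exact measure_iUnion_null fun t => h.measure_X_eq_zero (volume_walls a N) t

end CellDeviations

/-! ### Observations in the box. -/

section SampleTimes

variable {Ω : Type*} {d : ℕ} {a : ℝ} {X : ℤ → Ω → Pt d}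

lemma mem_box_of_mem_sampleTimes {T : ℕ} {ω : Ω} {t : ℕ} (ht : t ∈ sampleTimes a X T ω) :
    X t ω ∈ box d a := by
  classical
  exact (Finset.mem_filter.mp ht).2

lemma card_sampleTimes_le (T : ℕ) (ω : Ω) : ((sampleTimes a X T ω).card : ℝ) ≤ T := by
  classical
  have := Finset.card_filter_le (Finset.Icc 1 T) fun t : ℕ => X t ω ∈ box d a
  rw [Nat.card_Icc, Nat.add_sub_cancel] at this
  exact_mod_cast this

end SampleTimes

/-! ### The score on cells and the deterministic loss bound. -/

section Core

variable {Ω : Type*} [MeasurableSpace Ω] {μ : Measure Ω}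
  {d : ℕ} {a : ℝ} {X : ℤ → Ω → Pt d} {ε : ℤ → Ω → ℝ} {f : Pt d → ℝ} {φ : ℝ → ℝ}

/-- The regression function, set to zero outside of its domain. -/
def onBox (a : ℝ) (g : Pt d → ℝ) : Pt d → ℝ := (box d a).indicator g

lemma measurable_onBox {g : Pt d → ℝ} (hg : ContinuousOn g (box d a)) :
    Measurable (onBox a g) := by
  classical
  rw [onBox, ← Set.piecewise_eq_indicator]
  exact ContinuousOn.measurable_piecewise hg (continuousOn_const (c := (0 : ℝ)))
    (isClosed_box d a).measurableSet

/-- The score weight `1 / (Φ(g) (1 - Φ(g)))` on the domain of `g`. -/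
def weight (μ : Measure Ω) (a : ℝ) (ε : ℤ → Ω → ℝ) (g : Pt d → ℝ) : Pt d → ℝ :=
  (box d a).indicator fun x =>
    (errorCDF μ ε (onBox a g x) * (1 - errorCDF μ ε (onBox a g x)))⁻¹

/-- The score of the Bernoulli model. -/
def score (μ : Measure Ω) (a : ℝ) (ε : ℤ → Ω → ℝ) (g : Pt d → ℝ) (z : Pt d × ℝ) : ℝ :=
  weight μ a ε g z.1 * centredOutcome μ ε (onBox a g) z

lemma measurable_weight {g : Pt d → ℝ} (hg : ContinuousOn g (box d a)) :
    Measurable (weight μ a ε g) := by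
  have h : Measurable fun x => errorCDF μ ε (onBox a g x) :=
    measurable_errorCDF.comp (measurable_onBox hg)
  exact (h.mul (h.const_sub 1)).inv.indicator (isClosed_box d a).measurableSet

lemma abs_weight_le {g : Pt d → ℝ} {κ : ℝ} (hκ : 0 < κ)
    (hG : ∀ x ∈ box d a, κ ≤ (1 - errorCDF μ ε (g x)) * errorCDF μ ε (g x)) (x : Pt d) :
    |weight μ a ε g x| ≤ 1 / κ := by
  by_cases hx : x ∈ box d a
  · have h := hG x hx
    have e : weight μ a ε g x = (errorCDF μ ε (g x) * (1 - errorCDF μ ε (g x)))⁻¹ := by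
      simp [weight, onBox, hx]
    rw [e, mul_comm, abs_of_nonneg (inv_nonneg.mpr (hκ.le.trans h)), one_div]
    exact inv_anti₀ hκ h
  · simp only [weight, Set.indicator_of_notMem hx, abs_zero]
    positivity

lemma measurable_score {g : Pt d → ℝ} (hg : ContinuousOn g (box d a)) :
    Measurable (score μ a ε g) :=
  ((measurable_weight hg).comp measurable_fst).mul
    (measurable_centredOutcome (measurable_onBox hg))

lemma abs_score_le {g : Pt d → ℝ} {κ : ℝ} (hκ : 0 < κ)
    (hG : ∀ x ∈ box d a, κ ≤ (1 - errorCDF μ ε (g x)) * errorCDF μ ε (g x)) (z : Pt d × ℝ) :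
    |score μ a ε g z| ≤ 1 / κ := by
  rw [score, abs_mul]
  have h1 := abs_weight_le hκ hG z.1
  have h2 := abs_centredOutcome_le (μ := μ) (ε := ε) (onBox a g) z
  calc _ ≤ 1 / κ * 1 := mul_le_mul h1 h2 (abs_nonneg _) (by positivity)
    _ = _ := mul_one _

/-- The score times the success probability. -/
def scoreMean (μ : Measure Ω) (a : ℝ) (ε : ℤ → Ω → ℝ) (g : Pt d → ℝ) (z : Pt d × ℝ) : ℝ :=
  errorCDF μ ε (onBox a g z.1) * score μ a ε g z

lemma measurable_scoreMean {g : Pt d → ℝ} (hg : ContinuousOn g (box d a)) :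
    Measurable (scoreMean μ a ε g) :=
  ((measurable_errorCDF.comp (measurable_onBox hg)).comp measurable_fst).mul (measurable_score hg)

lemma abs_scoreMean_le {g : Pt d → ℝ} {κ : ℝ} (hκ : 0 < κ)
    (hG : ∀ x ∈ box d a, κ ≤ (1 - errorCDF μ ε (g x)) * errorCDF μ ε (g x)) (z : Pt d × ℝ) :
    |scoreMean μ a ε g z| ≤ 1 / κ := by
  rw [scoreMean, abs_mul, abs_of_nonneg (errorCDF_nonneg _)]
  exact (mul_le_of_le_one_left (abs_nonneg _) (errorCDF_le_one _)).trans (abs_score_le hκ hG z)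

lemma IsDataProcess.integral_onCell_one_le (h : IsDataProcess μ a X ε f φ) (ha : 0 < a) {c₂ : ℝ}
    (hc : ∀ x ∈ box d a, f x ≤ c₂) (hc0 : 0 ≤ c₂) {M m : ℕ} (hM : 0 < M) (hm : 0 < m) (I) :
    ∫ ω, onCell a M m (fun _ => 1) I (X 0 ω, ε 0 ω) ∂μ ≤ c₂ * (2 * a / (M * m)) ^ d := by
  have hms : MeasurableSet {ω | X 0 ω ∈ cell d a M m I} := h.measurable_X 0 (measurableSet_cell I)
  have e : ∀ ω, onCell a M m (fun _ => 1) I (X 0 ω, ε 0 ω) =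
      {ω | X 0 ω ∈ cell d a M m I}.indicator 1 ω := fun ω => by
    by_cases hz : X 0 ω ∈ cell d a M m I <;> simp [onCell, hz]
  simp_rw [e]
  rw [integral_indicator_one hms]
  exact h.measureReal_X_le hc hc0 (measurableSet_cell I)
    ((cell_subset_cube ha hM hm I).trans (cube_subset_box ha hM _)) (by positivity)
    (volume_cell_le ha hM hm I) 0

variable [IsProbabilityMeasure μ]

/-- Cut off to a cell, the score is a bounded function of the regressor times the centred outcome,
so its mean is zero. -/
lemma IsDataProcess.integral_onCell_score (h : IsDataProcess μ a X ε f φ) {g : Pt d → ℝ}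
    (hg : ContinuousOn g (box d a)) {κ : ℝ} (hκ : 0 < κ)
    (hG : ∀ x ∈ box d a, κ ≤ (1 - errorCDF μ ε (g x)) * errorCDF μ ε (g x)) {M m : ℕ} (I) :
    ∫ ω, onCell a M m (score μ a ε g) I (X 0 ω, ε 0 ω) ∂μ = 0 := by
  have e : ∀ z, onCell a M m (score μ a ε g) I z =
      (cell d a M m I).indicator (weight μ a ε g) z.1 * centredOutcome μ ε (onBox a g) z := by
    intro z
    by_cases hz : z.1 ∈ cell d a M m I <;> simp [onCell, score, hz]
  simp_rw [e]
  refine h.integral_mul_centredOutcome (measurable_onBox hg)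
    ((measurable_weight hg).indicator (measurableSet_cell I)) (K := 1 / κ) fun x => ?_
  by_cases hx : x ∈ cell d a M m I
  · simpa [hx] using abs_weight_le hκ hG x
  · simp [hx]; positivity

lemma IsDataProcess.integral_onCell_scoreMean (h : IsDataProcess μ a X ε f φ) {g : Pt d → ℝ}
    (hg : ContinuousOn g (box d a)) {κ : ℝ} (hκ : 0 < κ)
    (hG : ∀ x ∈ box d a, κ ≤ (1 - errorCDF μ ε (g x)) * errorCDF μ ε (g x)) {M m : ℕ} (I) :
    ∫ ω, onCell a M m (scoreMean μ a ε g) I (X 0 ω, ε 0 ω) ∂μ = 0 := by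
  set ψ : Pt d → ℝ := fun x => errorCDF μ ε (onBox a g x) * weight μ a ε g x with hψ
  have hψm : Measurable ψ :=
    (measurable_errorCDF.comp (measurable_onBox hg)).mul (measurable_weight hg)
  have hψb : ∀ x, |ψ x| ≤ 1 / κ := fun x => by
    rw [hψ]
    simp only [abs_mul]
    rw [abs_of_nonneg (errorCDF_nonneg _)]
    exact (mul_le_of_le_one_left (abs_nonneg _) (errorCDF_le_one _)).trans
      (abs_weight_le hκ hG x)
  have e : ∀ z, onCell a M m (scoreMean μ a ε g) I z =
      (cell d a M m I).indicator ψ z.1 * centredOutcome μ ε (onBox a g) z := by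
    intro z
    by_cases hz : z.1 ∈ cell d a M m I <;> simp [onCell, scoreMean, score, hψ, hz, mul_assoc]
  simp_rw [e]
  refine h.integral_mul_centredOutcome (measurable_onBox hg)
    (hψm.indicator (measurableSet_cell I)) (K := 1 / κ) fun x => ?_
  by_cases hx : x ∈ cell d a M m I
  · simpa [hx] using hψb x
  · simp [hx]; positivity

/-- The deterministic part of the argument: a bound for the loss of a maximum likelihood estimate
at a sample point with no regressor on the walls. -/
lemma sum_sq_le_of_isMLE {q : ℕ} (ha : 0 < a) {g : Pt d → ℝ} {σ : ℝ → ℝ} {u : ℝ}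
    {W : Matrix (Fin (d + 1)) (Fin (dimPoly d q)) ℝ} (hdata : IsDataProcess μ a X ε f φ)
    (hg : ContinuousOn g (box d a)) {κ : ℝ} (hκ : 0 < κ)
    (hG : ∀ x ∈ box d a, κ ≤ (1 - errorCDF μ ε (g x)) * errorCDF μ ε (g x)) {c₂ : ℝ}
    (hc : ∀ x ∈ box d a, f x ≤ c₂) (hc0 : 0 ≤ c₂) {B : ℝ≥0∞} {M m : ℕ} (hM : 0 < M) (hm : 0 < m)
    {η δ : ℝ} (hη : 0 ≤ η) (hδ0 : 0 ≤ δ) (hδ : δ ≤ κ / 2)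
    (hosc : ∀ θ : Fin (dimPoly d q) → ℝ, ∃ S : Finset (Fin d → Fin m), (S.card : ℝ) ≤ η * m ^ d ∧
      ∀ r ∉ S, ∀ z ∈ subBox m r, ∀ z' ∈ subBox m r,
        |errorCDF μ ε (lin (netBasis σ u W (a / M)) θ z) -
          errorCDF μ ε (lin (netBasis σ u W (a / M)) θ z')| ≤ η)
    {Θs : Param d q M} (hΘs : Θs ∈ candidates M a σ u W B)
    (hclose : ∀ i, ∀ x ∈ cube (center a i) (a / M),
      |errorCDF μ ε (localNet σ u W (a / M) (center a i) (Θs i) x) - errorCDF μ ε (g x)| ≤ δ)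
    {T : ℕ} {ω : Ω} {Θ : Param d q M} (hΘ : IsMLE μ a g X ε σ u W B T ω Θ)
    (hw : ∀ t : ℕ, X t ω ∉ walls d a M) :
    κ / 4 * ∑ t ∈ sampleTimes a X T ω,
        (errorCDF μ ε (g (X t ω)) - errorCDF μ ε (net a σ u W Θ (X t ω))) ^ 2 ≤
      cellDev μ a X ε M m (score μ a ε g) T ω + cellDev μ a X ε M m (scoreMean μ a ε g) T ω +
        1 / κ * cellDev μ a X ε M m (fun _ => 1) T ω +
        T * (η * (1 / κ) * (1 + c₂ * (2 * a) ^ d) + 2 * δ / κ) := by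
  classical
  have hM' : (0 : ℝ) < M := by exact_mod_cast hM
  have hm' : (0 : ℝ) < m := by exact_mod_cast hm
  have hh : a / (M : ℝ) ≠ 0 := by positivity
  set A := sampleTimes a X T ω with hA
  have hAmem : ∀ t ∈ A, X t ω ∈ box d a := fun t ht => mem_box_of_mem_sampleTimes ht
  have hAcard : (A.card : ℝ) ≤ T := card_sampleTimes_le T ω
  have hMne : Nonempty (Fin M) := ⟨⟨0, hM⟩⟩
  have hmne : Nonempty (Fin m) := ⟨⟨0, hm⟩⟩
  -- Times outside the sample receive an arbitrary cell, so that `cl` is total; only its values on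
  -- `A` matter.
  have hex : ∀ t : ℕ, ∃ I, t ∈ A → X t ω ∈ cell d a M m I := fun t => by
    by_cases ht : t ∈ A
    · obtain ⟨I, hI⟩ := exists_mem_cell ha hM hm (hAmem t ht) (hw t)
      exact ⟨I, fun _ => hI⟩
    · exact ⟨Classical.arbitrary _, fun h => absurd h ht⟩
  choose cl hcl using hex
  have hfilter : ∀ I, A.filter (fun t => cl t = I) =
      (Finset.Icc 1 T).filter fun t : ℕ => X t ω ∈ cell d a M m I := by
    intro I
    ext t
    rw [Finset.mem_filter, Finset.mem_filter]
    constructor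
    · rintro ⟨ht, rfl⟩
      exact ⟨(Finset.mem_filter.mp ht).1, hcl t ht⟩
    · rintro ⟨ht, hI⟩
      have htA : t ∈ A := Finset.mem_filter.mpr
        ⟨ht, cube_subset_box ha hM _ (cell_subset_cube ha hM hm I hI)⟩
      exact ⟨htA, eq_of_mem_cell (hcl t htA) hI⟩
  have hsumcell : ∀ (ψ : Pt d × ℝ → ℝ) (I),
      ∑ t ∈ A with cl t = I, ψ (X t ω, ε t ω) =
        ∑ t ∈ Finset.Icc 1 T, onCell a M m ψ I (X t ω, ε t ω) := by
    intro ψ I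
    rw [hfilter, Finset.sum_filter]
    refine Finset.sum_congr rfl fun t _ => ?_
    by_cases hz : X t ω ∈ cell d a M m I <;> simp [onCell, hz]
  set Φ := errorCDF μ ε with hΦ
  set P : ℕ → ℝ := fun t => Φ (net a σ u W Θ (X t ω)) with hP
  set Q : ℕ → ℝ := fun t => Φ (net a σ u W Θs (X t ω)) with hQ
  set G : ℕ → ℝ := fun t => Φ (g (X t ω)) with hGdef
  have hbasic := sum_sq_le_of_likelihood_le A (P := P) (Q := Q) (G := G)
    (y := fun t => outcome g X ε t ω) (κ := κ) (δ := δ)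
    (fun t _ => by unfold outcome; split_ifs <;> simp) hκ (fun t _ => errorCDF_nonneg _)
    (fun t _ => errorCDF_le_one _) (fun t ht => hG _ (hAmem t ht)) (fun t _ => errorCDF_nonneg _)
    (fun t _ => errorCDF_le_one _) hδ
    (fun t ht => by
      have hc' := hcl t ht
      simp only [hQ, hGdef]
      rw [net_eq_lin ha hM hm σ u W Θs (hw t) hc']
      exact hclose _ _ (cell_subset_cube ha hM hm _ hc'))
    (hΘ.2 Θs hΘs)
  set ζ : ℕ → ℝ := fun t => score μ a ε g (X t ω, ε t ω) with hζ
  have hscore : ∀ t ∈ A, ((outcome g X ε t ω : ℝ) - G t) / (G t * (1 - G t)) = ζ t := by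
    intro t ht
    have hb := hAmem t ht
    simp only [hζ, score, weight, onBox, centredOutcome, Set.indicator_of_mem hb, outcome, hGdef,
      sub_nonneg]
    rw [div_eq_inv_mul]
    push_cast
    rfl
  -- The part with `G` does not depend on the parameter and has mean zero, so it needs no
  -- oscillation bound; only `P` goes through the partition.
  have hsplit : ∑ t ∈ A, (P t - G t) * (((outcome g X ε t ω : ℝ) - G t) / (G t * (1 - G t))) =
      ∑ t ∈ A, P t * ζ t - ∑ t ∈ A, scoreMean μ a ε g (X t ω, ε t ω) := by
    rw [← Finset.sum_sub_distrib]
    refine Finset.sum_congr rfl fun t ht => ?_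
    rw [hscore t ht]
    simp only [scoreMean, onBox, Set.indicator_of_mem (hAmem t ht), hζ, hGdef]
    ring
  have hmean : -∑ t ∈ A, scoreMean μ a ε g (X t ω, ε t ω) ≤
      cellDev μ a X ε M m (scoreMean μ a ε g) T ω := by
    rw [← Finset.sum_fiberwise_of_maps_to (s := A) (t := Finset.univ) (g := cl)
      (fun _ _ => Finset.mem_univ _), ← Finset.sum_neg_distrib]
    refine Finset.sum_le_sum fun I _ => ?_
    rw [hsumcell, hdata.integral_onCell_scoreMean hg hκ hG]
    simp only [sub_zero]
    exact neg_le_abs _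
  have hex2 : ∀ i : Fin d → Fin M, ∃ S : Finset (Fin d → Fin m), (S.card : ℝ) ≤ η * m ^ d ∧
      ∀ r ∉ S, ∀ z ∈ subBox m r, ∀ z' ∈ subBox m r,
        |Φ (lin (netBasis σ u W (a / M)) ((a / (M : ℝ)) ^ q • Θ i) z) -
          Φ (lin (netBasis σ u W (a / M)) ((a / (M : ℝ)) ^ q • Θ i) z')| ≤ η :=
    fun i => hosc _
  choose S hScard hSosc using hex2
  -- Each cube has its own set of bad subcells, depending on its own coefficients; only the bound on
  -- their number is common.
  set bad : Finset ((Fin d → Fin M) × (Fin d → Fin m)) :=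
    (Finset.univ : Finset (Fin d → Fin M)).sigma S |>.map
      (Equiv.sigmaEquivProd _ _).toEmbedding with hbad
  have hbadmem : ∀ I, I ∈ bad ↔ I.2 ∈ S I.1 := by
    rintro ⟨i, r⟩
    simp [hbad, Equiv.sigmaEquivProd]
  have hbadcard : (bad.card : ℝ) ≤ M ^ d * (η * m ^ d) := by
    rw [hbad, Finset.card_map, Finset.card_sigma, Nat.cast_sum]
    refine (Finset.sum_le_card_nsmul _ _ _ fun i _ => hScard i).trans (le_of_eq ?_)
    simp
  have hgrid := sum_mul_le_sum_abs_add A Finset.univ cl (fun _ _ => Finset.mem_univ _) bad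
    (Finset.subset_univ _) (P := P) (ζ := ζ) (K := 1 / κ) (η := η) hη
    (fun t _ => by
      rw [abs_of_nonneg (errorCDF_nonneg _)]; exact errorCDF_le_one _)
    (fun t _ => abs_score_le hκ hG _)
    (fun t ht t' ht' hcc hnb => by
      have h1 := hcl t ht
      have h2 := hcl t' ht'
      rw [← hcc] at h2
      have hns : (cl t).2 ∉ S (cl t).1 := fun h => hnb ((hbadmem _).mpr h)
      have := hSosc (cl t).1 (cl t).2 hns _ (scaled_mem_subBox ha hM hm h1) _
        (scaled_mem_subBox ha hM hm h2)
      simp only [hP]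
      rw [net_eq_lin ha hM hm σ u W Θ (hw t) h1, net_eq_lin ha hM hm σ u W Θ (hw t') h2,
        localNet_eq_lin σ u W hh, localNet_eq_lin σ u W hh]
      exact this)
  have hdev1 : ∑ I, |∑ t ∈ A with cl t = I, ζ t| = cellDev μ a X ε M m (score μ a ε g) T ω := by
    refine Finset.sum_congr rfl fun I _ => ?_
    rw [hsumcell, hdata.integral_onCell_score hg hκ hG]
    simp only [sub_zero]
  -- The bad cells vary with the parameter, so their deviations are bounded by those of all cells.
  -- The means contribute at most `η (M m) ^ d` times `c₂ (2a / (M m)) ^ d`, in which `M` and `m`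
  -- cancel.
  have hcount : ∑ I ∈ bad, ((A.filter fun t => cl t = I).card : ℝ) ≤
      cellDev μ a X ε M m (fun _ => 1) T ω + T * (c₂ * η * (2 * a) ^ d) := by
    set p := c₂ * (2 * a / (M * m)) ^ d with hp
    have hp0 : 0 ≤ p := by positivity
    have h1 : ∀ I, ((A.filter fun t => cl t = I).card : ℝ) ≤
        |∑ t ∈ Finset.Icc 1 T, (onCell a M m (fun _ => 1) I (X t ω, ε t ω) -
          ∫ ω, onCell a M m (fun _ => 1) I (X 0 ω, ε 0 ω) ∂μ)| + T * p := by
      intro I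
      have e : ((A.filter fun t => cl t = I).card : ℝ) =
          ∑ t ∈ Finset.Icc 1 T, onCell a M m (fun _ => 1) I (X t ω, ε t ω) := by
        rw [← hsumcell (fun _ => 1) I]; simp
      rw [e, Finset.sum_sub_distrib, Finset.sum_const, Nat.card_Icc, Nat.add_sub_cancel,
        nsmul_eq_mul]
      have h2 := hdata.integral_onCell_one_le ha hc hc0 hM hm I
      have h3 := mul_le_mul_of_nonneg_left h2 (Nat.cast_nonneg (α := ℝ) T)
      have h4 := le_abs_self (∑ t ∈ Finset.Icc 1 T, onCell a M m (fun _ => 1) I (X t ω, ε t ω) -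
        T * ∫ ω, onCell a M m (fun _ => 1) I (X 0 ω, ε 0 ω) ∂μ)
      linarith
    calc _ ≤ ∑ I ∈ bad, (|∑ t ∈ Finset.Icc 1 T, (onCell a M m (fun _ => 1) I (X t ω, ε t ω) -
          ∫ ω, onCell a M m (fun _ => 1) I (X 0 ω, ε 0 ω) ∂μ)| + T * p) :=
          Finset.sum_le_sum fun I _ => h1 I
      _ ≤ cellDev μ a X ε M m (fun _ => 1) T ω + bad.card * (T * p) := by
          rw [Finset.sum_add_distrib, Finset.sum_const, nsmul_eq_mul]
          exact add_le_add (Finset.sum_le_sum_of_subset_of_nonneg (Finset.subset_univ _)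
            fun _ _ _ => abs_nonneg _) le_rfl
      _ ≤ cellDev μ a X ε M m (fun _ => 1) T ω + (M ^ d * (η * m ^ d)) * (T * p) := by
          gcongr
      _ = _ := by
          rw [hp, div_pow, mul_pow (M : ℝ)]; field_simp
  have hsymm : ∑ t ∈ A, (Φ (g (X t ω)) - Φ (net a σ u W Θ (X t ω))) ^ 2 =
      ∑ t ∈ A, (P t - G t) ^ 2 :=
    Finset.sum_congr rfl fun t _ => by simp only [hP, hGdef]; ring
  rw [hsymm]
  rw [hsplit] at hbasic
  rw [hdev1] at hgrid
  have hκ' : 0 < 1 / κ := by positivity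
  have k1 := mul_le_mul_of_nonneg_left hcount hκ'.le
  have k2 : η * (1 / κ) * A.card ≤ η * (1 / κ) * T :=
    mul_le_mul_of_nonneg_left hAcard (by positivity)
  have k3 : A.card * (2 * δ / κ) ≤ T * (2 * δ / κ) :=
    mul_le_mul_of_nonneg_right hAcard (by positivity)
  have e1 : T * (η * (1 / κ) * (1 + c₂ * (2 * a) ^ d) + 2 * δ / κ) =
      η * (1 / κ) * T + 1 / κ * (T * (c₂ * η * (2 * a) ^ d)) + T * (2 * δ / κ) := by ring
  rw [e1]
  linarith

end Core

/-! ### Consistency for probabilities, and separation of values. -/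

section Consistency

variable {Ω : Type*} [MeasurableSpace Ω] {μ : Measure Ω} [IsProbabilityMeasure μ]
  {d q : ℕ} {a : ℝ} {X : ℤ → Ω → Pt d} {ε : ℤ → Ω → ℝ} {f : Pt d → ℝ} {φ : ℝ → ℝ}
  {g : Pt d → ℝ} {σ : ℝ → ℝ} {u : ℝ} {W : Matrix (Fin (d + 1)) (Fin (dimPoly d q)) ℝ}
  {M : ℕ → ℕ} {B : ℝ≥0∞} {Θhat : ∀ T : ℕ, Ω → Param d q (M T)}

/-- Consistency of the maximum likelihood estimate on the scale of probabilities. -/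
lemma tendsto_measure_loss (ha : 0 < a) (hq : 1 ≤ q) (hg : ContinuousOn g (box d a))
    (hσ : IsActivation q σ u) (hW : IsDesign W) (hdata : IsDataProcess μ a X ε f φ)
    {κ : ℝ} (hκ : 0 < κ)
    (hG : ∀ x ∈ box d a, κ ≤ (1 - errorCDF μ ε (g x)) * errorCDF μ ε (g x))
    (hM : Tendsto M atTop atTop)
    (hTh : Tendsto (fun T : ℕ => (T : ℝ) * (a / M T) ^ d) atTop atTop)
    (hB : ∀ x ∈ box d a, ‖g x‖ₑ ≤ B)
    (hΘ : Tendsto (fun T => μ {ω | ¬ IsMLE μ a g X ε σ u W B T ω (Θhat T ω)}) atTop (𝓝 0))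
    {e : ℝ} (he : 0 < e) :
    Tendsto (fun T : ℕ => μ {ω | e ≤ (1 / (T : ℝ)) * ∑ t ∈ sampleTimes a X T ω,
      (errorCDF μ ε (g (X t ω)) - errorCDF μ ε (net a σ u W (Θhat T ω) (X t ω))) ^ 2})
      atTop (𝓝 0) := by
  obtain ⟨c₁, c₂', -, hc⟩ := hdata.bounds_f
  set c₂ := max c₂' 0 with hc₂
  have hc2 : ∀ x ∈ box d a, f x ≤ c₂ := fun x hx => (hc x hx).2.trans (le_max_left _ _)
  have hc0 : 0 ≤ c₂ := le_max_right _ _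
  -- A loss of at least `e` makes the left side of the basic inequality at least `κ e T / 4`.
  -- Through `D`, `η`, `δ` and `ρ` the oscillation, approximation and deviation terms each stay
  -- within `κ e T / 16`, three quarters of that. The fineness `m` depends on `η` only through the
  -- limiting basis and is fixed before `T` grows.
  set D : ℝ := 1 / κ * (1 + c₂ * (2 * a) ^ d) with hD
  have hD0 : 0 < D := by positivity
  set η : ℝ := κ * e / (16 * D) with hη
  have hη0 : 0 < η := by positivity
  set δ : ℝ := min (κ / 2) (κ ^ 2 * e / 32) with hδ
  have hδ0 : 0 < δ := by positivity
  set ρ : ℝ := κ * e / (16 * (2 + 1 / κ)) with hρ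
  have hρ0 : 0 < ρ := by positivity
  have hΦuc := hdata.uniformContinuous_errorCDF
  obtain ⟨m, hm, e₁, he₁, hgrid⟩ := exists_grid_oscillation (continuous_limBasis W)
    (fun θ hθ => hW.volume_lin_eq_zero hθ) hΦuc errorCDF_nonneg errorCDF_le_one
    (tendsto_cdf_atBot _) (tendsto_cdf_atTop _) hη0
  obtain ⟨h₀, hh₀, hnet⟩ := netBasis_close hq hσ W he₁
  obtain ⟨δ', hδ', huc⟩ := Metric.uniformContinuous_iff.mp hΦuc δ hδ0
  obtain ⟨M₀, hcand⟩ := exists_candidate_close ha hq hσ hW hg hB (half_pos hδ')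
  have hM1 : ∀ᶠ T in atTop, a / (M T : ℝ) < h₀ :=
    ((tendsto_natCast_atTop_atTop.comp hM).const_div_atTop a).eventually_lt_const hh₀
  have t1 := hdata.tendsto_cellDev ha hM hTh m (measurable_score (μ := μ) (ε := ε) hg)
    (abs_score_le hκ hG) hρ0
  have t2 := hdata.tendsto_cellDev ha hM hTh m (measurable_scoreMean (μ := μ) (ε := ε) hg)
    (abs_scoreMean_le hκ hG) hρ0
  have t3 := hdata.tendsto_cellDev ha hM hTh m (ψ := fun _ => 1) measurable_const (K := 1)
    (by simp) hρ0
  have hsum := ((hΘ.add t1).add t2).add t3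
  simp only [add_zero] at hsum
  refine tendsto_of_tendsto_of_tendsto_of_le_of_le' tendsto_const_nhds hsum
    (Eventually.of_forall fun T => zero_le) ?_
  filter_upwards [hM1, hM.eventually_ge_atTop M₀, hM.eventually_gt_atTop 0,
    eventually_gt_atTop 0] with T hMT hMT0 hMpos hT
  have hT' : (0 : ℝ) < T := by exact_mod_cast hT
  have hM' : (0 : ℝ) < M T := by exact_mod_cast hMpos
  obtain ⟨Θs, hΘs, hΘclose⟩ := hcand (M T) hMT0 hMpos
  have hsub : {ω | e ≤ (1 / (T : ℝ)) * ∑ t ∈ sampleTimes a X T ω,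
      (errorCDF μ ε (g (X t ω)) - errorCDF μ ε (net a σ u W (Θhat T ω) (X t ω))) ^ 2} ⊆
      ((({ω | ¬ IsMLE μ a g X ε σ u W B T ω (Θhat T ω)} ∪
        {ω | ρ * T ≤ cellDev μ a X ε (M T) m (score μ a ε g) T ω}) ∪
        {ω | ρ * T ≤ cellDev μ a X ε (M T) m (scoreMean μ a ε g) T ω}) ∪
        {ω | ρ * T ≤ cellDev μ a X ε (M T) m (fun _ => 1) T ω}) ∪
        {ω | ∃ t : ℕ, X t ω ∈ walls d a (M T)} := by
    intro ω hω
    by_contra hnot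
    simp only [Set.mem_union, Set.mem_ofPred_eq, not_or, not_not, not_le, not_exists] at hnot hω
    obtain ⟨⟨⟨⟨hmle, h1⟩, h2⟩, h3⟩, hw⟩ := hnot
    have hmain := sum_sq_le_of_isMLE ha hdata hg hκ hG hc2 hc0 hMpos hm hη0.le hδ0.le
      (min_le_left _ _) (hgrid _ (hnet _ (by positivity) hMT)) hΘs
      (fun i x hx => by
        rw [← Real.dist_eq]
        refine (huc ?_).le
        rw [Real.dist_eq]
        exact (hΘclose i x hx).trans_lt (half_lt_self hδ')) hmle hw
    rw [one_div, inv_mul_eq_div, le_div_iff₀ hT'] at hω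
    have k1 := mul_le_mul_of_nonneg_left hω (show 0 ≤ κ / 4 by positivity)
    have k2 := mul_lt_mul_of_pos_left h3 (show 0 < 1 / κ by positivity)
    have k3 : η * (1 / κ) * (1 + c₂ * (2 * a) ^ d) = κ * e / 16 := by
      rw [mul_assoc, ← hD, hη]; field_simp
    have k4 : 2 * δ / κ ≤ κ * e / 16 := by
      rw [div_le_iff₀ hκ]
      have : δ ≤ κ ^ 2 * e / 32 := min_le_right _ _
      linarith [show κ * e / 16 * κ = 2 * (κ ^ 2 * e / 32) by ring]
    have k5 : ρ * (2 + 1 / κ) = κ * e / 16 := by rw [hρ]; field_simp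
    have k6 : T * (η * (1 / κ) * (1 + c₂ * (2 * a) ^ d) + 2 * δ / κ) ≤
        T * (κ * e / 16 + κ * e / 16) := by rw [k3]; gcongr
    have k7 : ρ * T + ρ * T + 1 / κ * (ρ * T) = T * (κ * e / 16) := by rw [← k5]; ring
    have k8 : 0 < T * (κ * e / 16) := by positivity
    linarith
  refine (measure_mono hsub).trans ((measure_union_le _ _).trans ?_)
  rw [hdata.measure_exists_walls_eq_zero, add_zero]
  refine (measure_union_le _ _).trans (add_le_add ?_ le_rfl)
  refine (measure_union_le _ _).trans (add_le_add ?_ le_rfl)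
  exact measure_union_le _ _

/-- On bounded sets, an error in `v` shows in `Φ v`, uniformly. -/
lemma exists_le_abs_sub_of_le_abs_sub {Φ : ℝ → ℝ} (hΦ : Continuous Φ)
    (hg : ContinuousOn g (box d a)) (hinj : ∀ x ∈ box d a, ∀ v, Φ v = Φ (g x) → v = g x)
    (b : ℝ) {η : ℝ} (hη : 0 < η) :
    ∃ δ : ℝ, 0 < δ ∧ ∀ x ∈ box d a, ∀ v, |v| ≤ b → η ≤ |g x - v| → δ ≤ |Φ (g x) - Φ v| := by
  -- The pairs whose second entry misses `g` by at least `η` form a compact set. The continuous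
  -- function `|Φ (g x) - Φ v|` has a minimum there, and injectivity forbids the value zero.
  set K : Set (Pt d × ℝ) := (box d a ×ˢ Set.Icc (-b) b) ∩ {p | η ≤ |g p.1 - p.2|} with hK
  have hgc : ContinuousOn (fun p : Pt d × ℝ => g p.1) (box d a ×ˢ Set.Icc (-b) b) :=
    hg.comp continuousOn_fst fun p hp => hp.1
  have hcomp : IsCompact (box d a ×ˢ Set.Icc (-b) b) := (isCompact_box d a).prod isCompact_Icc
  have hKc : IsCompact K := by
    have hcl := (hgc.sub continuousOn_snd).abs.preimage_isClosed_of_isClosed hcomp.isClosed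
      (isClosed_Ici (a := η))
    exact hcomp.of_isClosed_subset hcl Set.inter_subset_left
  have hF : ContinuousOn (fun p : Pt d × ℝ => |Φ (g p.1) - Φ p.2|) K :=
    (((hΦ.comp_continuousOn hgc).sub (hΦ.comp_continuousOn continuousOn_snd)).abs).mono
      Set.inter_subset_left
  rcases K.eq_empty_or_nonempty with hE | hne
  · refine ⟨1, one_pos, fun x hx v hv hd => ?_⟩
    have : (x, v) ∈ K := ⟨⟨hx, abs_le.mp hv⟩, hd⟩
    rw [hE] at this
    exact this.elim
  · obtain ⟨p, hp, hmin⟩ := hKc.exists_isMinOn hne hF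
    refine ⟨|Φ (g p.1) - Φ p.2|, abs_pos.mpr fun h => ?_, fun x hx v hv hd =>
      hmin (show (x, v) ∈ K from ⟨⟨hx, abs_le.mp hv⟩, hd⟩)⟩
    have hv := hinj p.1 hp.1.1 p.2 (sub_eq_zero.mp h).symm
    have h2 : η ≤ |g p.1 - p.2| := hp.2
    rw [hv, sub_self, abs_zero] at h2
    linarith

end Consistency

end LNN

end

/-! ### Both convergences in measure. -/

theorem lemma3p4 {Ω : Type*} [MeasurableSpace Ω] (μ : Measure Ω) [IsProbabilityMeasure μ]
    {d q : ℕ} (hd : 1 ≤ d) (hq : 1 ≤ q) (a s C c : ℝ) (ha : 0 < a) (hs : 0 < s) (hs' : s ≤ 1)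
    -- the regression function and the activation function
    (g : LNN.Pt d → ℝ) (hg : LNN.IsSmooth a q s C c g)
    (σ : ℝ → ℝ) (u : ℝ) (hσ : LNN.IsActivation q σ u)
    (W : Matrix (Fin (d + 1)) (Fin (LNN.dimPoly d q)) ℝ) (hW : LNN.IsDesign W)
    -- the data
    (X : ℤ → Ω → LNN.Pt d) (ε : ℤ → Ω → ℝ) (f : LNN.Pt d → ℝ) (φ : ℝ → ℝ)
    (hdata : LNN.IsDataProcess μ a X ε f φ)
    (hΦg : ∃ κ : ℝ, 0 < κ ∧ ∀ x ∈ LNN.box d a,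
      κ ≤ (1 - LNN.errorCDF μ ε (g x)) * LNN.errorCDF μ ε (g x))
    -- the number of cubes per axis, `h = a / M T`: `h → 0` and `T h ^ d → ∞`
    (M : ℕ → ℕ) (hM : Tendsto M atTop atTop)
    (hTh : Tendsto (fun T : ℕ => (T : ℝ) * (a / M T) ^ d) atTop atTop)
    -- the bound on the candidates; `B = ∞` means no bound
    (B : ℝ≥0∞) (hB : ∀ x ∈ LNN.box d a, ‖g x‖ₑ ≤ B)
    -- the estimator, a maximizer of the likelihood with probability tending to one
    (Θhat : ∀ T : ℕ, Ω → LNN.Param d q (M T))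
    (hΘ : Tendsto (fun T => μ {ω | ¬ LNN.IsMLE μ a g X ε σ u W B T ω (Θhat T ω)}) atTop (𝓝 0)) :
    TendstoInMeasure μ
      (fun (T : ℕ) (ω : Ω) => (1 / (T : ℝ)) * ∑ t ∈ LNN.sampleTimes a X T ω,
        (LNN.errorCDF μ ε (g (X t ω)) -
          LNN.errorCDF μ ε (LNN.net a σ u W (Θhat T ω) (X t ω))) ^ 2)
      atTop (fun _ => (0 : ℝ)) ∧
    (B ≠ ∞ →
      (∀ x ∈ LNN.box d a, ∀ v : ℝ, LNN.errorCDF μ ε v = LNN.errorCDF μ ε (g x) → v = g x) →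
      TendstoInMeasure μ
        (fun (T : ℕ) (ω : Ω) => (1 / (T : ℝ)) * ∑ t ∈ LNN.sampleTimes a X T ω,
          (g (X t ω) - LNN.net a σ u W (Θhat T ω) (X t ω)) ^ 2)
        atTop (fun _ => (0 : ℝ))) := by
  obtain ⟨κ, hκ, hG⟩ := hΦg
  have hgc : ContinuousOn g (LNN.box d a) := hg.contDiffOn.continuousOn
  have hloss := fun {e : ℝ} (he : 0 < e) =>
    LNN.tendsto_measure_loss ha hq hgc hσ hW hdata hκ hG hM hTh hB hΘ he
  have habs : ∀ (T : ℕ) (A : Finset ℕ) (v : ℕ → ℝ),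
      ‖1 / (T : ℝ) * ∑ t ∈ A, v t ^ 2 - 0‖ = 1 / (T : ℝ) * ∑ t ∈ A, v t ^ 2 := fun T A v => by
    rw [sub_zero, Real.norm_eq_abs, abs_of_nonneg]
    positivity
  refine ⟨?_, fun hBtop hinj => ?_⟩
  · rw [tendstoInMeasure_iff_norm]
    intro e he
    simp_rw [habs]
    exact hloss he
  · rw [tendstoInMeasure_iff_norm]
    intro e he
    simp_rw [habs]
    set b := B.toReal with hb
    have hb0 : 0 ≤ b := ENNReal.toReal_nonneg
    have hleb : ∀ v : ℝ, ‖v‖ₑ ≤ B → |v| ≤ b := fun v hv => by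
      have := ENNReal.toReal_mono hBtop hv
      simpa using this
    obtain ⟨δ, hδ, hsep⟩ := LNN.exists_le_abs_sub_of_le_abs_sub
      hdata.uniformContinuous_errorCDF.continuous hgc hinj b
      (Real.sqrt_pos.mpr (half_pos he))
    -- A squared error never exceeds `(2b)²`, and an error of size `√(e / 2)` or more forces a
    -- probability gap of at least `δ`. With this `R` every squared error is at most `e / 2` plus
    -- `R` times the squared gap; the `+ 1` keeps `R` positive when `b = 0`.
    set R : ℝ := (2 * b) ^ 2 / δ ^ 2 + 1 with hR
    have hR0 : 0 < R := by positivity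
    have hsum := hΘ.add (hloss (e := e / 2 / R) (by positivity))
    rw [add_zero] at hsum
    refine tendsto_of_tendsto_of_tendsto_of_le_of_le' tendsto_const_nhds hsum
      (Eventually.of_forall fun T => zero_le) ?_
    filter_upwards [hM.eventually_gt_atTop 0, eventually_gt_atTop 0] with T hMpos hT
    have hT' : (0 : ℝ) < T := by exact_mod_cast hT
    have hsub : {ω | e ≤ 1 / (T : ℝ) * ∑ t ∈ LNN.sampleTimes a X T ω,
        (g (X t ω) - LNN.net a σ u W (Θhat T ω) (X t ω)) ^ 2} ⊆
        ({ω | ¬ LNN.IsMLE μ a g X ε σ u W B T ω (Θhat T ω)} ∪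
        {ω | e / 2 / R ≤ (1 / (T : ℝ)) * ∑ t ∈ LNN.sampleTimes a X T ω,
          (LNN.errorCDF μ ε (g (X t ω)) -
            LNN.errorCDF μ ε (LNN.net a σ u W (Θhat T ω) (X t ω))) ^ 2}) ∪
        {ω | ∃ t : ℕ, X t ω ∈ LNN.walls d a (M T)} := by
      intro ω hω
      by_contra hnot
      simp only [Set.mem_union, Set.mem_ofPred_eq, not_or, not_not, not_le, not_exists]
        at hnot hω
      obtain ⟨⟨hmle, hlt⟩, hw⟩ := hnot
      have hpt : ∀ t ∈ LNN.sampleTimes a X T ω,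
          (g (X t ω) - LNN.net a σ u W (Θhat T ω) (X t ω)) ^ 2 ≤ e / 2 +
            R * (LNN.errorCDF μ ε (g (X t ω)) -
              LNN.errorCDF μ ε (LNN.net a σ u W (Θhat T ω) (X t ω))) ^ 2 := by
        intro t ht
        have hx : X t ω ∈ LNN.box d a := LNN.mem_box_of_mem_sampleTimes ht
        -- With `m = 1` the cells are the half-open cubes themselves, enough to locate the single
        -- local network in force, which is bounded by `B` because the estimate is a candidate.
        obtain ⟨I, hI⟩ := LNN.exists_mem_cell ha hMpos one_pos hx (hw t)
        have hv : |LNN.net a σ u W (Θhat T ω) (X t ω)| ≤ b := by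
          rw [LNN.net_eq_lin ha hMpos one_pos σ u W _ (hw t) hI]
          exact hleb _ (hmle.1 _ _ (LNN.cell_subset_cube ha hMpos one_pos I hI))
        have hgx := hleb _ (hB _ hx)
        set v := LNN.net a σ u W (Θhat T ω) (X t ω)
        rcases lt_or_ge |g (X t ω) - v| (Real.sqrt (e / 2)) with hl | hl
        · have h1 : (g (X t ω) - v) ^ 2 ≤ e / 2 := by
            rw [← sq_abs, ← Real.sq_sqrt (half_pos he).le]
            exact pow_le_pow_left₀ (abs_nonneg _) hl.le 2
          have h2 : 0 ≤ R * (LNN.errorCDF μ ε (g (X t ω)) - LNN.errorCDF μ ε v) ^ 2 := by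
            positivity
          linarith
        · have h1 := hsep _ hx v hv hl
          have h2 : δ ^ 2 ≤ (LNN.errorCDF μ ε (g (X t ω)) - LNN.errorCDF μ ε v) ^ 2 := by
            rw [← sq_abs (_ - _)]
            exact pow_le_pow_left₀ hδ.le h1 2
          have h3 : (g (X t ω) - v) ^ 2 ≤ (2 * b) ^ 2 := by
            rw [← sq_abs]
            refine pow_le_pow_left₀ (abs_nonneg _) ((abs_sub _ _).trans (by linarith)) 2
          have h4 : (2 * b) ^ 2 ≤ R * δ ^ 2 := by
            rw [hR, add_mul, div_mul_cancel₀ _ (by positivity)]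
            nlinarith [sq_nonneg δ]
          have h5 := mul_le_mul_of_nonneg_left h2 hR0.le
          linarith
      have hcard := LNN.card_sampleTimes_le (a := a) (X := X) T ω
      have hle := Finset.sum_le_sum hpt
      rw [Finset.sum_add_distrib, Finset.sum_const, nsmul_eq_mul, ← Finset.mul_sum] at hle
      rw [one_div, inv_mul_eq_div, le_div_iff₀ hT'] at hω
      rw [one_div, inv_mul_eq_div, div_lt_iff₀ hT'] at hlt
      have k1 := mul_lt_mul_of_pos_left hlt hR0
      have k2 : R * (e / 2 / R * T) = e / 2 * T := by field_simp
      have k3 := mul_le_mul_of_nonneg_right hcard (half_pos he).le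
      linarith
    refine (measure_mono hsub).trans ((measure_union_le _ _).trans ?_)
    rw [hdata.measure_exists_walls_eq_zero, add_zero]
    exact measure_union_le _ _
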